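/- **Setting.** Let $m$ be a measure on $\mathbb{R}$ with $m(\{0\})=0$ and $\int 1\wedge x^2\,dm<\infty$, and let $b\in\mathbb{R}$. For each $n\ge 1$ let $A_n=(A^{(n)}_{ij})_{i,j=1}^n$ be a real symmetric random matrix with zero diagonal whose entries above the diagonal are i.i.d. (all $A_n$ being defined on one probability space, with an arbitrary joint law of different sizes), and suppose that $\{A_n\}$ is a Lévy–Khintchine ensemble with characteristics $(0,b,m)$: $\sum_{j=1}^n A^{(n)}_{1j}$ converges in distribution, as $n\to\infty$, to a random variable $Y$ with $$\mathbb{E}e^{itY}=\exp\Big(itb+\int_{\mathbb{R}}\Big(e^{itx}-1-\frac{itx}{1+x^2}\Big)dm(x)\Big)\qquad(t\in\mathbb{R}).$$ Suppose moreover that Condition **C1** holds: * $\int_{\mathbb{R}\setminus\{0\}}|x|\wedge 1\,dm(x)<\infty$; * if $V_{1,n}\ge V_{2,n}\ge\dots\ge V_{n-1,n}$ are the order statistics of $|A^{(n)}_{2n}|,\dots,|A^{(n)}_{nn}|$ (and $V_{n,n}:=0$), then almost surely $\lim_{k\to\infty}\sup_{n>k}\sum_{i=k+1}^{n}V_{i,n}=0$;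 * there are $\varepsilon>0$ and $C>0$ such that $m(\{|x|\ge t\})\le Ct^{-\varepsilon}$ and $n\,\mathbb{P}(|A^{(n)}_{12}|\ge t)\le Ct^{-\varepsilon}$ for all $t>1/4$ and all $n\ge2$. Let $L_n=A_n-D_n$, where $D_n$ is the diagonal matrix with $(D_n)_{ii}=\sum_{j}A^{(n)}_{ij}$. **The limit operator.** Let $\mathbb{N}^f=\bigcup_{k\ge0}\mathbb{N}^k$ be the set of finite words, with the empty word $\varnothing$, viewed as a rooted tree in which the children of $v$ are $v1,v2,\dots$. Let $(y_{vk})_{k\ge1}$, $v\in\mathbb{N}^f$, be independent random sequences such that, for each $v$, $|y_{v1}|\ge|y_{v2}|\ge\cdots$ almost surely and the non-zero $y_{vk}$ are the points of a Poisson point process on $\mathbb{R}\setminus\{0\}$ with intensity measure $m$ (so $y_{vk}=0$ for $k$ larger than the number of points; points of equal absolute value may be ordered in any way). The Poisson weighted infinite tree with loops $\mathbf{PWITL}(m)$ has weight $y_{vk}$ on the edge $\{v,vk\}$ and weight $y_{vv}=-y_{ul}-\sum_{k\ge1}y_{vk}$ on the loop at $v=ul\neq\varnothing$, and $y_{\varnothing\varnothing}=-\sum_{k\ge1}y_k$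 on the loop at the root. Its associated operator $L$ on $\ell^2(\mathbb{N}^f)$, with domain the space $\mathcal{D}(\mathbb{N}^f)$ of finitely supported vectors, is given (almost surely) by $\langle\delta_v,L\delta_{vk}\rangle=\langle\delta_{vk},L\delta_v\rangle=y_{vk}$, $\langle\delta_v,L\delta_v\rangle=y_{vv}$, and $\langle\delta_v,L\delta_u\rangle=0$ for all other $u,v$. Regard an $n\times n$ matrix $M$ as the bounded operator on $\ell^2(\mathbb{N}^f)$ with $\langle\delta_i,M\delta_j\rangle=M_{ij}$ for the one-letter words $1\le i,j\le n$ and $\langle\delta_u,M\delta_v\rangle=0$ otherwise. A bijection $\sigma$ of $\mathbb{N}^f$ acts on $\ell^2(\mathbb{N}^f)$ as the unitary operator with $\sigma\delta_v=\delta_{\sigma(v)}$. **Theorem 5.1.** The pair $(L_n,1)$ converges locally in distribution to $(L,\varnothing)$. That is, there are random bijections $\sigma_n:\mathbb{N}^f\to\mathbb{N}^f$ (defined on a possibly enlarged probability space) such that $\sigma_n(\varnothing)=1$ for every $n$ and, for every $\phi\in\mathcal{D}(\mathbb{N}^f)$, $$\sigma_n^{-1}L_n\sigma_n\phi\longrightarrow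 L\phi\qquad\text{in distribution in }\ell^2(\mathbb{N}^f),\text{ as }n\to\infty.$$ -/

import Mathlib

open MeasureTheory ProbabilityTheory Filter Topology
open scoped ENNReal NNReal

noncomputable section

/-! ### Lévy–Khintchine ensembles -/

/-- The characteristic function of an infinitely divisible law with characteristics
`(σ², b, m)`. -/
def levyKhintchineCharFun (sigmaSq : ℝ≥0) (b : ℝ) (m : Measure ℝ) (t : ℝ) : ℂ :=
  Complex.exp (-(1 / 2) * (t : ℂ) ^ 2 * ((sigmaSq : ℝ) : ℂ) + Complex.I * t * b +
    ∫ x : ℝ, (Complex.exp (Complex.I * t * x) - 1 - Complex.I * t * x / (1 + (x : ℂ) ^ 2)) ∂m)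

/-- A Lévy–Khintchine random matrix ensemble with characteristics `(σ², b, m)`; all the matrices
live on one probability space, with no restriction on the joint law of different sizes. -/
structure IsLevyKhintchineEnsemble {Ω : Type*} [MeasurableSpace Ω]
    (P : Measure Ω) [IsProbabilityMeasure P]
    (A : (n : ℕ) → Ω → Matrix (Fin n) (Fin n) ℝ)
    (sigmaSq : ℝ≥0) (b : ℝ) (m : Measure ℝ) : Prop where
  measurable_entry : ∀ n i j, Measurable fun ω => A n ω i j
  symm : ∀ n ω, (A n ω).IsSymm
  diag_zero : ∀ n ω i, A n ω i i = 0
  indep : ∀ n, iIndepFun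
    (fun (p : {p : Fin n × Fin n // p.1 < p.2}) ω => A n ω p.1.1 p.1.2) P
  identDistrib : ∀ n (p q : {p : Fin n × Fin n // p.1 < p.2}),
    IdentDistrib (fun ω => A n ω p.1.1 p.1.2) (fun ω => A n ω q.1.1 q.1.2) P P
  measure_zero : m {0} = 0
  lintegral_sq_lt_top : ∫⁻ x : ℝ, min 1 (ENNReal.ofReal (|x| ^ 2)) ∂m < ∞
  /-- The sums of the first rows converge in distribution to a random variable `Y` (the identity
  of the probability space `(ℝ, ν)`) with the required characteristic function. -/
  rowSum_tendsto : ∃ (ν : Measure ℝ) (_ : IsProbabilityMeasure ν),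
    (∀ t : ℝ, charFun ν t = levyKhintchineCharFun sigmaSq b m t) ∧
    TendstoInDistribution (fun (n : ℕ) ω => ∑ j, A (n + 1) ω 0 j) atTop (id : ℝ → ℝ)
      (fun _ => P) ν

/-- The absolute values of the entries `2, …, n` of the last column of an `n × n` matrix
(rows are numbered from `0` in the code), sorted in non-increasing order:
the list `[V₁, V₂, …, V_{n-1}]`. -/
def columnOrderStatistics {n : ℕ} (M : Matrix (Fin n) (Fin n) ℝ) : List ℝ :=
  ((Finset.univ.filter fun i : Fin n => 1 ≤ (i : ℕ)).val.map
    fun i => |M i ⟨n - 1, by have := i.isLt; omega⟩|).sort (· ≥ ·)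

/-- Condition C1. -/
structure ConditionC1 {Ω : Type*} [MeasurableSpace Ω] (P : Measure Ω)
    (A : (n : ℕ) → Ω → Matrix (Fin n) (Fin n) ℝ) (m : Measure ℝ) : Prop where
  lintegral_abs_lt_top : ∫⁻ x : ℝ, min (ENNReal.ofReal |x|) 1 ∂m < ∞
  /-- Almost surely `sup_{n > k} ∑_{i > k} V_{i,n} → 0` as `k → ∞`. -/
  uniformly_summable : ∀ᵐ ω ∂P, Tendsto
    (fun k : ℕ => ⨆ (n : ℕ) (_ : k < n),
      ENNReal.ofReal ((columnOrderStatistics (A n ω)).drop k).sum) atTop (𝓝 0)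
  tail : ∃ ε > (0 : ℝ), ∃ C > (0 : ℝ), ∀ t : ℝ, 1 / 4 < t →
    m {x | t ≤ |x|} ≤ ENNReal.ofReal (C * t ^ (-ε)) ∧
    ∀ (n : ℕ) (hn : 2 ≤ n),
      (n : ℝ≥0∞) * P {ω | t ≤ |A n ω ⟨0, by omega⟩ ⟨1, by omega⟩|} ≤
        ENNReal.ofReal (C * t ^ (-ε))

/-- The Laplacian-type matrix `M - D`, where `D` is the diagonal matrix of row sums of `M`. -/
def laplacianMatrix {n : ℕ} (M : Matrix (Fin n) (Fin n) ℝ) : Matrix (Fin n) (Fin n) ℝ :=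
  M - Matrix.diagonal fun i => ∑ j, M i j

/-! ### Operators on `ℓ²(V)` and local convergence -/

/-- The complex Hilbert space `ℓ²(V)`. -/
abbrev EllTwo (V : Type*) : Type _ := lp (fun _ : V => ℂ) 2

instance EllTwo.instMeasurableSpace (V : Type*) : MeasurableSpace (EllTwo V) := borel _

instance EllTwo.instBorelSpace (V : Type*) : BorelSpace (EllTwo V) := ⟨rfl⟩

/-- The unit vector `δ_v`. -/
def delta {V : Type*} (v : V) : EllTwo V :=
  letI := Classical.decEq V
  lp.single 2 v (1 : ℂ)

/-- `𝒟(V)`: the finitely supported vectors. -/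
def finSupported (V : Type*) : Submodule ℂ (EllTwo V) where
  carrier := {φ | (Function.support (φ : V → ℂ)).Finite}
  zero_mem' := by
    change (Function.support fun _ : V => (0 : ℂ)).Finite
    simp
  add_mem' := by
    intro φ ψ hφ hψ
    refine (Set.Finite.union hφ hψ).subset ?_
    intro u hu
    by_contra h
    simp only [Set.mem_union, Function.mem_support, not_or, not_not] at h
    apply hu
    change (φ : V → ℂ) u + (ψ : V → ℂ) u = 0
    rw [h.1, h.2, add_zero]
  smul_mem' := by
    intro c φ hφ
    refine Set.Finite.subset hφ ?_
    intro u hu h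
    simp [h] at hu

theorem memℓp_comp_equiv {V : Type*} (e : Equiv.Perm V) (φ : EllTwo V) :
    Memℓp (fun u => (φ : V → ℂ) (e u)) 2 := by
  have h := lp.memℓp φ
  rw [memℓp_gen_iff (by norm_num)] at h ⊢
  exact (Equiv.summable_iff e).mpr h

/-- The unitary operator of `ℓ²(V)` induced by a bijection `σ` of `V`: it maps `δ_v` to
`δ_{σ v}`. -/
def permUnitary {V : Type*} (σ : Equiv.Perm V) : EllTwo V ≃ₗᵢ[ℂ] EllTwo V where
  toFun φ := ⟨fun u => (φ : V → ℂ) (σ.symm u), memℓp_comp_equiv σ.symm φ⟩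
  invFun φ := ⟨fun u => (φ : V → ℂ) (σ u), memℓp_comp_equiv σ φ⟩
  map_add' φ ψ := rfl
  map_smul' c φ := rfl
  left_inv φ := by ext u; simp
  right_inv φ := by ext u; simp
  norm_map' φ := by
    rw [lp.norm_eq_tsum_rpow (by norm_num), lp.norm_eq_tsum_rpow (by norm_num)]
    congr 1
    exact Equiv.tsum_eq σ.symm (fun u => ‖(φ : V → ℂ) u‖ ^ (2 : ℝ≥0∞).toReal)

/-- Local convergence in distribution of random bounded operators `(A_n, u)` to a random, possibly
unbounded, operator `(L, v)` whose domain contains the finitely supported vectors: there are random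
bijections `σ_n` of `V` with `σ_n v = u` such that `σ_n⁻¹ A_n σ_n φ` converges in distribution, as
a random element of `ℓ²(V)`, to `L φ`, for each finitely supported `φ`.
The random bijections may use additional randomness, that is, they live on an extension
`π : (Ω₀, Q) → (Ω, P)` of the probability space of the `A_n`. So the notion depends only on the
laws of the operators. -/
def LocallyConvergesInDistribution.{u, v, w} {Ω : Type u} [MeasurableSpace Ω] (P : Measure Ω)
    {Ω' : Type v} [MeasurableSpace Ω'] (P' : Measure Ω') [IsProbabilityMeasure P']
    {V : Type w}
    (A : ℕ → Ω → (EllTwo V →L[ℂ] EllTwo V)) (u : V)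
    (L : Ω' → (EllTwo V →ₗ.[ℂ] EllTwo V)) (v : V) : Prop :=
  ∃ hdom : ∀ ω', finSupported V ≤ (L ω').domain,
  ∃ (Ω₀ : Type u) (_ : MeasurableSpace Ω₀) (Q : Measure Ω₀) (_ : IsProbabilityMeasure Q)
    (π : Ω₀ → Ω) (σ : ℕ → Ω₀ → Equiv.Perm V),
    MeasurePreserving π Q P ∧
    (∀ n x z, MeasurableSet {ω | σ n ω x = z}) ∧
    (∀ n ω, σ n ω v = u) ∧
    ∀ (φ : EllTwo V) (hφ : φ ∈ finSupported V),
      TendstoInDistribution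
        (fun n ω => (permUnitary (σ n ω)).symm (A n (π ω) (permUnitary (σ n ω) φ))) atTop
        (fun ω' => L ω' ⟨φ, hdom ω' hφ⟩) (fun _ => Q) P'

/-- The linear operator with domain `𝒟(V)` given by a matrix of weights,
`⟨δ_u, T δ_v⟩ = w u v`. It is meant for weights with square summable columns; a column that is not
square summable is replaced by `0`. -/
def weightOperator {V : Type*} (w : V → V → ℝ) : EllTwo V →ₗ.[ℂ] EllTwo V :=
  letI col : V → EllTwo V := fun v =>
    open Classical in
    if h : Memℓp (fun u => (w u v : ℂ)) 2 then ⟨fun u => (w u v : ℂ), h⟩ else 0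
  { domain := finSupported V
    toFun :=
      { toFun := fun φ => ∑ᶠ v, ((φ : EllTwo V) : V → ℂ) v • col v
        map_add' := by
          intro φ ψ
          rw [← finsum_add_distrib]
          · exact finsum_congr fun v => by simp [add_smul]
          · exact Set.Finite.subset φ.2 fun v hv h => hv (by simp [h])
          · exact Set.Finite.subset ψ.2 fun v hv h => hv (by simp [h])
        map_smul' := by
          intro c φ
          rw [RingHom.id_apply, smul_finsum']
          · exact finsum_congr fun v => by simp [mul_smul]
          · exact Set.Finite.subset φ.2 fun v hv h => hv (by simp [h]) } }

/-! ### The Poisson weighted infinite tree with loops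

The vertex set `ℕ^f` of finite words is `List ℕ`. The root is `[]`, letters are numbered from `0`,
and the list of a vertex starts with its last letter, so the `k`-th child of `v` is `k :: v`. -/

/-- An `n × n` matrix as a bounded operator on `ℓ²(ℕ^f)`, with the index `i` identified with
the one-letter word `i`. -/
def matrixOperator {n : ℕ} (M : Matrix (Fin n) (Fin n) ℝ) :
    EllTwo (List ℕ) →L[ℂ] EllTwo (List ℕ) :=
  ∑ i, ∑ j, (M i j : ℂ) • (innerSL ℂ (delta [(j : ℕ)])).smulRight (delta [(i : ℕ)])

/-- `ξ` is a Poisson point process with intensity measure `m`. -/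
structure IsPoissonPointProcess {Ω E : Type*} [MeasurableSpace Ω] [MeasurableSpace E]
    (P : Measure Ω) (m : Measure E) (ξ : Ω → Measure E) : Prop where
  measurable_apply : ∀ B, MeasurableSet B → Measurable fun ω => ξ ω B
  law_of_ne_top : ∀ B, MeasurableSet B → m B ≠ ∞ →
    P.map (fun ω => ξ ω B) = (poissonMeasure (m B).toNNReal).map (fun j : ℕ => (j : ℝ≥0∞))
  eq_top_of_eq_top : ∀ B, MeasurableSet B → m B = ∞ → ∀ᵐ ω ∂P, ξ ω B = ∞
  indep : ∀ (r : ℕ) (B : Fin r → Set E), (∀ i, MeasurableSet (B i)) →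
    Pairwise (Function.onFun Disjoint B) → iIndepFun (fun i ω => ξ ω (B i)) P

/-- `y` is a realization of the edge weights of the Poisson weighted infinite tree with
intensity `m`: `y v k` is the weight of the edge between `v` and its `k`-th child. For each `v`
the non-zero terms of `(y v k)_k` are the points of a Poisson point process on `ℝ \ {0}`, ordered by
non-increasing absolute value (in any way in case of ties), and these ordered sequences are
independent. -/
structure IsPWIT {Ω : Type*} [MeasurableSpace Ω] (P : Measure Ω) (m : Measure ℝ)
    (y : List ℕ → ℕ → Ω → ℝ) : Prop where
  measurable : ∀ v k, Measurable (y v k)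
  antitone_abs : ∀ᵐ ω ∂P, ∀ v, Antitone fun k => |y v k ω|
  indep : iIndepFun (fun v ω k => y v k ω) P
  poisson : ∀ v, IsPoissonPointProcess P m
    fun ω => (Measure.sum fun k => Measure.dirac (y v k ω)).restrict {0}ᶜ

/-- The weight of the edge from a vertex to its parent (`0` for the root). -/
def parentWeight (y : List ℕ → ℕ → ℝ) : List ℕ → ℝ
  | [] => 0
  | k :: v => y v k

/-- The weight of the loop at `v`: minus the sum of the weights of the edges at `v`. -/
def loopWeight (y : List ℕ → ℕ → ℝ) (v : List ℕ) : ℝ :=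
  -parentWeight y v - ∑' k, y v k

open Classical in
/-- The weights of all the edges and loops of the tree with loops. -/
def pwitlWeight (y : List ℕ → ℕ → ℝ) (u v : List ℕ) : ℝ :=
  if u = v then loopWeight y v
  else if ∃ k, u = k :: v then parentWeight y u
  else if ∃ k, v = k :: u then parentWeight y v
  else 0

/-- The operator associated to the Poisson weighted infinite tree with loops. -/
def pwitlOperator (y : List ℕ → ℕ → ℝ) : EllTwo (List ℕ) →ₗ.[ℂ] EllTwo (List ℕ) :=
  weightOperator (pwitlWeight y)

end

/-! The matrix looks locally like the tree because a row of a large matrix looks like a Poisson process.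

Condition C1 makes the truncated first moments of the entries uniformly small after multiplication by
the size (`exists_integral_min_le`): otherwise, by independence, the sum of all but the `k` largest
entries of a column could not be small with probability one half. So row sums are asymptotically
compound Poisson, and their convergence gives the convergence of the exponents of the Lévy–Khintchine
formula up to a drift (`tendsto_levyExponent_of_tendsto_charFun_pow`). Second differences in the
frequency remove the drift and turn the exponents into characteristic functions of finite measures, so
that `n` times the law of an entry converges to `m` away from the origin (`tendsto_entryLaw`).
Therefore the numbers of entries of a row in finitely many cells are asymptotically independent and
Poisson (`tendsto_labelCount_poisson`).

A word of the tree is represented by the cells, or labels, of the weights of its first `K` children.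
Given the multiplicities of the labels in a row of the matrix, the sequence of labels of the children is
drawn from its conditional law in the tree, and the children are matched with entries of the same
labels. Thus any rule for ordering weights of equal absolute value is admissible. The
first `t` words are placed one after the other at vertices of the matrix. The placement of a word
depends only on the rows seen before, and entries that have been seen already are replaced by fresh
copies. So the rows seen in this adaptive exploration are i.i.d. (`exists_exploration`, by
`measurePreserving_of_unique`), and their labels are close in total variation to those of the tree
(`sum_abs_jointLabels_sub_le`).

Unless an exceptional event of small probability occurs, the relabelled matrix and the operator of the
tree are both close to the operator of the same tree with quantized weights
(`norm_conj_matrixOperator_sub_le`, `norm_pwitlOperator_sub_quantizedWeight_le`). All columns have sum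
zero, so the error on the diagonal is at most the `ℓ¹` error off the diagonal, and the `ℓ¹` norm
dominates the `ℓ²` norm; this is where the smallness of the truncated first moments enters.

This yields, for each number of words and each precision, relabellings of all large matrices
(`eventually_exists_coupling`). A diagonal choice of both parameters, with independent auxiliary
randomness for each size, gives the random bijections. -/

noncomputable section

/-! ### Truncated first moments and Lévy exponents -/

/-- The measure has finite truncated first moment. -/
def HasTruncatedMoment (M : Measure ℝ) : Prop :=
  Integrable (fun x : ℝ => min |x| 1) M

theorem hasTruncatedMoment_of_isFiniteMeasure (M : Measure ℝ) [IsFiniteMeasure M] :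
    HasTruncatedMoment M := by
  refine Integrable.of_bound (C := 1) (by fun_prop) (ae_of_all _ fun x => ?_)
  rw [Real.norm_of_nonneg (le_min (abs_nonneg x) zero_le_one)]
  exact min_le_right _ _

theorem norm_cexp_mul_I_sub_one_le (u : ℝ) : ‖Complex.exp (u * Complex.I) - 1‖ ≤ min |u| 2 := by
  refine le_min ?_ ?_
  · rw [mul_comm]
    exact Real.norm_exp_I_mul_ofReal_sub_one_le
  · calc ‖Complex.exp (u * Complex.I) - 1‖ ≤ ‖Complex.exp (u * Complex.I)‖ + ‖(1 : ℂ)‖ :=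
        norm_sub_le _ _
      _ = 2 := by rw [Complex.norm_exp_ofReal_mul_I, norm_one]; norm_num

theorem norm_cexp_sub_cexp_le (t s x : ℝ) :
    ‖Complex.exp (t * x * Complex.I) - Complex.exp (s * x * Complex.I)‖ ≤
      min (|t - s| * |x|) 2 := by
  have h : Complex.exp (t * x * Complex.I) - Complex.exp (s * x * Complex.I) =
      Complex.exp ((s * x : ℝ) * Complex.I) * (Complex.exp (((t - s) * x : ℝ) * Complex.I) - 1) := by
    rw [mul_sub, ← Complex.exp_add, mul_one]
    push_cast
    congr 2
    ring
  rw [h, norm_mul, Complex.norm_exp_ofReal_mul_I, one_mul, ← abs_mul]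
  exact norm_cexp_mul_I_sub_one_le _

theorem min_mul_two_le (c x : ℝ) (hc : 0 ≤ c) : min (c * |x|) 2 ≤ (c + 2) * min |x| 1 := by
  rcases le_total |x| 1 with h | h
  · rw [min_eq_left h]
    exact (min_le_left _ _).trans (by nlinarith [abs_nonneg x])
  · rw [min_eq_right h]
    exact (min_le_right _ _).trans (by linarith)

/-- The drift-free Lévy exponent `t ↦ ∫ (e^{itx} - 1) dM(x)`. -/
def levyExponent (M : Measure ℝ) (t : ℝ) : ℂ := ∫ x : ℝ, (Complex.exp (t * x * Complex.I) - 1) ∂M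

theorem integrable_cexp_sub_cexp {M : Measure ℝ} (hM : HasTruncatedMoment M) (t s : ℝ) :
    Integrable (fun x : ℝ => Complex.exp (t * x * Complex.I) - Complex.exp (s * x * Complex.I)) M := by
  refine Integrable.mono' (hM.const_mul (|t - s| + 2)) (by fun_prop) (ae_of_all _ fun x => ?_)
  exact (norm_cexp_sub_cexp_le t s x).trans (min_mul_two_le _ _ (abs_nonneg _))

theorem integrable_cexp_sub_one {M : Measure ℝ} (hM : HasTruncatedMoment M) (t : ℝ) :
    Integrable (fun x : ℝ => Complex.exp (t * x * Complex.I) - 1) M := by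
  simpa using integrable_cexp_sub_cexp hM t 0

theorem levyExponent_sub {M : Measure ℝ} (hM : HasTruncatedMoment M) (t s : ℝ) :
    levyExponent M t - levyExponent M s =
      ∫ x : ℝ, (Complex.exp (t * x * Complex.I) - Complex.exp (s * x * Complex.I)) ∂M := by
  rw [levyExponent, levyExponent,
    ← integral_sub (integrable_cexp_sub_one hM t) (integrable_cexp_sub_one hM s)]
  simp

theorem norm_levyExponent_le {M : Measure ℝ} (hM : HasTruncatedMoment M) (t : ℝ) :
    ‖levyExponent M t‖ ≤ (|t| + 2) * ∫ x, min |x| 1 ∂M := by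
  rw [← integral_const_mul]
  refine norm_integral_le_of_norm_le (hM.const_mul _) (ae_of_all _ fun x => ?_)
  have := norm_cexp_sub_cexp_le t 0 x
  simp only [Complex.ofReal_zero, zero_mul, Complex.exp_zero, sub_zero] at this
  exact this.trans (min_mul_two_le _ _ (abs_nonneg _))

theorem measurableSet_le_abs (R : ℝ) : MeasurableSet {x : ℝ | R ≤ |x|} :=
  measurableSet_le measurable_const measurable_id.abs

theorem measure_le_abs_lt_top {M : Measure ℝ} (hM : HasTruncatedMoment M) {R : ℝ} (hR : 0 < R) :
    M {x | R ≤ |x|} < ∞ := by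
  have h := Integrable.measure_ge_lt_top hM (ε := min R 1) (lt_min hR one_pos)
  exact (measure_mono fun x (hx : R ≤ |x|) => min_le_min_right _ hx).trans_lt h

/-- Modulus of continuity of a Lévy exponent, in terms of the truncated moment and the tail. -/
theorem norm_levyExponent_sub_le {M : Measure ℝ} (hM : HasTruncatedMoment M) {R : ℝ} (hR : 1 ≤ R)
    (t s : ℝ) :
    ‖levyExponent M t - levyExponent M s‖ ≤
      |t - s| * R * ∫ x, min |x| 1 ∂M + 2 * M.real {x | R ≤ |x|} := by
  have hfin := (measure_le_abs_lt_top hM (zero_lt_one.trans_le hR)).ne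
  have hint : Integrable (({x : ℝ | R ≤ |x|}).indicator fun _ => (2 : ℝ)) M :=
    (integrable_indicator_iff (measurableSet_le_abs R)).2
      (integrableOn_const hfin)
  have h2 : 2 * M.real {x | R ≤ |x|} = ∫ x, ({x : ℝ | R ≤ |x|}).indicator (fun _ => (2 : ℝ)) x ∂M := by
    rw [integral_indicator (measurableSet_le_abs R), setIntegral_const, smul_eq_mul, mul_comm]
  rw [levyExponent_sub hM, h2, ← integral_const_mul, ← integral_add (hM.const_mul _) hint]
  refine norm_integral_le_of_norm_le ((hM.const_mul _).add hint) (ae_of_all _ fun x => ?_)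
  refine (norm_cexp_sub_cexp_le t s x).trans ?_
  rcases le_or_gt R |x| with h | h
  · rw [Set.indicator_of_mem (by exact h)]
    have : 0 ≤ |t - s| * R * min |x| 1 := by positivity
    exact (min_le_right _ _).trans (by linarith)
  · rw [Set.indicator_of_notMem (by simpa using h), add_zero, mul_assoc]
    refine (min_le_left _ _).trans (mul_le_mul_of_nonneg_left ?_ (abs_nonneg _))
    rcases le_total |x| 1 with h' | h'
    · rw [min_eq_left h']
      nlinarith [abs_nonneg x]
    · rw [min_eq_right h']
      linarith

/-- Second differences of a Lévy exponent are Fourier transforms of finite measures. -/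
theorem levyExponent_second_difference {M : Measure ℝ} (hM : HasTruncatedMoment M) (t h : ℝ) :
    levyExponent M t - (levyExponent M (t + h) + levyExponent M (t - h)) / 2 =
      ∫ x : ℝ, Complex.exp (t * x * Complex.I) * (1 - Real.cos (h * x) : ℝ) ∂M := by
  have e : levyExponent M t - (levyExponent M (t + h) + levyExponent M (t - h)) / 2 =
      ((levyExponent M t - levyExponent M (t + h)) + (levyExponent M t - levyExponent M (t - h))) / 2 := by
    ring
  rw [e, levyExponent_sub hM, levyExponent_sub hM,
    ← integral_add (integrable_cexp_sub_cexp hM _ _) (integrable_cexp_sub_cexp hM _ _),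
    ← integral_div]
  refine integral_congr_ae (ae_of_all _ fun x => ?_)
  have e1 : Complex.exp (((t + h : ℝ) : ℂ) * x * Complex.I) =
      Complex.exp (t * x * Complex.I) * Complex.exp (h * x * Complex.I) := by
    rw [← Complex.exp_add]
    push_cast
    ring_nf
  have e2 : Complex.exp (((t - h : ℝ) : ℂ) * x * Complex.I) =
      Complex.exp (t * x * Complex.I) * Complex.exp (-(h * x) * Complex.I) := by
    rw [← Complex.exp_add]
    push_cast
    ring_nf
  have e3 : ((Real.cos (h * x) : ℝ) : ℂ) =
      (Complex.exp (h * x * Complex.I) + Complex.exp (-(h * x) * Complex.I)) / 2 := by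
    rw [Complex.ofReal_cos, Complex.cos]
    push_cast
    rfl
  simp only [e1, e2]
  push_cast at e3 ⊢
  rw [e3]
  ring

theorem norm_pow_sub_pow_le_of_norm_le_one {a b : ℂ} (ha : ‖a‖ ≤ 1) (hb : ‖b‖ ≤ 1) (k : ℕ) :
    ‖a ^ k - b ^ k‖ ≤ k * ‖a - b‖ := by
  induction k with
  | zero => simp
  | succ k ih =>
    have e : a ^ (k + 1) - b ^ (k + 1) = a ^ k * (a - b) + (a ^ k - b ^ k) * b := by ring
    rw [e]
    refine (norm_add_le _ _).trans ?_
    rw [norm_mul, norm_mul, norm_pow]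
    have h1 : ‖a‖ ^ k * ‖a - b‖ ≤ 1 * ‖a - b‖ :=
      mul_le_mul_of_nonneg_right (pow_le_one₀ (norm_nonneg _) ha) (norm_nonneg _)
    have h2 : ‖a ^ k - b ^ k‖ * ‖b‖ ≤ (k * ‖a - b‖) * 1 :=
      mul_le_mul ih hb (norm_nonneg _) (by positivity)
    push_cast
    linarith

/-- Compound Poisson approximation: the `k`-th power of the characteristic function of `μ` is close to
the one of a compound Poisson law with Lévy measure `k • μ`. -/
theorem norm_cexp_levyExponent_sub_charFun_pow_le (μ : Measure ℝ) [IsProbabilityMeasure μ]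
    (t : ℝ) (k : ℕ) (h1 : ‖levyExponent μ t‖ ≤ 1) :
    ‖Complex.exp (k * levyExponent μ t) - charFun μ t ^ k‖ ≤ k * ‖levyExponent μ t‖ ^ 2 := by
  have hz : charFun μ t = 1 + levyExponent μ t := by
    have hi : Integrable (fun x : ℝ => Complex.exp (t * x * Complex.I)) μ := by
      refine Integrable.of_bound (C := 1) (by fun_prop) (ae_of_all _ fun x => ?_)
      rw [← Complex.ofReal_mul, Complex.norm_exp_ofReal_mul_I]
    rw [levyExponent, integral_sub hi (integrable_const _), charFun_apply_real]
    simp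
  have hre : (levyExponent μ t).re ≤ 0 := by
    have h := (Complex.re_le_norm (charFun μ t)).trans (norm_charFun_le_one t)
    rw [hz] at h
    simpa using h
  rw [Complex.exp_nat_mul]
  refine (norm_pow_sub_pow_le_of_norm_le_one ?_ (norm_charFun_le_one t) k).trans ?_
  · rw [Complex.norm_exp]
    exact Real.exp_le_one_iff.2 hre
  · refine mul_le_mul_of_nonneg_left ?_ (Nat.cast_nonneg k)
    rw [hz, ← sub_sub]
    exact Complex.norm_exp_sub_one_sub_id_le h1

/-- Convergence of the exponentials of an equicontinuous sequence of functions vanishing at the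
origin forces convergence of the functions themselves: no jump by a multiple of `2πi` can occur. -/
theorem tendsto_zero_of_tendsto_cexp {g : ℕ → ℝ → ℂ} {η : ℝ} (hη : 0 < η)
    (hg0 : ∀ n, g n 0 = 0) (hg : ∀ n t s, |t - s| ≤ η → ‖g n t - g n s‖ ≤ 1)
    (hexp : ∀ t, Tendsto (fun n => Complex.exp (g n t)) atTop (𝓝 1)) (t : ℝ) :
    Tendsto (fun n => g n t) atTop (𝓝 0) := by
  have step : ∀ t s, |t - s| ≤ η → Tendsto (fun n => g n s) atTop (𝓝 0) →
      Tendsto (fun n => g n t) atTop (𝓝 0) := by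
    intro t s hts hs
    have hlog : Tendsto (fun n => Complex.log (Complex.exp (g n t))) atTop (𝓝 0) := by
      have := (hexp t).clog (by simp [Complex.slitPlane])
      simpa using this
    refine hlog.congr' ?_
    filter_upwards [hs.norm.eventually (gt_mem_nhds (show ‖(0 : ℂ)‖ < 1 by simp))] with n hn
    have h2 : ‖g n t‖ ≤ 2 := by
      have := norm_le_norm_add_norm_sub' (g n t) (g n s)
      linarith [hg n t s hts]
    have h3 := (abs_le.1 ((Complex.abs_im_le_norm (g n t)).trans h2))
    exact Complex.log_exp (by linarith [Real.pi_gt_three]) (by linarith [Real.pi_gt_three])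
  have key : ∀ k : ℕ, ∀ t : ℝ, |t| ≤ k * η → Tendsto (fun n => g n t) atTop (𝓝 0) := by
    intro k
    induction k with
    | zero =>
      intro t ht
      have : t = 0 := by simpa using ht
      simp [this, hg0]
    | succ k ih =>
      intro t ht
      push_cast at ht
      have hk : (0 : ℝ) < k + 1 := by positivity
      refine step t (t * (k / (k + 1))) ?_ (ih _ ?_)
      · have e : t - t * (k / (k + 1)) = t / (k + 1) := by field_simp; ring
        rw [e, abs_div, abs_of_pos hk, div_le_iff₀ hk]
        linarith
      · rw [abs_mul, abs_of_nonneg (by positivity : (0 : ℝ) ≤ k / (k + 1)), mul_div_assoc',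
          div_le_iff₀ hk]
        nlinarith [Nat.cast_nonneg (α := ℝ) k]
  obtain ⟨k, hk⟩ := exists_nat_ge (|t| / η)
  exact key k t ((div_le_iff₀ hη).1 hk)

/-! ### Weak convergence of finite measures on the line -/

/-- Weak convergence of finite measures implies convergence of the measures of sets with null
frontier. -/
theorem FiniteMeasure.tendsto_measureReal_of_null_frontier {μs : ℕ → FiniteMeasure ℝ}
    {μ : FiniteMeasure ℝ} (h : Tendsto μs atTop (𝓝 μ)) {E : Set ℝ}
    (hE : MeasurableSet E) (hnull : (μ : Measure ℝ) (frontier E) = 0) :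
    Tendsto (fun n => (μs n : Measure ℝ).real E) atTop (𝓝 ((μ : Measure ℝ).real E)) := by
  have hup : ∀ F : Set ℝ, (μ : Measure ℝ) (frontier F) = 0 → ∀ ε > (0 : ℝ),
      ∀ᶠ n in atTop, (μs n : Measure ℝ).real F < (μ : Measure ℝ).real F + ε := by
    intro F hF ε hε
    have h1 := FiniteMeasure.limsup_measure_closed_le_of_tendsto h (isClosed_closure (s := F))
    have h2 : (μ : Measure ℝ) (closure F) = (μ : Measure ℝ) F := by
      refine le_antisymm ?_ (measure_mono subset_closure)
      rw [closure_eq_self_union_frontier]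
      exact (measure_union_le _ _).trans (by rw [hF, add_zero])
    rw [h2] at h1
    have h3 : (μ : Measure ℝ) F < ENNReal.ofReal ((μ : Measure ℝ).real F + ε) := by
      rw [← ENNReal.ofReal_toReal (measure_ne_top (μ : Measure ℝ) F)]
      exact (ENNReal.ofReal_lt_ofReal_iff (by positivity)).2 (by rw [measureReal_def]; linarith)
    filter_upwards [eventually_lt_of_limsup_lt (h1.trans_lt h3)] with n hn
    have := (measure_mono subset_closure).trans_lt hn
    rw [measureReal_def]
    exact (ENNReal.lt_ofReal_iff_toReal_lt (measure_ne_top _ _)).1 this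
  have hmass : Tendsto (fun n => (μs n : Measure ℝ).real Set.univ) atTop
      (𝓝 ((μ : Measure ℝ).real Set.univ)) := by
    have := FiniteMeasure.tendsto_iff_forall_integral_tendsto.1 h
      (BoundedContinuousFunction.const ℝ (1 : ℝ))
    simpa using this
  rw [Metric.tendsto_atTop']
  intro ε hε
  have h3 := hmass.eventually (lt_mem_nhds (show (μ : Measure ℝ).real Set.univ - ε / 2 < _ by linarith))
  have h4 := hup E hnull (ε / 2) (by linarith)
  have h5 := hup Eᶜ (by rwa [frontier_compl]) (ε / 2) (by linarith)
  obtain ⟨N, hN⟩ := eventually_atTop.1 (h3.and (h4.and h5))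
  refine ⟨N, fun n hn => ?_⟩
  obtain ⟨a1, a2, a3⟩ := hN n hn.le
  rw [measureReal_compl hE, measureReal_compl hE] at a3
  rw [Real.dist_eq, abs_lt]
  constructor <;> linarith

/-- Lévy's continuity theorem for finite measures. -/
theorem FiniteMeasure.tendsto_of_tendsto_charFun {μs : ℕ → FiniteMeasure ℝ} {μ : FiniteMeasure ℝ}
    (h : ∀ t, Tendsto (fun n => charFun (μs n : Measure ℝ) t) atTop
      (𝓝 (charFun (μ : Measure ℝ) t))) :
    Tendsto μs atTop (𝓝 μ) := by
  -- A Dirac mass is added so that the total masses stay away from zero and one can normalize.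
  let norm1 : FiniteMeasure ℝ → Measure ℝ := fun ν =>
    (ENNReal.ofReal (1 + (ν : Measure ℝ).real Set.univ)⁻¹) • (Measure.dirac 0 + (ν : Measure ℝ))
  have hpos : ∀ ν : FiniteMeasure ℝ, 0 < 1 + (ν : Measure ℝ).real Set.univ := fun ν => by positivity
  have hprob : ∀ ν, IsProbabilityMeasure (norm1 ν) := by
    intro ν
    refine ⟨?_⟩
    have e : (Measure.dirac (0 : ℝ) + (ν : Measure ℝ)) Set.univ =
        ENNReal.ofReal (1 + (ν : Measure ℝ).real Set.univ) := by
      rw [ENNReal.ofReal_add zero_le_one measureReal_nonneg, ofReal_measureReal]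
      simp
    rw [Measure.smul_apply, e, smul_eq_mul, ← ENNReal.ofReal_mul (inv_nonneg.2 (hpos ν).le),
      inv_mul_cancel₀ (hpos ν).ne', ENNReal.ofReal_one]
  have hint : ∀ (ν : FiniteMeasure ℝ) {E : Type} [NormedAddCommGroup E] [NormedSpace ℝ E]
      [CompleteSpace E] (f : ℝ → E), Continuous f → (∃ C, ∀ x, ‖f x‖ ≤ C) →
      ∫ x, f x ∂(norm1 ν) = (1 + (ν : Measure ℝ).real Set.univ)⁻¹ • (f 0 + ∫ x, f x ∂(ν : Measure ℝ)) := by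
    intro ν E _ _ _ f hf hC
    obtain ⟨C, hC⟩ := hC
    have hi : ∀ κ : Measure ℝ, IsFiniteMeasure κ → Integrable f κ := fun κ _ => by
      refine Integrable.of_bound (C := C) ?_ (ae_of_all _ hC)
      exact hf.stronglyMeasurable.aestronglyMeasurable
    rw [integral_smul_measure, integral_add_measure (hi _ inferInstance) (hi _ inferInstance),
      integral_dirac, ENNReal.toReal_ofReal (inv_nonneg.2 (hpos ν).le)]
  have hmass : Tendsto (fun n => (μs n : Measure ℝ).real Set.univ) atTop
      (𝓝 ((μ : Measure ℝ).real Set.univ)) := by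
    have := (Complex.continuous_re.tendsto _).comp (h 0)
    simpa [charFun_zero, Function.comp_def] using this
  have hinv : Tendsto (fun n => (1 + (μs n : Measure ℝ).real Set.univ)⁻¹) atTop
      (𝓝 (1 + (μ : Measure ℝ).real Set.univ)⁻¹) := (hmass.const_add 1).inv₀ (hpos μ).ne'
  have hweak : Tendsto (β := ProbabilityMeasure ℝ) (fun n => ⟨norm1 (μs n), hprob _⟩) atTop
      (𝓝 ⟨norm1 μ, hprob μ⟩) := by
    refine ProbabilityMeasure.tendsto_of_tendsto_charFun fun t => ?_
    have e : ∀ ν, charFun (norm1 ν) t =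
        (1 + (ν : Measure ℝ).real Set.univ)⁻¹ • (1 + charFun (ν : Measure ℝ) t) := by
      intro ν
      rw [charFun_apply_real, charFun_apply_real, hint ν _ (by fun_prop) ⟨1, fun x => ?_⟩]
      · simp
      · rw [← Complex.ofReal_mul, Complex.norm_exp_ofReal_mul_I]
    simp only [ProbabilityMeasure.coe_mk, e]
    exact hinv.smul ((h t).const_add 1)
  rw [FiniteMeasure.tendsto_iff_forall_integral_tendsto]
  intro f
  have h1 := ProbabilityMeasure.tendsto_iff_forall_integral_tendsto.1 hweak f
  simp only [ProbabilityMeasure.coe_mk] at h1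
  have e : ∀ ν : FiniteMeasure ℝ, ∫ x, f x ∂(ν : Measure ℝ) =
      (1 + (ν : Measure ℝ).real Set.univ) * ∫ x, f x ∂(norm1 ν) - f 0 := by
    intro ν
    rw [hint ν f f.continuous ⟨‖f‖, f.norm_coe_le_norm⟩, smul_eq_mul,
      mul_inv_cancel_left₀ (hpos ν).ne']
    ring
  simp only [e]
  exact ((hmass.const_add 1).mul h1).sub_const _

/-- The measure `(1 - cos (h x)) dM(x)`. -/
def cosDensity (h : ℝ) (M : Measure ℝ) : Measure ℝ :=
  M.withDensity fun x => ENNReal.ofReal (1 - Real.cos (h * x))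

theorem isFiniteMeasure_cosDensity (h : ℝ) {M : Measure ℝ} (hM : HasTruncatedMoment M) :
    IsFiniteMeasure (cosDensity h M) := by
  have hi : Integrable (fun x => 1 - Real.cos (h * x)) M := by
    refine (integrable_cexp_sub_one hM h).re.neg.congr (ae_of_all _ fun x => ?_)
    simp only [Pi.neg_apply, RCLike.re_to_complex, Complex.sub_re, Complex.one_re]
    rw [← Complex.ofReal_mul, Complex.exp_ofReal_mul_I_re]
    ring
  exact isFiniteMeasure_withDensity_ofReal hi.2

theorem charFun_cosDensity (h : ℝ) {M : Measure ℝ} (hM : HasTruncatedMoment M) (t : ℝ) :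
    charFun (cosDensity h M) t =
      levyExponent M t - (levyExponent M (t + h) + levyExponent M (t - h)) / 2 := by
  rw [levyExponent_second_difference hM, charFun_apply_real, cosDensity,
    integral_withDensity_eq_integral_toReal_smul (by fun_prop) (ae_of_all _ fun x => by simp)]
  refine integral_congr_ae (ae_of_all _ fun x => ?_)
  simp only
  rw [ENNReal.toReal_ofReal (by linarith [Real.cos_le_one (h * x)]), Complex.real_smul, mul_comm]

/-- If the Lévy exponents of finite measures converge to that of `m` up to a drift, the measures
converge on intervals away from the origin whose end points are not atoms of `m`. -/
theorem tendsto_measureReal_of_tendsto_levyExponent {M : ℕ → Measure ℝ} {m : Measure ℝ}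
    (hM : ∀ n, HasTruncatedMoment (M n)) (hm : HasTruncatedMoment m) (β : ℂ)
    (h : ∀ t : ℝ, Tendsto (fun n => levyExponent (M n) t) atTop (𝓝 (levyExponent m t + t * β)))
    {δ R : ℝ} (hδ : 0 < δ) (hδR : δ ≤ R) {E : Set ℝ} (hE : MeasurableSet E)
    (hER : ∀ x ∈ E, δ ≤ |x| ∧ |x| ≤ R) (hnull : m (frontier E) = 0) :
    Tendsto (fun n => (M n).real E) atTop (𝓝 (m.real E)) := by
  have hR : 0 < R := hδ.trans_le hδR
  set u : ℝ := R⁻¹ with hu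
  have hu0 : 0 < u := inv_pos.2 hR
  set c : ℝ := 1 - Real.cos (u * δ) with hc
  have huδ : u * δ ≤ 1 := by
    rw [hu, inv_mul_le_iff₀ hR]
    linarith
  have hc0 : 0 < c := by
    have := Real.cos_lt_cos_of_nonneg_of_le_pi le_rfl
      (by linarith [Real.pi_gt_three] : u * δ ≤ Real.pi) (by positivity)
    rw [Real.cos_zero] at this
    linarith
  have hcE : ∀ x ∈ E, c ≤ 1 - Real.cos (u * x) := by
    intro x hx
    obtain ⟨h1, h2⟩ := hER x hx
    have h3 : u * |x| ≤ 1 := by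
      rw [hu, inv_mul_le_iff₀ hR]
      linarith
    have := Real.cos_le_cos_of_nonneg_of_le_pi (by positivity)
      (by linarith [Real.pi_gt_three] : u * |x| ≤ Real.pi) (mul_le_mul_of_nonneg_left h1 hu0.le)
    rw [← Real.cos_abs (u * x), abs_mul, abs_of_pos hu0]
    linarith
  let G : ℝ → ℝ := fun x => (max (1 - Real.cos (u * x)) c)⁻¹
  have hGpos : ∀ x, 0 < max (1 - Real.cos (u * x)) c := fun x => lt_max_of_lt_right hc0
  have hGc : Continuous G := by
    refine Continuous.inv₀ (by fun_prop) fun x => (hGpos x).ne'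
  have hG0 : ∀ x, 0 ≤ G x := fun x => (inv_pos.2 (hGpos x)).le
  have hGb : ∀ x, G x ≤ c⁻¹ := fun x => inv_anti₀ hc0 (le_max_right _ _)
  let θ : Measure ℝ → Measure ℝ := fun κ => (cosDensity u κ).withDensity fun x => ENNReal.ofReal (G x)
  have hGi : ∀ κ : Measure ℝ, IsFiniteMeasure κ → Integrable G κ := fun κ _ =>
    Integrable.of_bound (C := c⁻¹) hGc.aestronglyMeasurable
      (ae_of_all _ fun x => by rw [Real.norm_of_nonneg (hG0 x)]; exact hGb x)
  have hθfin : ∀ κ, HasTruncatedMoment κ → IsFiniteMeasure (θ κ) := fun κ hκ =>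
    isFiniteMeasure_withDensity_ofReal (hGi _ (isFiniteMeasure_cosDensity u hκ)).2
  have hθE : ∀ κ, ∀ F ⊆ E, MeasurableSet F → θ κ F = κ F := by
    intro κ F hF hFm
    have e : θ κ = κ.withDensity fun x =>
        ENNReal.ofReal (1 - Real.cos (u * x)) * ENNReal.ofReal (G x) :=
      (withDensity_mul κ (by fun_prop) (hGc.measurable.ennreal_ofReal)).symm
    rw [e, withDensity_apply _ hFm]
    calc _ = ∫⁻ x in F, 1 ∂κ := by
          refine setLIntegral_congr_fun hFm fun x hx => ?_
          have h1 := hcE x (hF hx)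
          rw [← ENNReal.ofReal_mul (by linarith)]
          simp only [G]
          rw [max_eq_left h1, mul_inv_cancel₀ (by linarith), ENNReal.ofReal_one]
      _ = κ F := by simp
  have hac : θ m (frontier E) = 0 := by
    have h1 : θ m ≪ m := (withDensity_absolutelyContinuous _ _).trans
      (withDensity_absolutelyContinuous _ _)
    exact h1 hnull
  let fm : (κ : Measure ℝ) → IsFiniteMeasure κ → FiniteMeasure ℝ := fun κ hκ => ⟨κ, hκ⟩
  have hw : Tendsto (fun n => fm (cosDensity u (M n)) (isFiniteMeasure_cosDensity u (hM n)))
      atTop (𝓝 (fm (cosDensity u m) (isFiniteMeasure_cosDensity u hm))) := by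
    refine FiniteMeasure.tendsto_of_tendsto_charFun fun t => ?_
    simp only [fm, FiniteMeasure.toMeasure_mk, charFun_cosDensity u (hM _), charFun_cosDensity u hm]
    have := (h t).sub (((h (t + u)).add (h (t - u))).div_const 2)
    convert this using 2
    push_cast
    ring
  have hθ : Tendsto (fun n => fm (θ (M n)) (hθfin _ (hM n))) atTop
      (𝓝 (fm (θ m) (hθfin _ hm))) := by
    refine FiniteMeasure.tendsto_iff_forall_integral_tendsto.2 fun f => ?_
    let Gb : BoundedContinuousFunction ℝ ℝ := BoundedContinuousFunction.ofNormedAddCommGroup G hGc c⁻¹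
      fun x => by rw [Real.norm_of_nonneg (hG0 x)]; exact hGb x
    have := FiniteMeasure.tendsto_iff_forall_integral_tendsto.1 hw (Gb * f)
    have e : ∀ κ, ∫ x, f x ∂(θ κ) = ∫ x, (Gb * f) x ∂(cosDensity u κ) := by
      intro κ
      rw [integral_withDensity_eq_integral_toReal_smul (hGc.measurable.ennreal_ofReal)
        (ae_of_all _ fun x => by simp)]
      refine integral_congr_ae (ae_of_all _ fun x => ?_)
      simp only
      rw [ENNReal.toReal_ofReal (hG0 x)]
      rfl
    simpa only [fm, FiniteMeasure.toMeasure_mk, e] using this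
  have := FiniteMeasure.tendsto_measureReal_of_null_frontier (μ := fm (θ m) (hθfin _ hm)) hθ hE hac
  simpa only [fm, FiniteMeasure.toMeasure_mk, measureReal_def, hθE _ E subset_rfl hE] using this

/-- Convergence of the powers of characteristic functions to `exp` of a Lévy exponent implies
convergence of the rescaled Lévy exponents, under uniform bounds on truncated moments and tails. -/
theorem tendsto_levyExponent_of_tendsto_charFun_pow {μ : ℕ → Measure ℝ}
    [∀ n, IsProbabilityMeasure (μ n)] {m : Measure ℝ} (hm : HasTruncatedMoment m) (β : ℂ)
    {C : ℝ} (hC : ∀ n : ℕ, (n + 1) * ∫ x, min |x| 1 ∂(μ n) ≤ C)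
    (htail : ∀ ε > (0 : ℝ), ∃ R ≥ (1 : ℝ), m.real {x | R ≤ |x|} ≤ ε ∧
      ∀ n : ℕ, (n + 1) * (μ n).real {x | R ≤ |x|} ≤ ε)
    (h : ∀ t : ℝ, Tendsto (fun n => charFun (μ n) t ^ (n + 1)) atTop
      (𝓝 (Complex.exp (levyExponent m t + t * β)))) (t : ℝ) :
    Tendsto (fun n : ℕ => (n + 1) * levyExponent (μ n) t) atTop (𝓝 (levyExponent m t + t * β)) := by
  have hμ : ∀ n, HasTruncatedMoment (μ n) := fun n => hasTruncatedMoment_of_isFiniteMeasure _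
  have hC0 : 0 ≤ C := le_trans (by positivity) (hC 0)
  have hbound : ∀ (n : ℕ) t, (n + 1) * ‖levyExponent (μ n) t‖ ≤ (|t| + 2) * C := by
    intro n t
    calc (n + 1) * ‖levyExponent (μ n) t‖ ≤ (n + 1) * ((|t| + 2) * ∫ x, min |x| 1 ∂(μ n)) :=
          mul_le_mul_of_nonneg_left (norm_levyExponent_le (hμ n) t) (by positivity)
      _ = (|t| + 2) * ((n + 1) * ∫ x, min |x| 1 ∂(μ n)) := by ring
      _ ≤ (|t| + 2) * C := mul_le_mul_of_nonneg_left (hC n) (by positivity)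
  have hexp : ∀ t : ℝ, Tendsto (fun n : ℕ => Complex.exp ((n + 1) * levyExponent (μ n) t)) atTop
      (𝓝 (Complex.exp (levyExponent m t + t * β))) := by
    intro t
    have hdiff : Tendsto (fun n : ℕ => Complex.exp ((n + 1) * levyExponent (μ n) t) -
        charFun (μ n) t ^ (n + 1)) atTop (𝓝 0) := by
      have hlim : Tendsto (fun n : ℕ => ((|t| + 2) * C) ^ 2 * (1 / ((n : ℝ) + 1))) atTop (𝓝 0) := by
        simpa only [mul_zero] using
          (tendsto_one_div_add_atTop_nhds_zero_nat (𝕜 := ℝ)).const_mul (((|t| + 2) * C) ^ 2)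
      refine squeeze_zero_norm' ?_ hlim
      obtain ⟨N, hN⟩ := exists_nat_ge ((|t| + 2) * C)
      filter_upwards [eventually_ge_atTop N] with n hn
      have hn' : (N : ℝ) ≤ n := by exact_mod_cast hn
      have hb := hbound n t
      have hpos : (0 : ℝ) < n + 1 := by positivity
      have h1 : ‖levyExponent (μ n) t‖ ≤ 1 := by
        by_contra hcon
        push Not at hcon
        nlinarith
      have h2 := norm_cexp_levyExponent_sub_charFun_pow_le (μ n) t (n + 1) h1
      push_cast at h2
      refine h2.trans ?_
      rw [mul_one_div, le_div_iff₀ hpos]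
      calc _ = (((n : ℝ) + 1) * ‖levyExponent (μ n) t‖) ^ 2 := by ring
        _ ≤ _ := pow_le_pow_left₀ (by positivity) hb 2
    simpa using hdiff.add (h t)
  obtain ⟨R, hR1, hRm, hRn⟩ := htail (1 / 16) (by norm_num)
  set I : ℝ := ∫ x, min |x| 1 ∂m with hI
  have hI0 : 0 ≤ I := integral_nonneg fun x => le_min (abs_nonneg x) zero_le_one
  set D : ℝ := R * C + R * I + ‖β‖ + 1 with hD
  have hD0 : 0 < D := by positivity
  have key := tendsto_zero_of_tendsto_cexp (η := 1 / (2 * D))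
    (g := fun n t => (n + 1) * levyExponent (μ n) t - (levyExponent m t + t * β))
    (by positivity) (by intro n; simp [levyExponent]) ?_ ?_ t
  · simpa using key.add_const (levyExponent m t + t * β)
  · intro n t s hts
    have e : ((n : ℂ) + 1) * levyExponent (μ n) t - (levyExponent m t + t * β) -
        (((n : ℂ) + 1) * levyExponent (μ n) s - (levyExponent m s + s * β)) =
        ((n : ℂ) + 1) * (levyExponent (μ n) t - levyExponent (μ n) s) -
        (levyExponent m t - levyExponent m s) - ((t - s : ℝ) : ℂ) * β := by
      push_cast
      ring
    simp only [e]
    have hn1 : ‖((n : ℂ) + 1)‖ = (n : ℝ) + 1 := by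
      have : ((n : ℂ) + 1) = (((n : ℝ) + 1 : ℝ) : ℂ) := by push_cast; rfl
      rw [this, Complex.norm_real, Real.norm_of_nonneg (by positivity)]
    have a1 : ‖((n : ℂ) + 1) * (levyExponent (μ n) t - levyExponent (μ n) s)‖ ≤
        |t - s| * (R * C) + 1 / 8 := by
      rw [norm_mul, hn1]
      calc _ ≤ ((n : ℝ) + 1) * (|t - s| * R * ∫ x, min |x| 1 ∂(μ n) +
            2 * (μ n).real {x | R ≤ |x|}) :=
            mul_le_mul_of_nonneg_left (norm_levyExponent_sub_le (hμ n) hR1 t s) (by positivity)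
        _ = |t - s| * R * ((n + 1) * ∫ x, min |x| 1 ∂(μ n)) +
            2 * ((n + 1) * (μ n).real {x | R ≤ |x|}) := by ring
        _ ≤ |t - s| * R * C + 2 * (1 / 16) :=
            add_le_add (mul_le_mul_of_nonneg_left (hC n) (by positivity)) (by linarith [hRn n])
        _ = _ := by ring
    have a2 : ‖levyExponent m t - levyExponent m s‖ ≤ |t - s| * (R * I) + 1 / 8 :=
      (norm_levyExponent_sub_le hm hR1 t s).trans (by rw [← hI]; linarith)
    have a3 : ‖((t - s : ℝ) : ℂ) * β‖ = |t - s| * ‖β‖ := by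
      rw [norm_mul, Complex.norm_real, Real.norm_eq_abs]
    have a4 : |t - s| * D ≤ 1 / 2 := by
      calc |t - s| * D ≤ 1 / (2 * D) * D := mul_le_mul_of_nonneg_right hts hD0.le
        _ = 1 / 2 := by field_simp
    refine (norm_sub_le _ _).trans ((add_le_add (norm_sub_le _ _) le_rfl).trans ?_)
    rw [a3]
    have : |t - s| * D = |t - s| * (R * C) + |t - s| * (R * I) + |t - s| * ‖β‖ + |t - s| := by
      rw [hD]; ring
    linarith [abs_nonneg (t - s)]
  · intro t
    simp only [Complex.exp_sub]
    have := (hexp t).div_const (Complex.exp (levyExponent m t + t * β))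
    rwa [div_self (Complex.exp_ne_zero _)] at this

/-! ### Consequences of Condition C1 for the law of one entry -/

/-- The law of an off-diagonal entry of the matrix of size `n + 2`. -/
def entryLaw {Ω : Type*} [MeasurableSpace Ω] (P : Measure Ω)
    (A : (n : ℕ) → Ω → Matrix (Fin n) (Fin n) ℝ) (n : ℕ) : Measure ℝ :=
  P.map fun ω => A (n + 2) ω 0 1

theorem List.sum_map_min_le (l : List ℝ) {δ : ℝ} (hδ : 0 ≤ δ) (k : ℕ) :
    (l.map fun x => min x δ).sum ≤ k * δ + (l.drop k).sum := by
  induction l generalizing k with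
  | nil => simpa using mul_nonneg (Nat.cast_nonneg k) hδ
  | cons x l ih =>
    cases k with
    | zero =>
      have := ih 0
      simp only [List.map_cons, List.sum_cons, List.drop_zero] at this ⊢
      linarith [min_le_left x δ]
    | succ k =>
      have := ih k
      simp only [List.map_cons, List.sum_cons, List.drop_succ_cons] at this ⊢
      push_cast
      linarith [min_le_right x δ]

theorem sum_min_le_columnOrderStatistics {n : ℕ} (M : Matrix (Fin (n + 2)) (Fin (n + 2)) ℝ)
    {δ : ℝ} (hδ : 0 ≤ δ) (k : ℕ) :
    ∑ i : Fin n, min |M i.castSucc.succ (Fin.last (n + 1))| δ ≤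
      k * δ + ((columnOrderStatistics M).drop k).sum := by
  refine le_trans ?_ (List.sum_map_min_le _ hδ k)
  have e : ((columnOrderStatistics M).map fun x => min x δ).sum =
      ∑ i ∈ Finset.univ.filter (fun i : Fin (n + 2) => 1 ≤ (i : ℕ)),
        min |M i (Fin.last (n + 1))| δ := by
    rw [← Multiset.sum_coe, ← Multiset.map_coe, columnOrderStatistics, Multiset.sort_eq,
      Multiset.map_map]
    rfl
  rw [e]
  have hinj : Function.Injective fun i : Fin n => i.castSucc.succ := fun i j h => by
    simpa using h
  calc ∑ i : Fin n, min |M i.castSucc.succ (Fin.last (n + 1))| δ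
      = ∑ i ∈ Finset.univ.map ⟨fun i : Fin n => i.castSucc.succ, hinj⟩,
          min |M i (Fin.last (n + 1))| δ := by rw [Finset.sum_map]; rfl
    _ ≤ _ := by
      refine Finset.sum_le_sum_of_subset_of_nonneg ?_ fun i _ _ => le_min (abs_nonneg _) hδ
      intro i hi
      simp only [Finset.mem_map, Finset.mem_univ, true_and, Function.Embedding.coeFn_mk] at hi
      obtain ⟨j, rfl⟩ := hi
      simp

theorem Real.exp_neg_le_one_sub_half {y : ℝ} (h0 : 0 ≤ y) (h1 : y ≤ 1) :
    Real.exp (-y) ≤ 1 - y / 2 := by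
  rw [Real.exp_neg, inv_le_comm₀ (Real.exp_pos y) (by linarith)]
  refine le_trans ?_ (Real.add_one_le_exp y)
  rw [inv_le_iff_one_le_mul₀ (by linarith)]
  nlinarith

theorem hasTruncatedMoment_of_conditionC1 {Ω : Type*} [MeasurableSpace Ω] {P : Measure Ω}
    {A : (n : ℕ) → Ω → Matrix (Fin n) (Fin n) ℝ} {m : Measure ℝ} (hC1 : ConditionC1 P A m) :
    HasTruncatedMoment m := by
  refine ⟨by fun_prop, ?_⟩
  rw [hasFiniteIntegral_iff_ofReal (ae_of_all _ fun x => le_min (abs_nonneg x) zero_le_one)]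
  refine lt_of_eq_of_lt (lintegral_congr fun x => ?_) hC1.lintegral_abs_lt_top
  rw [ENNReal.ofReal_min, ENNReal.ofReal_one]

section

variable {Ω : Type*} [MeasurableSpace Ω] {P : Measure Ω} [IsProbabilityMeasure P]
  {A : (n : ℕ) → Ω → Matrix (Fin n) (Fin n) ℝ} {sigmaSq : ℝ≥0} {b : ℝ} {m : Measure ℝ}

theorem isProbabilityMeasure_entryLaw (hA : IsLevyKhintchineEnsemble P A sigmaSq b m) (n : ℕ) :
    IsProbabilityMeasure (entryLaw P A n) :=
  Measure.isProbabilityMeasure_map (hA.measurable_entry _ _ _).aemeasurable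

theorem map_entry_eq_entryLaw (hA : IsLevyKhintchineEnsemble P A sigmaSq b m) (n : ℕ)
    (p : {p : Fin (n + 2) × Fin (n + 2) // p.1 < p.2}) :
    P.map (fun ω => A (n + 2) ω p.1.1 p.1.2) = entryLaw P A n :=
  (hA.identDistrib (n + 2) p ⟨(0, 1), by simp⟩).map_eq

/-- Under Condition C1 there is a level `k` such that, with probability at least one half, all but
the `k` largest entries of a column have a small sum, uniformly in the size of the matrix. -/
theorem exists_le_measure_sum_min_le (hC1 : ConditionC1 P A m) {ε : ℝ} (hε : 0 < ε) :
    ∃ k : ℕ, ∀ n : ℕ, k < n + 2 → ∀ δ : ℝ, 0 ≤ δ →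
      1 / 2 ≤ P.real {ω | ∑ i : Fin n, min |A (n + 2) ω i.castSucc.succ (Fin.last (n + 1))| δ ≤
        k * δ + ε} := by
  -- No measurability of the order statistics is needed: outer measures are continuous from below.
  let F : ℕ → Ω → ℝ≥0∞ := fun k ω => ⨆ (n : ℕ) (_ : k < n),
      ENNReal.ofReal ((columnOrderStatistics (A n ω)).drop k).sum
  let G : ℕ → Set Ω := fun k => {ω | ∀ k' ≥ k, F k' ω ≤ ENNReal.ofReal ε}
  have hmono : Monotone G := fun k k' hk ω hω j hj => hω j (hk.trans hj)
  have hone : P (⋃ k, G k) = 1 := by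
    rw [← prob_add_prob_compl (μ := P) MeasurableSet.univ, measure_univ, Set.compl_univ,
      measure_empty, add_zero]
    rw [← measure_univ (μ := P)]
    refine measure_congr ?_
    rw [eventuallyEq_univ]
    filter_upwards [hC1.uniformly_summable] with ω hω
    have := hω.eventually (ge_mem_nhds (ENNReal.ofReal_pos.2 hε))
    obtain ⟨k, hk⟩ := eventually_atTop.1 this
    exact Set.mem_iUnion.2 ⟨k, hk⟩
  rw [hmono.measure_iUnion] at hone
  obtain ⟨k, hk⟩ := lt_iSup_iff.1 (show ((1 / 2 : ℝ≥0∞)) < ⨆ k, P (G k) by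
    rw [hone, one_div]; exact ENNReal.one_half_lt_one)
  refine ⟨k, fun n hn δ hδ => ?_⟩
  have hsub : G k ⊆ {ω | ∑ i : Fin n, min |A (n + 2) ω i.castSucc.succ (Fin.last (n + 1))| δ ≤
        k * δ + ε} := by
    intro ω hω
    have h1 := (le_iSup₂ (f := fun (n : ℕ) (_ : k < n) =>
      ENNReal.ofReal ((columnOrderStatistics (A n ω)).drop k).sum) (n + 2) hn).trans (hω k le_rfl)
    have h2 := (ENNReal.ofReal_le_ofReal_iff hε.le).1 h1
    have := sum_min_le_columnOrderStatistics (A (n + 2) ω) hδ k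
    simp only [Set.mem_ofPred_eq]
    linarith
  have := (hk.trans_le (measure_mono hsub)).le
  have h3 := ENNReal.toReal_mono (measure_ne_top _ _) this
  simpa [measureReal_def] using h3

/-- Uniform integrability at the origin of the rescaled laws of the entries. -/
theorem exists_integral_min_le (hA : IsLevyKhintchineEnsemble P A sigmaSq b m)
    (hC1 : ConditionC1 P A m) {ε : ℝ} (hε : 0 < ε) :
    ∃ δ : ℝ, 0 < δ ∧ δ ≤ 1 ∧ ∀ n : ℕ, (n + 2) * ∫ x, min |x| δ ∂(entryLaw P A n) ≤ ε := by
  obtain ⟨ε', hε', rfl⟩ : ∃ ε' > 0, ε = 8 * ε' := ⟨ε / 8, by positivity, by ring⟩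
  obtain ⟨k, hk⟩ := exists_le_measure_sum_min_le (P := P) (A := A) (m := m) hC1 hε'
  set δ : ℝ := min 1 (ε' / (k + 1)) with hδ
  have hδ0 : 0 < δ := lt_min one_pos (by positivity)
  have hkδ : (k + 1) * δ ≤ ε' := by
    calc ((k : ℝ) + 1) * δ ≤ (k + 1) * (ε' / (k + 1)) :=
          mul_le_mul_of_nonneg_left (min_le_right _ _) (by positivity)
      _ = ε' := by field_simp
  have hkδ' : 0 ≤ (k : ℝ) * δ := by positivity
  refine ⟨δ, hδ0, min_le_left _ _, fun n => ?_⟩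
  have := isProbabilityMeasure_entryLaw hA n
  set μ := entryLaw P A n with hμ
  set I : ℝ := ∫ x, min |x| δ ∂μ with hI
  have hmin0 : ∀ x : ℝ, 0 ≤ min |x| δ := fun x => le_min (abs_nonneg x) hδ0.le
  have hmi : Integrable (fun x : ℝ => min |x| δ) μ := by
    refine Integrable.of_bound (C := δ) (by fun_prop) (ae_of_all _ fun x => ?_)
    rw [Real.norm_of_nonneg (hmin0 x)]
    exact min_le_right _ _
  have hI0 : 0 ≤ I := integral_nonneg hmin0
  have hIδ : I ≤ δ := by
    have := integral_mono hmi (integrable_const δ) fun x => min_le_right |x| δ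
    simpa using this
  rcases lt_or_ge k (n + 2) with hkn | hkn
  · have hhalf := hk n hkn δ hδ0.le
    let X : Fin n → Ω → ℝ := fun i ω => min |A (n + 2) ω i.castSucc.succ (Fin.last (n + 1))| δ
    have hXm : ∀ i, Measurable (X i) := fun i =>
      (hA.measurable_entry _ _ _).abs.min measurable_const
    let q : Fin n → {p : Fin (n + 2) × Fin (n + 2) // p.1 < p.2} := fun i =>
      ⟨(i.castSucc.succ, Fin.last (n + 1)), by
        rw [Fin.lt_def]; simp⟩
    have hq : Function.Injective q := fun i j h => by
      simpa [q] using h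
    have hXi : iIndepFun X P :=
      ((hA.indep (n + 2)).precomp hq).comp (fun _ x => min |x| δ) fun _ =>
        measurable_id.abs.min measurable_const
    have hmgf : mgf (∑ i, X i) P (-ε'⁻¹) ≤ Real.exp (-(I / (2 * ε'))) ^ n := by
      rw [hXi.mgf_sum hXm]
      calc ∏ i : Fin n, mgf (X i) P (-ε'⁻¹) ≤ ∏ i : Fin n, Real.exp (-(I / (2 * ε'))) := by
            refine Finset.prod_le_prod (fun i _ => mgf_nonneg) fun i _ => ?_
            have e : mgf (X i) P (-ε'⁻¹) = ∫ x, Real.exp (-(ε'⁻¹ * min |x| δ)) ∂μ := by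
              have h1 := map_entry_eq_entryLaw hA n (q i)
              rw [hμ, ← h1, integral_map (hA.measurable_entry _ _ _).aemeasurable
                (by fun_prop), mgf]
              refine integral_congr_ae (ae_of_all _ fun ω => ?_)
              simp only [X, q, neg_mul]
            rw [e]
            calc ∫ x, Real.exp (-(ε'⁻¹ * min |x| δ)) ∂μ ≤ ∫ x, (1 - ε'⁻¹ * min |x| δ / 2) ∂μ := by
                  refine integral_mono ?_ ((integrable_const _).sub
                    ((hmi.const_mul _).div_const _)) fun x => ?_
                  · refine Integrable.of_bound (C := 1) (by fun_prop) (ae_of_all _ fun x => ?_)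
                    rw [Real.norm_of_nonneg (Real.exp_pos _).le, Real.exp_le_one_iff]
                    have := hmin0 x
                    simp only [Left.neg_nonpos_iff]
                    positivity
                  · refine Real.exp_neg_le_one_sub_half (mul_nonneg (by positivity) (hmin0 x)) ?_
                    rw [inv_mul_le_iff₀ hε']
                    linarith [min_le_right |x| δ]
              _ = 1 - I / (2 * ε') := by
                  rw [integral_sub (integrable_const _) ((hmi.const_mul _).div_const _),
                    integral_div, integral_const_mul]
                  simp only [integral_const, probReal_univ, smul_eq_mul, one_mul, ← hI]
                  field_simp
              _ ≤ Real.exp (-(I / (2 * ε'))) := by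
                  linarith [Real.add_one_le_exp (-(I / (2 * ε')))]
        _ = _ := by simp
    have hlow : Real.exp (-2) * (1 / 2) ≤ mgf (∑ i, X i) P (-ε'⁻¹) := by
      have hnn : ∀ ω, 0 ≤ (∑ i, X i) ω := fun ω => by
        rw [Finset.sum_apply]
        exact Finset.sum_nonneg fun i _ => hmin0 _
      have hmark := mul_meas_ge_le_integral_of_nonneg (μ := P)
        (f := fun ω => Real.exp (-ε'⁻¹ * (∑ i, X i) ω)) (ae_of_all _ fun ω => (Real.exp_pos _).le)
        (by
          refine Integrable.of_bound (C := 1) ?_ (ae_of_all _ fun ω => ?_)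
          · simp only [Finset.sum_apply]
            exact (Real.measurable_exp.comp ((Finset.measurable_sum _ fun i _ =>
              hXm i).const_mul _)).aestronglyMeasurable
          · rw [Real.norm_of_nonneg (Real.exp_pos _).le, Real.exp_le_one_iff]
            have h3 := mul_nonneg (inv_nonneg.2 hε'.le) (hnn ω)
            linarith) (Real.exp (-2))
      refine le_trans (mul_le_mul_of_nonneg_left ?_ (Real.exp_pos _).le) hmark
      refine hhalf.trans (measureReal_mono fun ω hω => ?_)
      simp only [Set.mem_ofPred_eq] at hω ⊢
      rw [Real.exp_le_exp, Finset.sum_apply, neg_mul, neg_le_neg_iff, inv_mul_le_iff₀ hε']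
      have : ∑ i, X i ω ≤ k * δ + ε' := hω
      nlinarith
    have hfin : Real.exp (-3) ≤ Real.exp (-(n * (I / (2 * ε')))) := by
      have h1 := hlow.trans hmgf
      rw [← Real.exp_nat_mul] at h1
      have h2 : Real.exp (-3) ≤ Real.exp (-2) * (1 / 2) := by
        have e : Real.exp (-3) = Real.exp (-2) * Real.exp (-1) := by
          rw [← Real.exp_add]; norm_num
        rw [e]
        refine mul_le_mul_of_nonneg_left ?_ (Real.exp_pos _).le
        have := Real.exp_neg_le_one_sub_half (y := 1) zero_le_one le_rfl
        linarith
      have e2 : (n : ℝ) * -(I / (2 * ε')) = -(n * (I / (2 * ε'))) := by ring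
      rw [e2] at h1
      exact h2.trans h1
    rw [Real.exp_le_exp] at hfin
    have h4 : n * I ≤ 6 * ε' := by
      have : n * (I / (2 * ε')) ≤ 3 := by linarith
      rw [mul_div_assoc', div_le_iff₀ (by positivity)] at this
      linarith
    nlinarith
  · have hkn' : (n : ℝ) + 2 ≤ k := by exact_mod_cast hkn
    calc ((n : ℝ) + 2) * I ≤ k * δ := mul_le_mul hkn' hIδ hI0 (Nat.cast_nonneg k)
      _ ≤ 8 * ε' := by nlinarith

/-- Uniform smallness of the tails of `m` and of the rescaled laws of the entries. -/
theorem exists_tail_le (hA : IsLevyKhintchineEnsemble P A sigmaSq b m)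
    (hC1 : ConditionC1 P A m) {ε : ℝ} (hε : 0 < ε) :
    ∃ R ≥ (1 : ℝ), m.real {x | R ≤ |x|} ≤ ε ∧
      ∀ n : ℕ, (n + 2) * (entryLaw P A n).real {x | R ≤ |x|} ≤ ε := by
  obtain ⟨e, he, C, hC, h⟩ := hC1.tail
  have hlim : Tendsto (fun R : ℝ => C * R ^ (-e)) atTop (𝓝 0) := by
    simpa using (tendsto_rpow_neg_atTop he).const_mul C
  obtain ⟨R, hR, hR1⟩ := ((hlim.eventually (ge_mem_nhds hε)).and (eventually_ge_atTop 1)).exists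
  obtain ⟨h1, h2⟩ := h R (by linarith)
  refine ⟨R, hR1, ?_, fun n => ?_⟩
  · refine (ENNReal.toReal_mono ENNReal.ofReal_ne_top h1).trans ?_
    rw [ENNReal.toReal_ofReal (by positivity)]
    exact hR
  · have h3 := ENNReal.toReal_mono ENNReal.ofReal_ne_top (h2 (n + 2) (by omega))
    rw [ENNReal.toReal_ofReal (by positivity), ENNReal.toReal_mul] at h3
    refine le_trans (le_of_eq ?_) (h3.trans hR)
    rw [measureReal_def, entryLaw, Measure.map_apply (hA.measurable_entry _ _ _)
      (measurableSet_le_abs R)]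
    push_cast
    rfl

theorem charFun_map_rowSum (hA : IsLevyKhintchineEnsemble P A sigmaSq b m) (n : ℕ) (t : ℝ) :
    charFun (P.map fun ω => ∑ j, A (n + 2) ω 0 j) t = charFun (entryLaw P A n) t ^ (n + 1) := by
  let q : Fin (n + 1) → {p : Fin (n + 2) × Fin (n + 2) // p.1 < p.2} := fun i =>
    ⟨(0, i.succ), Fin.succ_pos i⟩
  have hq : Function.Injective q := fun i j h => by simpa [q] using h
  have hind := (hA.indep (n + 2)).precomp hq
  have e : (fun ω => ∑ j, A (n + 2) ω 0 j) = fun ω => ∑ i, A (n + 2) ω (q i).1.1 (q i).1.2 := by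
    funext ω
    rw [Fin.sum_univ_succ, hA.diag_zero, zero_add]
  rw [e, hind.charFun_map_fun_sum_eq_prod fun i => (hA.measurable_entry _ _ _).aemeasurable,
    Finset.prod_apply]
  simp only [map_entry_eq_entryLaw hA, Finset.prod_const, Finset.card_univ, Fintype.card_fin]

/-- Under a finite truncated first moment the compensating term of the Lévy–Khintchine formula can be
absorbed into the drift. -/
theorem levyKhintchineCharFun_eq (hm : HasTruncatedMoment m) (b : ℝ) :
    ∃ β : ℂ, ∀ t : ℝ, levyKhintchineCharFun 0 b m t = Complex.exp (levyExponent m t + t * β) := by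
  have hi : Integrable (fun x : ℝ => (x : ℂ) / (1 + (x : ℂ) ^ 2)) m := by
    refine Integrable.mono' hm ?_ (ae_of_all _ fun x => ?_)
    · exact (by fun_prop : Measurable fun x : ℝ => (x : ℂ) / (1 + (x : ℂ) ^ 2)).aestronglyMeasurable
    · have e : (x : ℂ) / (1 + (x : ℂ) ^ 2) = ((x / (1 + x ^ 2) : ℝ) : ℂ) := by push_cast; rfl
      have hpos : 0 < 1 + x ^ 2 := by positivity
      rw [e, Complex.norm_real, Real.norm_eq_abs, abs_div, abs_of_pos hpos]
      refine le_min ?_ ?_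
      · exact div_le_self (abs_nonneg x) (by nlinarith)
      · rw [div_le_one hpos]
        nlinarith [sq_nonneg (|x| - 1), sq_abs x, abs_nonneg x]
  refine ⟨Complex.I * (b - ∫ x : ℝ, (x : ℂ) / (1 + (x : ℂ) ^ 2) ∂m), fun t => ?_⟩
  rw [levyKhintchineCharFun]
  congr 1
  have e : ∫ x : ℝ, (Complex.exp (Complex.I * t * x) - 1 - Complex.I * t * x / (1 + (x : ℂ) ^ 2)) ∂m =
      levyExponent m t - Complex.I * t * ∫ x : ℝ, (x : ℂ) / (1 + (x : ℂ) ^ 2) ∂m := by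
    rw [levyExponent, ← integral_const_mul,
      ← integral_sub (integrable_cexp_sub_one hm t) (hi.const_mul _)]
    refine integral_congr_ae (ae_of_all _ fun x => ?_)
    simp only
    rw [mul_div_assoc]
    congr 3
    ring
  rw [e]
  simp
  ring

/-- The rescaled laws of the entries converge to `m` away from the origin. -/
theorem tendsto_entryLaw (hA : IsLevyKhintchineEnsemble P A 0 b m)
    (hC1 : ConditionC1 P A m) {δ R : ℝ} (hδ : 0 < δ) (hδR : δ ≤ R) {E : Set ℝ}
    (hE : MeasurableSet E) (hER : ∀ x ∈ E, δ ≤ |x| ∧ |x| ≤ R) (hnull : m (frontier E) = 0) :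
    Tendsto (fun n : ℕ => (n + 2) * (entryLaw P A n).real E) atTop (𝓝 (m.real E)) := by
  have hprob := isProbabilityMeasure_entryLaw hA
  have hm := hasTruncatedMoment_of_conditionC1 hC1
  obtain ⟨β, hβ⟩ := levyKhintchineCharFun_eq hm b
  obtain ⟨ν, hν, hchar, hdist⟩ := hA.rowSum_tendsto
  have hpow : ∀ t : ℝ, Tendsto (fun n => charFun (entryLaw P A n) t ^ (n + 1)) atTop
      (𝓝 (Complex.exp (levyExponent m t + t * β))) := by
    intro t
    have h1 := ProbabilityMeasure.tendsto_iff_tendsto_charFun.1 hdist.tendsto t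
    have h2 := h1.comp (tendsto_add_atTop_nat 1)
    simp only [ProbabilityMeasure.coe_mk, Measure.map_id, hchar, hβ] at h2
    refine h2.congr fun n => ?_
    exact charFun_map_rowSum hA n t
  obtain ⟨δ₁, hδ₁, hδ₁1, hC⟩ := exists_integral_min_le hA hC1 one_pos
  have hbound : ∀ n : ℕ, ((n : ℝ) + 1) * ∫ x, min |x| 1 ∂(entryLaw P A n) ≤ δ₁⁻¹ := by
    intro n
    have hle : ∫ x, min |x| 1 ∂(entryLaw P A n) ≤ δ₁⁻¹ * ∫ x, min |x| δ₁ ∂(entryLaw P A n) := by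
      rw [← integral_const_mul]
      refine integral_mono (hasTruncatedMoment_of_isFiniteMeasure _) (Integrable.const_mul ?_ _)
        fun x => ?_
      · refine Integrable.of_bound (C := δ₁) (by fun_prop) (ae_of_all _ fun x => ?_)
        rw [Real.norm_of_nonneg (le_min (abs_nonneg x) hδ₁.le)]
        exact min_le_right _ _
      · simp only
        rw [inv_mul_eq_div, le_div_iff₀ hδ₁]
        refine le_min ?_ ?_
        · calc min |x| 1 * δ₁ ≤ |x| * 1 :=
                mul_le_mul (min_le_left _ _) hδ₁1 hδ₁.le (abs_nonneg x)
            _ = |x| := mul_one _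
        · calc min |x| 1 * δ₁ ≤ 1 * δ₁ := mul_le_mul_of_nonneg_right (min_le_right _ _) hδ₁.le
            _ = δ₁ := one_mul _
    have hJ : 0 ≤ ∫ x, min |x| δ₁ ∂(entryLaw P A n) :=
      integral_nonneg fun x => le_min (abs_nonneg x) hδ₁.le
    calc ((n : ℝ) + 1) * ∫ x, min |x| 1 ∂(entryLaw P A n)
        ≤ (n + 1) * (δ₁⁻¹ * ∫ x, min |x| δ₁ ∂(entryLaw P A n)) :=
          mul_le_mul_of_nonneg_left hle (by positivity)
      _ = δ₁⁻¹ * ((n + 1) * ∫ x, min |x| δ₁ ∂(entryLaw P A n)) := by ring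
      _ ≤ δ₁⁻¹ * 1 := mul_le_mul_of_nonneg_left (by nlinarith [hC n]) (inv_pos.2 hδ₁).le
      _ = δ₁⁻¹ := mul_one _
  have htail : ∀ ε > (0 : ℝ), ∃ R ≥ (1 : ℝ), m.real {x | R ≤ |x|} ≤ ε ∧
      ∀ n : ℕ, ((n : ℝ) + 1) * (entryLaw P A n).real {x | R ≤ |x|} ≤ ε := by
    intro ε hε
    obtain ⟨R, hR, h1, h2⟩ := exists_tail_le hA hC1 hε
    refine ⟨R, hR, h1, fun n => ?_⟩
    have h3 : 0 ≤ (entryLaw P A n).real {x | R ≤ |x|} := measureReal_nonneg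
    linarith [h2 n]
  have hlevy := tendsto_levyExponent_of_tendsto_charFun_pow hm β hbound htail hpow
  have key := tendsto_measureReal_of_tendsto_levyExponent
    (M := fun n => ((n + 1 : ℕ) : ℝ≥0∞) • entryLaw P A n) (m := m)
    (fun n => (hasTruncatedMoment_of_isFiniteMeasure _).smul_measure (ENNReal.natCast_ne_top _))
    hm β (fun t => (hlevy t).congr fun n => by
      rw [levyExponent, levyExponent, integral_smul_measure, ENNReal.toReal_natCast]
      simp) hδ hδR hE hER hnull
  have key' : Tendsto (fun n : ℕ => ((n : ℝ) + 1) * (entryLaw P A n).real E) atTop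
      (𝓝 (m.real E)) := by
    refine key.congr fun n => ?_
    rw [measureReal_ennreal_smul_apply, ENNReal.toReal_natCast]
    simp
  have hzero : Tendsto (fun n : ℕ => 1 / ((n : ℝ) + 1)) atTop (𝓝 0) :=
    tendsto_one_div_add_atTop_nhds_zero_nat
  have := key'.add (hzero.mul key')
  rw [zero_mul, add_zero] at this
  refine this.congr fun n => ?_
  field_simp
  ring

end

/-! ### Poisson limit of the numbers of points in finitely many cells -/

/-- The numbers of indices carrying each of the labels; the label `0` means
that an index is unlabelled, and such indices are not counted. -/
def labelCount {ι : Type*} [Fintype ι] {r : ℕ} (l : ι → Fin (r + 1)) (i : Fin r) : ℕ :=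
  (Finset.univ.filter fun j => l j = i.succ).card

theorem measurable_labelCount_comp {ι Ω : Type*} [Fintype ι] [MeasurableSpace Ω] {r : ℕ}
    {l : Ω → ι → Fin (r + 1)} (hl : Measurable l) : Measurable fun ω => labelCount (l ω) :=
  (measurable_of_countable (α := ι → Fin (r + 1)) labelCount).comp hl

/-- A vector of natural numbers as a point of Euclidean space. -/
def latticePoint {r : ℕ} (c : Fin r → ℕ) : EuclideanSpace ℝ (Fin r) :=
  WithLp.toLp 2 fun i => (c i : ℝ)

theorem latticePoint_eq_of_dist_le {r : ℕ} {c d : Fin r → ℕ}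
    (h : dist (latticePoint c) (latticePoint d) ≤ 1 / 2) : c = d := by
  funext i
  rw [dist_eq_norm] at h
  have h1 := (PiLp.norm_apply_le (latticePoint c - latticePoint d) i).trans h
  have h2 : |(c i : ℝ) - d i| ≤ 1 / 2 := h1
  have h3 : |((c i : ℤ) - d i : ℤ)| < 1 := by
    have : ((|((c i : ℤ) - d i : ℤ)| : ℤ) : ℝ) < 1 := by
      push_cast
      linarith
    exact_mod_cast this
  have := Int.abs_lt_one_iff.1 h3
  omega

/-- Convergence of characteristic functions of lattice-valued vectors implies convergence of the
point probabilities. -/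
theorem tendsto_measureReal_singleton_of_tendsto_charFun {r : ℕ} {κ : ℕ → Measure (Fin r → ℕ)}
    [∀ n, IsProbabilityMeasure (κ n)] {κ' : Measure (Fin r → ℕ)} [IsProbabilityMeasure κ']
    (h : ∀ t, Tendsto (fun n => charFun ((κ n).map latticePoint) t) atTop
      (𝓝 (charFun (κ'.map latticePoint) t))) (c : Fin r → ℕ) :
    Tendsto (fun n => (κ n).real {c}) atTop (𝓝 (κ'.real {c})) := by
  have hmeas : Measurable (latticePoint (r := r)) := measurable_of_countable _
  have hpr : ∀ ν : Measure (Fin r → ℕ), IsProbabilityMeasure ν →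
      IsProbabilityMeasure (ν.map latticePoint) := fun ν _ =>
    Measure.isProbabilityMeasure_map hmeas.aemeasurable
  let pm : (ν : Measure (Fin r → ℕ)) → IsProbabilityMeasure ν →
      ProbabilityMeasure (EuclideanSpace ℝ (Fin r)) := fun ν hν => ⟨ν.map latticePoint, hpr ν hν⟩
  have hw : Tendsto (fun n => pm (κ n) inferInstance) atTop (𝓝 (pm κ' inferInstance)) :=
    ProbabilityMeasure.tendsto_of_tendsto_charFun h
  have hball : ∀ ν : Measure (Fin r → ℕ),
      (ν.map latticePoint) (Metric.ball (latticePoint c) (1 / 2)) = ν {c} := by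
    intro ν
    rw [Measure.map_apply hmeas Metric.isOpen_ball.measurableSet]
    congr 1
    ext d
    simp only [Set.mem_preimage, Metric.mem_ball, Set.mem_singleton_iff]
    constructor
    · exact fun hd => latticePoint_eq_of_dist_le hd.le
    · rintro rfl
      simp
  have hfr : (κ'.map latticePoint) (frontier (Metric.ball (latticePoint c) (1 / 2))) = 0 := by
    rw [Measure.map_apply hmeas isClosed_frontier.measurableSet]
    convert measure_empty (μ := κ')
    refine Set.eq_empty_of_forall_notMem fun d hd => ?_
    have h1 : latticePoint d ∈ Metric.sphere (latticePoint c) (1 / 2) :=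
      Metric.frontier_ball_subset_sphere hd
    have h2 : d = c := latticePoint_eq_of_dist_le (Metric.mem_sphere.1 h1).le
    rw [h2, Metric.mem_sphere, dist_self] at h1
    norm_num at h1
  have key := ProbabilityMeasure.tendsto_measure_of_null_frontier_of_tendsto' hw hfr
  have e : ∀ ν hν, (pm ν hν : Measure _) (Metric.ball (latticePoint c) (1 / 2)) = ν {c} :=
    fun ν _ => hball ν
  simp only [e] at key
  exact (ENNReal.tendsto_toReal (measure_ne_top _ _)).comp key

theorem charFun_map_labelCount {r N : ℕ} (μ : Measure ℝ) [IsProbabilityMeasure μ]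
    {lab : ℝ → Fin (r + 1)} (hlab : Measurable lab) (t : EuclideanSpace ℝ (Fin r)) :
    charFun (((Measure.pi fun _ : Fin N => μ).map fun x => labelCount fun j => lab (x j)).map
      latticePoint) t =
      (1 + ∑ i, (μ.real (lab ⁻¹' {i.succ}) : ℂ) * (Complex.exp (t i * Complex.I) - 1)) ^ N := by
  have hmeas : Measurable fun x : Fin N → ℝ => labelCount fun j => lab (x j) :=
    measurable_labelCount_comp (measurable_pi_lambda _ fun j => hlab.comp (measurable_pi_apply j))
  have hmeas' : Measurable (latticePoint (r := r)) := measurable_of_countable _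
  rw [Measure.map_map hmeas' hmeas, charFun_apply,
    integral_map (hmeas'.comp hmeas).aemeasurable (by fun_prop)]
  let τ : Fin (r + 1) → ℝ := Fin.cases 0 t
  have e1 : ∀ x : Fin N → ℝ, Complex.exp ((inner ℝ ((latticePoint ∘ fun x : Fin N → ℝ =>
      labelCount fun j => lab (x j)) x) t : ℝ) * Complex.I) =
      ∏ j, Complex.exp (τ (lab (x j)) * Complex.I) := by
    intro x
    rw [← Complex.exp_sum, ← Finset.sum_mul, ← Complex.ofReal_sum]
    congr 3
    have h1 : ∀ j, τ (lab (x j)) = ∑ i, if lab (x j) = i.succ then t i else 0 := by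
      intro j
      induction lab (x j) using Fin.cases with
      | zero => simp [τ, (Fin.succ_ne_zero _).symm]
      | succ i => simp [τ]
    simp only [h1]
    rw [Finset.sum_comm, PiLp.inner_apply]
    refine Finset.sum_congr rfl fun i _ => ?_
    rw [← Finset.sum_filter, Finset.sum_const, nsmul_eq_mul]
    simp only [latticePoint, labelCount, Function.comp_apply, Real.inner_apply]
  rw [integral_congr_ae (ae_of_all _ e1)]
  rw [integral_fintype_prod_eq_pow (f := fun x : ℝ => Complex.exp (τ (lab x) * Complex.I)),
    Fintype.card_fin]
  congr 1
  have e2 : ∀ x : ℝ, Complex.exp (τ (lab x) * Complex.I) =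
      1 + ∑ i, (lab ⁻¹' {i.succ}).indicator (fun _ => Complex.exp (t i * Complex.I) - 1) x := by
    intro x
    classical
    simp only [Set.indicator_apply, Set.mem_preimage, Set.mem_singleton_iff]
    induction lab x using Fin.cases with
    | zero => simp [τ, (Fin.succ_ne_zero _).symm]
    | succ i => simp [τ]
  have hms : ∀ i : Fin r, MeasurableSet (lab ⁻¹' {i.succ}) := fun i => hlab (measurableSet_singleton _)
  have hint : ∀ i, Integrable
      ((lab ⁻¹' {i.succ}).indicator fun _ => Complex.exp (t i * Complex.I) - 1) μ := fun i =>
    (integrable_const _).indicator (hms i)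
  rw [integral_congr_ae (ae_of_all _ e2), integral_add (integrable_const _)
    (integrable_finsetSum _ fun i _ => hint i), integral_finsetSum _ fun i _ => hint i]
  simp only [integral_const, probReal_univ, one_smul]
  congr 1
  refine Finset.sum_congr rfl fun i _ => ?_
  rw [integral_indicator (hms i), setIntegral_const, Complex.real_smul]

/-- **Poisson limit theorem** for the numbers of points of an i.i.d. sample in disjoint cells. -/
theorem tendsto_labelCount_poisson {r : ℕ} {μ : ℕ → Measure ℝ} [∀ n, IsProbabilityMeasure (μ n)]
    {lab : ℝ → Fin (r + 1)} (hlab : Measurable lab) {lam : Fin r → ℝ≥0}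
    (h : ∀ i, Tendsto (fun n : ℕ => (n + 2) * (μ n).real (lab ⁻¹' {i.succ})) atTop (𝓝 (lam i)))
    (c : Fin r → ℕ) :
    Tendsto (fun n => (Measure.pi fun _ : Fin (n + 2) => μ n).real
      {x | (labelCount fun j => lab (x j)) = c}) atTop
      (𝓝 (∏ i, (poissonMeasure (lam i)).real {c i})) := by
  have hmeas : ∀ N, Measurable fun x : Fin N → ℝ => labelCount fun j => lab (x j) := fun N =>
    measurable_labelCount_comp (measurable_pi_lambda _ fun j => hlab.comp (measurable_pi_apply j))
  let κ : ℕ → Measure (Fin r → ℕ) := fun n =>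
    (Measure.pi fun _ : Fin (n + 2) => μ n).map fun x => labelCount fun j => lab (x j)
  have : ∀ n, IsProbabilityMeasure (κ n) := fun n =>
    Measure.isProbabilityMeasure_map (hmeas _).aemeasurable
  let κ' : Measure (Fin r → ℕ) := Measure.pi fun i => poissonMeasure (lam i)
  have key := tendsto_measureReal_singleton_of_tendsto_charFun (κ := κ) (κ' := κ') ?_ c
  · have e1 : ∀ n, (κ n).real {c} = (Measure.pi fun _ : Fin (n + 2) => μ n).real
        {x | (labelCount fun j => lab (x j)) = c} := by
      intro n
      rw [measureReal_def, Measure.map_apply (hmeas _) (measurableSet_singleton c)]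
      rfl
    have e2 : κ'.real {c} = ∏ i, (poissonMeasure (lam i)).real {c i} := by
      rw [measureReal_def, Measure.pi_singleton, ENNReal.toReal_prod]
      rfl
    rw [← e2]
    exact key.congr e1
  · intro t
    have e1 : charFun (κ'.map latticePoint) t =
        Complex.exp (∑ i, (lam i : ℂ) * (Complex.exp (t i * Complex.I) - 1)) := by
      have e3 : κ'.map latticePoint =
          (Measure.pi fun i => (poissonMeasure (lam i)).map (Nat.cast : ℕ → ℝ)).map
            (WithLp.toLp 2) := by
        rw [← Measure.pi_map_pi fun i => (measurable_of_countable _).aemeasurable,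
          Measure.map_map (by fun_prop) (measurable_of_countable _)]
        rfl
      rw [e3, charFun_pi, Complex.exp_sum]
      refine Finset.prod_congr rfl fun i _ => ?_
      rw [charFun_map_cast_poissonMeasure]
    rw [e1]
    simp only [κ, charFun_map_labelCount _ hlab]
    let g : ℕ → ℂ := fun n =>
      ∑ i, ((μ (n - 2)).real (lab ⁻¹' {i.succ}) : ℂ) * (Complex.exp (t i * Complex.I) - 1)
    have hg : Tendsto (fun n : ℕ => n * g n) atTop
        (𝓝 (∑ i, (lam i : ℂ) * (Complex.exp (t i * Complex.I) - 1))) := by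
      rw [← tendsto_add_atTop_iff_nat 2]
      have : Tendsto (fun n : ℕ => ∑ i, (((n + 2) * (μ n).real (lab ⁻¹' {i.succ}) : ℝ) : ℂ) *
          (Complex.exp (t i * Complex.I) - 1)) atTop
          (𝓝 (∑ i, (lam i : ℂ) * (Complex.exp (t i * Complex.I) - 1))) := by
        refine tendsto_finsetSum _ fun i _ => ?_
        exact ((Complex.continuous_ofReal.tendsto _).comp (h i)).mul_const _
      refine this.congr fun n => ?_
      simp only [g, Nat.add_sub_cancel]
      rw [Finset.mul_sum]
      refine Finset.sum_congr rfl fun i _ => ?_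
      push_cast
      ring
    have := (Complex.tendsto_one_add_pow_exp_of_tendsto hg).comp (tendsto_add_atTop_nat 2)
    refine this.congr fun n => ?_
    simp [g]

/-! ### The point processes of the tree -/

theorem lintegral_natCast_poissonMeasure (r : ℝ≥0) : ∫⁻ j : ℕ, (j : ℝ≥0∞) ∂(poissonMeasure r) = r := by
  rw [lintegral_countable']
  rw [tsum_eq_zero_add' ENNReal.summable]
  have e : ∀ j : ℕ, ((j + 1 : ℕ) : ℝ≥0∞) * poissonMeasure r {j + 1} = r * poissonMeasure r {j} := by
    intro j
    rw [poissonMeasure_singleton, poissonMeasure_singleton, ← ENNReal.ofReal_natCast,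
      ← ENNReal.ofReal_mul (Nat.cast_nonneg _), ← ENNReal.ofReal_coe_nnreal,
      ← ENNReal.ofReal_mul r.coe_nonneg]
    congr 1
    rw [Nat.factorial_succ]
    push_cast
    have : ((j : ℝ) + 1) ≠ 0 := by positivity
    have : (j.factorial : ℝ) ≠ 0 := by positivity
    field_simp
    ring
  simp only [e]
  rw [ENNReal.tsum_mul_left]
  have h1 : ∑' j, poissonMeasure r {j} = 1 := by
    have := lintegral_countable' (μ := poissonMeasure r) (fun _ => (1 : ℝ≥0∞))
    simpa using this.symm
  simp [h1]

theorem measure_sum_dirac_restrict_apply (x : ℕ → ℝ) {B : Set ℝ} (hB : MeasurableSet B) :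
    ((Measure.sum fun k => Measure.dirac (x k)).restrict {0}ᶜ) B =
      ∑' k, (B ∩ {0}ᶜ).indicator 1 (x k) := by
  have hB' : MeasurableSet (B ∩ {0}ᶜ) := hB.inter (measurableSet_singleton 0).compl
  rw [Measure.restrict_apply hB, Measure.sum_apply _ hB']
  exact tsum_congr fun k => Measure.dirac_apply' _ hB'

section

variable {Ω' : Type*} [MeasurableSpace Ω'] {P' : Measure Ω'}
  {m : Measure ℝ} {y : List ℕ → ℕ → Ω' → ℝ}

/-- **Campbell's formula**, as an inequality, for the points below a vertex. -/
theorem lintegral_tsum_le (hy : IsPWIT P' m y) (v : List ℕ) {g : ℝ → ℝ≥0∞} (hg : Measurable g)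
    (hg0 : g 0 = 0) : ∫⁻ ω, ∑' k, g (y v k ω) ∂P' ≤ ∫⁻ x, g x ∂m := by
  set η : Measure ℝ := (Measure.sum fun k => P'.map (y v k)).restrict {0}ᶜ with hη
  have hle : η ≤ m := by
    refine Measure.le_iff.2 fun B hB => ?_
    by_cases hfin : m B = ∞
    · rw [hfin]
      exact le_top
    refine le_of_eq ?_
    have hB' : MeasurableSet (B ∩ {0}ᶜ) := hB.inter (measurableSet_singleton 0).compl
    have h1 : η B = ∫⁻ ω, ((Measure.sum fun k => Measure.dirac (y v k ω)).restrict {0}ᶜ) B ∂P' := by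
      simp only [measure_sum_dirac_restrict_apply _ hB]
      rw [hη, Measure.restrict_apply hB, Measure.sum_apply _ hB', lintegral_tsum]
      · refine tsum_congr fun k => ?_
        rw [Measure.map_apply (hy.measurable v k) hB', ← lintegral_indicator_one
          (hy.measurable v k hB')]
        rfl
      · intro k
        exact ((measurable_one.indicator hB').comp (hy.measurable v k)).aemeasurable
    have h2 := lintegral_map (μ := P') (f := fun x : ℝ≥0∞ => x) measurable_id
      ((hy.poisson v).measurable_apply B hB)
    rw [h1, ← h2, (hy.poisson v).law_of_ne_top B hB hfin,
      lintegral_map (f := fun x : ℝ≥0∞ => x) measurable_id (measurable_of_countable _),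
      lintegral_natCast_poissonMeasure,
      ENNReal.coe_toNNReal hfin]
  calc ∫⁻ ω, ∑' k, g (y v k ω) ∂P' = ∑' k, ∫⁻ ω, g (y v k ω) ∂P' :=
        lintegral_tsum fun k => (hg.comp (hy.measurable v k)).aemeasurable
    _ = ∑' k, ∫⁻ x, g x ∂(P'.map (y v k)) := by
        refine tsum_congr fun k => ?_
        rw [lintegral_map hg (hy.measurable v k)]
    _ = ∫⁻ x, g x ∂(Measure.sum fun k => P'.map (y v k)) := by
        rw [lintegral_sum_measure]
    _ = ∫⁻ x, g x ∂η := by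
        rw [hη, ← lintegral_indicator (measurableSet_singleton 0).compl]
        refine lintegral_congr fun x => ?_
        by_cases hx : x = 0
        · simp [hx, hg0]
        · rw [Set.indicator_of_mem (by simpa using hx)]
    _ ≤ ∫⁻ x, g x ∂m := lintegral_mono' hle le_rfl

theorem measurableSet_le_abs_apply (hy : IsPWIT P' m y) (v : List ℕ) (k : ℕ) (δ : ℝ) :
    MeasurableSet {ω | δ ≤ |y v k ω|} := hy.measurable v k (measurableSet_le_abs δ)

theorem tsum_measure_le_abs_le (hy : IsPWIT P' m y) (v : List ℕ) {δ : ℝ} (hδ : 0 < δ) :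
    ∑' k, P' {ω | δ ≤ |y v k ω|} ≤ m {x | δ ≤ |x|} := by
  have h := lintegral_tsum_le hy v (g := ({x : ℝ | δ ≤ |x|}).indicator 1)
    (measurable_one.indicator (measurableSet_le_abs δ))
    (Set.indicator_of_notMem (by simpa using hδ) _)
  rw [lintegral_indicator_one (measurableSet_le_abs δ), lintegral_tsum] at h
  · refine le_trans (le_of_eq (tsum_congr fun k => ?_)) h
    rw [← lintegral_indicator_one (measurableSet_le_abs_apply hy v k δ)]
    rfl
  · intro k
    exact ((measurable_one.indicator (measurableSet_le_abs δ)).comp (hy.measurable v k)).aemeasurable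

theorem measure_exists_le_abs_le (hy : IsPWIT P' m y) (v : List ℕ) {δ : ℝ} (hδ : 0 < δ) :
    P' {ω | ∃ k, δ ≤ |y v k ω|} ≤ m {x | δ ≤ |x|} := by
  have e : {ω | ∃ k, δ ≤ |y v k ω|} = ⋃ k, {ω | δ ≤ |y v k ω|} := by
    ext ω
    simp
  rw [e]
  exact (measure_iUnion_le _).trans (tsum_measure_le_abs_le hy v hδ)

/-- Only finitely many points lie away from the origin, in a quantitative form. -/
theorem tendsto_measure_exists_ge (hy : IsPWIT P' m y) (hm : HasTruncatedMoment m) (v : List ℕ)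
    {δ : ℝ} (hδ : 0 < δ) :
    Tendsto (fun K : ℕ => P' {ω | ∃ k ≥ K, δ ≤ |y v k ω|}) atTop (𝓝 0) := by
  have hfin : ∑' k, P' {ω | δ ≤ |y v k ω|} ≠ ∞ :=
    ((tsum_measure_le_abs_le hy v hδ).trans_lt (measure_le_abs_lt_top hm hδ)).ne
  refine tendsto_of_tendsto_of_tendsto_of_le_of_le tendsto_const_nhds
    (ENNReal.tendsto_sum_nat_add _ hfin) (fun _ => zero_le) fun K => ?_
  have e : {ω | ∃ k ≥ K, δ ≤ |y v k ω|} = ⋃ k, {ω | δ ≤ |y v (k + K) ω|} := by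
    ext ω
    simp only [Set.mem_iUnion, Set.mem_ofPred_eq]
    constructor
    · rintro ⟨k, hk, h⟩
      exact ⟨k - K, by rwa [Nat.sub_add_cancel hk]⟩
    · rintro ⟨k, h⟩
      exact ⟨k + K, by omega, h⟩
  rw [e]
  exact measure_iUnion_le _

/-- The weights below a vertex are almost surely summable. -/
theorem ae_summable_abs (hy : IsPWIT P' m y) (hm : HasTruncatedMoment m) (v : List ℕ) :
    ∀ᵐ ω ∂P', Summable fun k => |y v k ω| := by
  have hle := lintegral_tsum_le hy v (g := fun x => ENNReal.ofReal (min |x| 1)) (by fun_prop)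
    (by simp)
  have hfin : ∫⁻ x, ENNReal.ofReal (min |x| 1) ∂m < ∞ := by
    have := hm.2
    rwa [hasFiniteIntegral_iff_ofReal
      (ae_of_all _ fun x => le_min (abs_nonneg x) zero_le_one)] at this
  have hmeas : AEMeasurable (fun ω => ∑' k, ENNReal.ofReal (min |y v k ω| 1)) P' := by
    refine AEMeasurable.tsum fun k => ?_
    exact (((hy.measurable v k).abs.min measurable_const).ennreal_ofReal).aemeasurable
  filter_upwards [ae_lt_top' hmeas (hle.trans_lt hfin).ne] with ω hω
  have hs : Summable fun k => min |y v k ω| 1 := by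
    have := ENNReal.summable_toReal hω.ne
    refine this.congr fun k => ?_
    rw [ENNReal.toReal_ofReal (le_min (abs_nonneg _) zero_le_one)]
  have h0 := hs.tendsto_atTop_zero.eventually (gt_mem_nhds one_pos)
  obtain ⟨N, hN⟩ := eventually_atTop.1 h0
  rw [← summable_nat_add_iff N]
  refine ((summable_nat_add_iff N).2 hs).congr fun k => ?_
  rcases min_lt_iff.1 (hN (k + N) (Nat.le_add_left _ k)) with h | h
  · rw [min_eq_left h.le]
  · exact absurd h (lt_irrefl _)

/-- Markov's inequality for the sum of the truncated weights below a vertex. -/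
theorem measure_le_tsum_min_le (hy : IsPWIT P' m y) (v : List ℕ) {δ ε : ℝ} (hδ : 0 ≤ δ)
    (hε : 0 < ε) :
    P' {ω | ENNReal.ofReal ε ≤ ∑' k, ENNReal.ofReal (min |y v k ω| δ)} ≤
      (∫⁻ x, ENNReal.ofReal (min |x| δ) ∂m) / ENNReal.ofReal ε := by
  have hmeas : AEMeasurable (fun ω => ∑' k, ENNReal.ofReal (min |y v k ω| δ)) P' := by
    refine AEMeasurable.tsum fun k => ?_
    exact (((hy.measurable v k).abs.min measurable_const).ennreal_ofReal).aemeasurable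
  refine (meas_ge_le_lintegral_div hmeas (ENNReal.ofReal_pos.2 hε).ne' ENNReal.ofReal_ne_top).trans ?_
  refine ENNReal.div_le_div_right ?_ _
  exact lintegral_tsum_le hy v (g := fun x => ENNReal.ofReal (min |x| δ)) (by fun_prop)
    (by simp [hδ])

/-- The numbers of points in disjoint cells away from the origin are independent Poisson
variables. -/
theorem measureReal_forall_eq_poisson [IsProbabilityMeasure P'] (hy : IsPWIT P' m y) (v : List ℕ)
    {r : ℕ} {B : Fin r → Set ℝ}
    (hB : ∀ i, MeasurableSet (B i)) (hdisj : Pairwise (Function.onFun Disjoint B))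
    (hfin : ∀ i, m (B i) ≠ ∞) (c : Fin r → ℕ) :
    P'.real {ω | ∀ i, ((Measure.sum fun k => Measure.dirac (y v k ω)).restrict {0}ᶜ) (B i) = c i} =
      ∏ i, (poissonMeasure (m (B i)).toNNReal).real {c i} := by
  have hind := (hy.poisson v).indep r B hB hdisj
  have h1 := hind.measure_inter_preimage_eq_mul Finset.univ (sets := fun i => {(c i : ℝ≥0∞)})
    fun i _ => measurableSet_singleton _
  have e : {ω | ∀ i, ((Measure.sum fun k => Measure.dirac (y v k ω)).restrict {0}ᶜ) (B i) = c i} =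
      ⋂ i ∈ (Finset.univ : Finset (Fin r)), (fun ω =>
        ((Measure.sum fun k => Measure.dirac (y v k ω)).restrict {0}ᶜ) (B i)) ⁻¹' {(c i : ℝ≥0∞)} := by
    ext ω
    simp
  rw [measureReal_def, e, h1, ENNReal.toReal_prod]
  refine Finset.prod_congr rfl fun i _ => ?_
  rw [← Measure.map_apply ((hy.poisson v).measurable_apply _ (hB i)) (measurableSet_singleton _),
    (hy.poisson v).law_of_ne_top _ (hB i) (hfin i),
    Measure.map_apply (measurable_of_countable _) (measurableSet_singleton _), measureReal_def]
  congr 2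
  ext j
  simp

end

/-! ### Numbering of the words and matching of labels -/

/-- The numbering of the words by natural numbers; it satisfies that a word comes before its
children. -/
def wordEquiv : List ℕ ≃ ℕ := Denumerable.eqv (List ℕ)

theorem wordEquiv_nil : wordEquiv [] = 0 := rfl

theorem wordEquiv_symm_zero : wordEquiv.symm 0 = [] := by
  rw [Equiv.symm_apply_eq, wordEquiv_nil]

theorem wordEquiv_lt_cons (k : ℕ) (v : List ℕ) : wordEquiv v < wordEquiv (k :: v) := by
  change Encodable.encode v < Encodable.encode (k :: v)
  rw [Encodable.encode_list_cons]
  exact Nat.lt_succ_of_le (Nat.right_le_pair _ _)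

/-- The number of the `k`-th child of the `u`-th word. -/
def childIndex (u k : ℕ) : ℕ := wordEquiv (k :: wordEquiv.symm u)

theorem lt_childIndex (u k : ℕ) : u < childIndex u k := by
  simpa [childIndex] using wordEquiv_lt_cons k (wordEquiv.symm u)

theorem childIndex_inj {u k u' k' : ℕ} (h : childIndex u k = childIndex u' k') :
    u = u' ∧ k = k' := by
  have := wordEquiv.injective h
  rw [List.cons.injEq] at this
  exact ⟨wordEquiv.symm.injective this.2, this.1⟩

/-- If the labels on `Fin N` and on `Fin K` have the same multiplicities, the labelled indices can be
matched bijectively. -/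
theorem exists_matching {N K r : ℕ} {l : Fin N → Fin (r + 1)} {d : Fin K → Fin (r + 1)}
    (h : labelCount l = labelCount d) :
    ∃ τ : Fin K → Option (Fin N), (∀ k j, τ k = some j → l j = d k ∧ d k ≠ 0) ∧
      (∀ k k' j, τ k = some j → τ k' = some j → k = k') ∧ (∀ k, d k ≠ 0 → τ k ≠ none) ∧
      ∀ j, l j ≠ 0 → ∃ k, τ k = some j := by
  classical
  have he : ∀ i : Fin r, Nonempty ({k // d k = i.succ} ≃ {j // l j = i.succ}) := fun i => by
    refine ⟨Fintype.equivOfCardEq ?_⟩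
    rw [Fintype.card_subtype, Fintype.card_subtype]
    exact (congrFun h i).symm
  obtain ⟨e⟩ : Nonempty (∀ i : Fin r, {k // d k = i.succ} ≃ {j // l j = i.succ}) :=
    ⟨fun i => (he i).some⟩
  refine ⟨fun k => if hk : d k = 0 then none
    else some (e ((d k).pred hk) ⟨k, (Fin.succ_pred _ hk).symm⟩).1, ?_, ?_, ?_, ?_⟩
  · intro k j hj
    by_cases hk : d k = 0
    · simp [hk] at hj
    · simp only [hk, dite_false, Option.some.injEq] at hj
      refine ⟨?_, hk⟩
      rw [← hj, (e ((d k).pred hk) _).2, Fin.succ_pred]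
  · intro k k' j hj hj'
    by_cases hk : d k = 0
    · simp [hk] at hj
    by_cases hk' : d k' = 0
    · simp [hk'] at hj'
    simp only [hk, dite_false, Option.some.injEq] at hj
    simp only [hk', dite_false, Option.some.injEq] at hj'
    have hl : l j = d k := by rw [← hj, (e ((d k).pred hk) _).2, Fin.succ_pred]
    have hl' : l j = d k' := by rw [← hj', (e ((d k').pred hk') _).2, Fin.succ_pred]
    have hdd : d k' = d k := hl'.symm.trans hl
    have hpred : (d k').pred hk' = (d k).pred hk := by simp [hdd]
    have key : ∀ (i : Fin r) (a : {k // d k = i.succ}), i = (d k).pred hk → (e i a).1 = j →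
        a.1 = k := by
      rintro i a rfl ha
      have : e _ a = e _ ⟨k, (Fin.succ_pred _ hk).symm⟩ := Subtype.ext (ha.trans hj.symm)
      have := (e _).injective this
      rw [this]
    exact (key _ ⟨k', (Fin.succ_pred _ hk').symm⟩ hpred hj').symm
  · intro k hk
    simp [hk]
  · intro j hj
    have hs : l j = ((l j).pred hj).succ := (Fin.succ_pred _ hj).symm
    obtain ⟨⟨k, hk⟩, hkj⟩ := (e ((l j).pred hj)).surjective ⟨j, hs⟩
    have hk0 : d k ≠ 0 := by
      rw [hk]
      exact Fin.succ_ne_zero _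
    refine ⟨k, ?_⟩
    have hpred : (d k).pred hk0 = (l j).pred hj := by
      rw [← Fin.succ_inj, Fin.succ_pred, hk]
    have key : ∀ (i : Fin r) (hi : d k = i.succ), i = (l j).pred hj → (e i ⟨k, hi⟩).1 = j := by
      rintro i hi rfl
      rw [hkj]
    simp only [hk0, dite_false, Option.some.injEq]
    exact key _ _ hpred

open Classical in
/-- A matching of labelled indices; it is empty if the multiplicities of the labels differ. -/
def matching {N K r : ℕ} (l : Fin N → Fin (r + 1)) (d : Fin K → Fin (r + 1)) :
    Fin K → Option (Fin N) :=
  if h : labelCount l = labelCount d then Classical.choose (exists_matching h) else fun _ => none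

section

variable {N K r : ℕ} {l : Fin N → Fin (r + 1)} {d : Fin K → Fin (r + 1)}

theorem matching_spec {k : Fin K} {j : Fin N} (hj : matching l d k = some j) :
    l j = d k ∧ d k ≠ 0 := by
  unfold matching at hj
  split_ifs at hj with h
  exact (Classical.choose_spec (exists_matching h)).1 k j hj

theorem matching_inj {k k' : Fin K} {j : Fin N} (hj : matching l d k = some j)
    (hj' : matching l d k' = some j) : k = k' := by
  unfold matching at hj hj'
  split_ifs at hj hj' with h
  exact (Classical.choose_spec (exists_matching h)).2.1 k k' j hj hj'

theorem matching_ne_none (h : labelCount l = labelCount d) {k : Fin K} (hk : d k ≠ 0) :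
    matching l d k ≠ none := by
  rw [matching, dif_pos h]
  exact (Classical.choose_spec (exists_matching h)).2.2.1 k hk

theorem exists_matching_eq_some (h : labelCount l = labelCount d) {j : Fin N} (hj : l j ≠ 0) :
    ∃ k, matching l d k = some j := by
  rw [matching, dif_pos h]
  exact (Classical.choose_spec (exists_matching h)).2.2.2 j hj

end

/-! ### Placing the first words of the tree at vertices of the matrix -/

/-- The vertex proposed for the `w`-th word: if the word is the `k`-th child of one of the first
`h` words, with `k < K`, the vertex matched to `k`. -/
def candidate {h K t N r : ℕ} (l : Fin h → Fin N → Fin (r + 1)) (d : Fin h → Fin K → Fin (r + 1))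
    (w : Fin t) : Option (Fin N) :=
  match wordEquiv.symm w with
  | [] => none
  | k :: v => if H : wordEquiv v < h ∧ k < K then
      matching (l ⟨wordEquiv v, H.1⟩) (d ⟨wordEquiv v, H.1⟩) ⟨k, H.2⟩ else none

section

variable {h K t N r : ℕ} {l : Fin h → Fin N → Fin (r + 1)} {d : Fin h → Fin K → Fin (r + 1)}

theorem candidate_child {w : Fin t} {u : Fin h} {k : Fin K} (hw : (w : ℕ) = childIndex u k) :
    candidate l d w = matching (l u) (d u) k := by
  have e : wordEquiv.symm w = (k : ℕ) :: wordEquiv.symm u := by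
    rw [hw, childIndex, Equiv.symm_apply_apply]
  unfold candidate
  rw [e]
  simp

theorem exists_of_candidate_eq_some {w : Fin t} {j : Fin N} (hj : candidate l d w = some j) :
    ∃ (u : Fin h) (k : Fin K), (w : ℕ) = childIndex u k ∧ matching (l u) (d u) k = some j := by
  unfold candidate at hj
  split at hj
  · simp at hj
  · rename_i k v e
    split_ifs at hj with H
    refine ⟨⟨wordEquiv v, H.1⟩, ⟨k, H.2⟩, ?_, hj⟩
    rw [childIndex, Equiv.symm_apply_apply, ← e, Equiv.apply_symm_apply]

theorem candidate_congr {l' : Fin h → Fin N → Fin (r + 1)} {d' : Fin h → Fin K → Fin (r + 1)}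
    {w : Fin t} (hl : ∀ u : Fin h, (u : ℕ) < w → l u = l' u ∧ d u = d' u) :
    candidate l d w = candidate l' d' w := by
  unfold candidate
  split
  · rfl
  · rename_i k v e
    split_ifs with H
    · have : wordEquiv v < w := by
        have := wordEquiv_lt_cons k v
        rwa [← e, Equiv.apply_symm_apply] at this
      rw [(hl ⟨wordEquiv v, H.1⟩ this).1, (hl ⟨wordEquiv v, H.1⟩ this).2]
    · rfl

end

open Classical in
/-- The vertex at which the `w`-th word is placed: the proposed one, if it is not reserved (the
first `t` vertices are) and was not proposed before, and the `w`-th vertex otherwise. -/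
def placement {t N : ℕ} (htN : t ≤ N) (cand : Fin t → Option (Fin N)) (w : Fin t) : Fin N :=
  (cand w).elim (Fin.castLE htN w) fun j =>
    if t ≤ (j : ℕ) ∧ ∀ w' < w, cand w' ≠ some j then j else Fin.castLE htN w

section

variable {t N : ℕ} {htN : t ≤ N} {cand : Fin t → Option (Fin N)}

theorem placement_eq_or (cand : Fin t → Option (Fin N)) (w : Fin t) :
    (placement htN cand w = Fin.castLE htN w) ∨
      (cand w = some (placement htN cand w) ∧ t ≤ (placement htN cand w : ℕ) ∧
        ∀ w' < w, cand w' ≠ some (placement htN cand w)) := by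
  unfold placement
  cases hj : cand w with
  | none => left; rfl
  | some j =>
    simp only [Option.elim_some]
    split_ifs with H
    · right
      exact ⟨rfl, H⟩
    · left
      rfl

theorem placement_of_some {w : Fin t} {j : Fin N} (hj : cand w = some j) (ht : t ≤ (j : ℕ))
    (hlt : ∀ w' < w, cand w' ≠ some j) : placement htN cand w = j := by
  rw [placement, hj, Option.elim_some, if_pos ⟨ht, hlt⟩]

theorem placement_of_none {w : Fin t} (hj : cand w = none) :
    placement htN cand w = Fin.castLE htN w := by
  rw [placement, hj, Option.elim_none]

theorem placement_injective (htN : t ≤ N) (cand : Fin t → Option (Fin N)) :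
    Function.Injective (placement htN cand) := by
  intro w w' hww
  rcases placement_eq_or (htN := htN) cand w with h1 | ⟨h1, h2, h3⟩ <;>
    rcases placement_eq_or (htN := htN) cand w' with h1' | ⟨h1', h2', h3'⟩
  · rw [h1, h1'] at hww
    simpa [Fin.ext_iff] using hww
  · rw [← hww, h1] at h2'
    simp at h2'
    omega
  · rw [hww, h1'] at h2
    simp at h2
    omega
  · rcases lt_trichotomy w w' with hlt | heq | hlt
    · exact absurd (hww ▸ h1) (h3' w hlt)
    · exact heq
    · exact absurd (hww ▸ h1') (h3 w' hlt)

theorem placement_congr {cand' : Fin t → Option (Fin N)} {w : Fin t}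
    (h : ∀ w' ≤ w, cand w' = cand' w') : placement htN cand w = placement htN cand' w := by
  have e : ∀ j, (∀ w' < w, cand w' ≠ some j) ↔ (∀ w' < w, cand' w' ≠ some j) := fun j =>
    forall₂_congr fun w' hw' => by rw [h w' hw'.le]
  simp only [placement, h w le_rfl, e]

end

/-- A map on sequences whose value at each index only depends on the previous entries has a unique
fixed point. -/
theorem existsUnique_fixed_of_forall_lt {t : ℕ} {α : Type*} [Nonempty α]
    (F : (Fin t → α) → Fin t → α)
    (hF : ∀ s s' w, (∀ w' < w, s w' = s' w') → F s w = F s' w) : ∃! s, F s = s := by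
  have hex : ∀ k : ℕ, ∃ s, ∀ w : Fin t, (w : ℕ) < k → F s w = s w := by
    intro k
    induction k with
    | zero => exact ⟨fun _ => Classical.arbitrary α, fun w hw => absurd hw (Nat.not_lt_zero _)⟩
    | succ k ih =>
      obtain ⟨s, hs⟩ := ih
      exact ⟨F s, fun w hw => hF _ _ w fun w' hw' => hs w' (by rw [Fin.lt_def] at hw'; omega)⟩
  obtain ⟨s, hs⟩ := hex t
  refine ⟨s, funext fun w => hs w w.isLt, fun s' hs' => ?_⟩
  have : ∀ (k : ℕ) (w : Fin t), (w : ℕ) < k → s' w = s w := by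
    intro k
    induction k with
    | zero => exact fun w hw => absurd hw (Nat.not_lt_zero _)
    | succ k ih =>
      intro w hw
      rw [← congrFun hs' w, ← hs w w.isLt]
      exact hF _ _ w fun w' hw' => ih w' (by rw [Fin.lt_def] at hw'; omega)
  exact funext fun w => this t w w.isLt

open Classical in
/-- The row of the `u`-th explored vertex `s u`: the entries towards vertices that were explored
before are replaced by the fresh entries `R u`. -/
def exploredRow {h t N : ℕ} (hht : h ≤ t) (M : Matrix (Fin N) (Fin N) ℝ) (s : Fin t → Fin N)
    (R : Fin h → Fin N → ℝ) (u : Fin h) (j : Fin N) : ℝ :=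
  if ∃ u' ≤ Fin.castLE hht u, s u' = j then R u j else M (s (Fin.castLE hht u)) j

theorem exploredRow_congr {h t N : ℕ} {hht : h ≤ t} {M : Matrix (Fin N) (Fin N) ℝ}
    {s s' : Fin t → Fin N} {R : Fin h → Fin N → ℝ} {u : Fin h}
    (hs : ∀ u' ≤ Fin.castLE hht u, s u' = s' u') :
    exploredRow hht M s R u = exploredRow hht M s' R u := by
  funext j
  have e : (∃ u' ≤ Fin.castLE hht u, s u' = j) ↔ ∃ u' ≤ Fin.castLE hht u, s' u' = j :=
    exists_congr fun u' => and_congr_right fun hu' => by rw [hs u' hu']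
  simp only [exploredRow, e, hs _ le_rfl]

/-! ### Exploration of a random matrix -/

theorem measurePreserving_precomp {ι κ : Type*} [Fintype ι] [Fintype κ] {g : κ → ι}
    (hg : Function.Injective g) (μ : Measure ℝ) [IsProbabilityMeasure μ] :
    MeasurePreserving (fun (x : ι → ℝ) k => x (g k)) (Measure.pi fun _ => μ)
      (Measure.pi fun _ => μ) := by
  refine ⟨measurable_pi_lambda _ fun k => measurable_pi_apply _, ?_⟩
  have h1 : iIndepFun (fun (i : ι) (x : ι → ℝ) => x i) (Measure.pi fun _ : ι => μ) :=
    iIndepFun_pi (X := fun _ x => x) fun _ => aemeasurable_id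
  have h2 := (h1.precomp hg).map_fun_eq_pi_map fun k => (measurable_pi_apply (g k)).aemeasurable
  rw [h2]
  congr 1
  funext k
  exact (measurePreserving_eval (fun _ : ι => μ) (g k)).map_eq

theorem measurePreserving_curry (κ ι : Type*) [Fintype κ] [Fintype ι] (μ : Measure ℝ)
    [IsProbabilityMeasure μ] :
    MeasurePreserving (MeasurableEquiv.curry κ ι ℝ) (Measure.pi fun _ => μ)
      (Measure.pi fun _ => Measure.pi fun _ => μ) := by
  refine ⟨(MeasurableEquiv.curry κ ι ℝ).measurable, ?_⟩
  have := Measure.infinitePi_map_curry (fun (_ : κ) (_ : ι) => μ)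
  simpa only [Measure.infinitePi_eq_pi] using this

/-- If a random map takes the value `p (g x) x`, where `g x` can be recovered from the value by `f`
and is the only index with this property, then it is measure preserving as soon as all the maps
`p s` are. -/
theorem measurePreserving_of_unique {X Y S : Type*} [MeasurableSpace X] [MeasurableSpace Y]
    [MeasurableSpace S] [MeasurableSingletonClass S] [Countable S] {Q : Measure X} {ρ : Measure Y}
    {p : S → X → Y} {f : Y → S} {g : X → S} (hf : Measurable f) (hpm : ∀ s, Measurable (p s))
    (hp : ∀ s ∈ Set.range f, MeasurePreserving (p s) Q ρ) (hg : ∀ x s, g x = s ↔ f (p s x) = s) :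
    Measurable g ∧ MeasurePreserving (fun x => p (g x) x) Q ρ := by
  have hgm : Measurable g := by
    refine measurable_to_countable' fun s => ?_
    have : g ⁻¹' {s} = (fun x => f (p s x)) ⁻¹' {s} := by
      ext x
      exact hg x s
    rw [this]
    exact (hf.comp (hpm s)) (measurableSet_singleton s)
  have hm : Measurable fun x => p (g x) x := by
    have : Measurable fun q : S × X => p q.1 q.2 := measurable_from_prod_countable_right hpm
    exact this.comp (hgm.prodMk measurable_id)
  refine ⟨hgm, hm, Measure.ext fun E hE => ?_⟩
  have hdec : ∀ (α : Type _) [MeasurableSpace α] (ν : Measure α) (φ : α → S), Measurable φ →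
      ∀ F, MeasurableSet F → ν F = ∑' s, ν (φ ⁻¹' {s} ∩ F) := by
    intro α _ ν φ hφ F hF
    rw [← measure_iUnion]
    · rw [← Set.iUnion_inter, ← Set.preimage_iUnion, Set.iUnion_of_singleton, Set.preimage_univ,
        Set.univ_inter]
    · intro s s' hss
      refine Set.disjoint_left.2 fun x hx hx' => hss ?_
      exact hx.1.symm.trans hx'.1
    · exact fun s => (hφ (measurableSet_singleton s)).inter hF
  rw [Measure.map_apply hm hE, hdec _ Q g hgm _ (hm hE)]
  have hdecY : ρ E = ∑' s, ρ (f ⁻¹' {s} ∩ E) := by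
    rw [← measure_iUnion]
    · rw [← Set.iUnion_inter, ← Set.preimage_iUnion, Set.iUnion_of_singleton, Set.preimage_univ,
        Set.univ_inter]
    · intro s s' hss
      refine Set.disjoint_left.2 fun x hx hx' => hss ?_
      exact hx.1.symm.trans hx'.1
    · exact fun s => (hf (measurableSet_singleton s)).inter hE
  rw [hdecY]
  refine tsum_congr fun s => ?_
  have e : g ⁻¹' {s} ∩ (fun x => p (g x) x) ⁻¹' E = p s ⁻¹' (f ⁻¹' {s} ∩ E) := by
    ext x
    simp only [Set.mem_inter_iff, Set.mem_preimage, Set.mem_singleton_iff]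
    constructor
    · rintro ⟨h1, h2⟩
      rw [h1] at h2
      exact ⟨(hg x s).1 h1, h2⟩
    · rintro ⟨h1, h2⟩
      have h3 := (hg x s).2 h1
      rw [h3]
      exact ⟨rfl, h2⟩
  rw [e]
  by_cases hs : s ∈ Set.range f
  · exact (hp s hs).measure_preimage ((hf (measurableSet_singleton s)).inter hE).nullMeasurableSet
  · have : f ⁻¹' {s} ∩ E = ∅ := by
      refine Set.eq_empty_of_forall_notMem fun x hx => hs ⟨x, hx.1⟩
    rw [this]
    simp

/-- A random symmetric matrix with i.i.d. entries of law `μ` above the diagonal. -/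
structure IsIIDSymmetric {Ω : Type*} [MeasurableSpace Ω] (P : Measure Ω) {N : ℕ}
    (M : Ω → Matrix (Fin N) (Fin N) ℝ) (μ : Measure ℝ) : Prop where
  measurable_entry : ∀ i j, Measurable fun ω => M ω i j
  symm : ∀ ω i j, M ω i j = M ω j i
  map_eq : P.map (fun ω (p : {p : Fin N × Fin N // p.1 < p.2}) => M ω p.1.1 p.1.2) =
    Measure.pi fun _ => μ

open Classical in
/-- The coordinate that is read off by `exploredRow`: an entry of the matrix above the diagonal or
a fresh variable. -/
def exploredIndex {h t N : ℕ} (hht : h ≤ t) (s : Fin t → Fin N) (q : Fin h × Fin N) :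
    {p : Fin N × Fin N // p.1 < p.2} ⊕ (Fin h × Fin N) :=
  if H : ∃ u' ≤ Fin.castLE hht q.1, s u' = q.2 then .inr q
  else .inl ⟨(min (s (Fin.castLE hht q.1)) q.2, max (s (Fin.castLE hht q.1)) q.2),
    min_lt_max.2 fun e => H ⟨_, le_rfl, e⟩⟩

/-- An entry between two explored vertices is read only once, in the row of the vertex explored first;
in the other row it is replaced by a fresh variable. -/
theorem exploredIndex_injective {h t N : ℕ} (hht : h ≤ t) {s : Fin t → Fin N}
    (hs : Function.Injective s) : Function.Injective (exploredIndex hht s) := by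
  rintro ⟨u, j⟩ ⟨u', j'⟩ heq
  unfold exploredIndex at heq
  split_ifs at heq with H H' H'
  · exact Sum.inr_injective heq
  · have h1 := Sum.inl_injective heq
    simp only [Subtype.mk.injEq, Prod.mk.injEq] at h1
    obtain ⟨hmin, hmax⟩ := h1
    have hcases : (s (Fin.castLE hht u) = s (Fin.castLE hht u') ∧ j = j') ∨
        (s (Fin.castLE hht u) = j' ∧ j = s (Fin.castLE hht u')) := by
      grind
    rcases hcases with ⟨h1, h2⟩ | ⟨h1, h2⟩
    · have := hs h1
      simp only [Fin.ext_iff, Fin.val_castLE] at this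
      rw [h2, Fin.ext this]
    · rcases le_total u u' with hle | hle
      · exact absurd ⟨Fin.castLE hht u, hle, h1⟩ H'
      · exact absurd ⟨Fin.castLE hht u', hle, h2.symm⟩ H

section

variable {Ω : Type*} [MeasurableSpace Ω] {P : Measure Ω} [IsProbabilityMeasure P] {N : ℕ}
  {M : Ω → Matrix (Fin N) (Fin N) ℝ} {μ : Measure ℝ} [IsProbabilityMeasure μ] {h t : ℕ}

/-- Along a deterministic placement the explored rows are i.i.d., since they read off pairwise distinct
coordinates of the product of the matrix entries and the fresh variables. -/
theorem measurePreserving_exploredRow (hM : IsIIDSymmetric P M μ) (hht : h ≤ t) {s : Fin t → Fin N}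
    (hs : Function.Injective s) :
    MeasurePreserving (fun q : Ω × (Fin h → Fin N → ℝ) => exploredRow hht (M q.1) s q.2)
      (P.prod (Measure.pi fun _ => Measure.pi fun _ => μ))
      (Measure.pi fun _ => Measure.pi fun _ => μ) := by
  have e1 : MeasurePreserving
      (fun ω (p : {p : Fin N × Fin N // p.1 < p.2}) => M ω p.1.1 p.1.2) P
      (Measure.pi fun _ => μ) :=
    ⟨measurable_pi_lambda _ fun p => hM.measurable_entry _ _, hM.map_eq⟩
  have e2 := (measurePreserving_curry (Fin h) (Fin N) μ).symm
  have e3 := (measurePreserving_sumPiEquivProdPi_symm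
    (X := fun _ : {p : Fin N × Fin N // p.1 < p.2} ⊕ (Fin h × Fin N) => ℝ) fun _ => μ).comp
      (e1.prod e2)
  have e4 := (measurePreserving_precomp (exploredIndex_injective hht hs) μ).comp e3
  have e5 := (measurePreserving_curry (Fin h) (Fin N) μ).comp e4
  convert e5 using 1
  funext q u j
  simp only [Function.comp_apply, exploredRow]
  change _ = (MeasurableEquiv.sumPiEquivProdPi
    fun _ : {p : Fin N × Fin N // p.1 < p.2} ⊕ (Fin h × Fin N) => ℝ).symm
    (Prod.map (fun ω (p : {p : Fin N × Fin N // p.1 < p.2}) => M ω p.1.1 p.1.2)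
      (MeasurableEquiv.curry (Fin h) (Fin N) ℝ).symm q) (exploredIndex hht s (u, j))
  unfold exploredIndex
  split_ifs with H
  · rfl
  · change _ = M q.1 (min (s (Fin.castLE hht u)) j) (max (s (Fin.castLE hht u)) j)
    rcases le_total (s (Fin.castLE hht u)) j with hle | hle
    · rw [min_eq_left hle, max_eq_right hle]
    · rw [min_eq_right hle, max_eq_left hle, hM.symm]

variable {β : Type*} [MeasurableSpace β]

/-- Exploration of the rows of the matrix `M` at the vertices `s 0, …, s (h - 1)`, with fresh
entries taken from the first components of `x`. The second components of `x` are additional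
randomness attached to the rows. -/
def explore (hht : h ≤ t) (M : Matrix (Fin N) (Fin N) ℝ) (s : Fin t → Fin N)
    (x : Fin h → (Fin N → ℝ) × β) (u : Fin h) : (Fin N → ℝ) × β :=
  (exploredRow hht M s (fun u => (x u).1) u, (x u).2)

theorem measurable_explore (hM : ∀ i j, Measurable fun ω => M ω i j) (hht : h ≤ t)
    (s : Fin t → Fin N) :
    Measurable fun q : Ω × (Fin h → (Fin N → ℝ) × β) => explore hht (M q.1) s q.2 := by
  refine measurable_pi_lambda _ fun u => Measurable.prodMk (measurable_pi_lambda _ fun j => ?_)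
    (by fun_prop)
  simp only [exploredRow]
  split_ifs
  · fun_prop
  · exact (hM _ _).comp measurable_fst

theorem measurePreserving_explore (hM : IsIIDSymmetric P M μ) (hht : h ≤ t) {s : Fin t → Fin N}
    (hs : Function.Injective s) (ζ : Fin h → Measure β) [∀ u, IsProbabilityMeasure (ζ u)] :
    MeasurePreserving (fun q : Ω × (Fin h → (Fin N → ℝ) × β) => explore hht (M q.1) s q.2)
      (P.prod (Measure.pi fun u => (Measure.pi fun _ => μ).prod (ζ u)))
      (Measure.pi fun u => (Measure.pi fun _ => μ).prod (ζ u)) := by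
  have hE := measurePreserving_arrowProdEquivProdArrow (Fin N → ℝ) β (Fin h)
    (fun _ => Measure.pi fun _ => μ) ζ
  have e1 := (MeasurePreserving.id P).prod hE
  have e2 := (measurePreserving_prodAssoc P (Measure.pi fun _ : Fin h => Measure.pi fun _ : Fin N => μ)
    (Measure.pi ζ)).symm.comp e1
  have e3 := ((measurePreserving_exploredRow hM hht hs).prod
    (MeasurePreserving.id (Measure.pi ζ))).comp e2
  exact hE.symm.comp e3

/-- Adaptive exploration: if the placement `f` of the `w`-th word only depends on the rows explored
before, a matrix with i.i.d. entries can be explored along a random placement `g` that is consistent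
with the rows seen, and these rows are i.i.d. -/
theorem exists_exploration (hM : IsIIDSymmetric P M μ) (hht : h ≤ t) (htN : t ≤ N) (ζ : Fin h → Measure β)
    [∀ u, IsProbabilityMeasure (ζ u)] {f : (Fin h → (Fin N → ℝ) × β) → Fin t → Fin N}
    (hf : Measurable f) (hinj : ∀ x, Function.Injective (f x))
    (hlt : ∀ x x' (w : Fin t), (∀ u : Fin h, (u : ℕ) < w → x u = x' u) → f x w = f x' w) :
    ∃ g : Ω × (Fin h → (Fin N → ℝ) × β) → Fin t → Fin N, Measurable g ∧
      (∀ q, f (explore hht (M q.1) (g q) q.2) = g q) ∧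
      MeasurePreserving (fun q => explore hht (M q.1) (g q) q.2)
        (P.prod (Measure.pi fun u => (Measure.pi fun _ => μ).prod (ζ u)))
        (Measure.pi fun u => (Measure.pi fun _ => μ).prod (ζ u)) := by
  have hex : ∀ q : Ω × (Fin h → (Fin N → ℝ) × β),
      ∃! s : Fin t → Fin N, f (explore hht (M q.1) s q.2) = s := by
    intro q
    rcases Nat.eq_zero_or_pos t with h0 | hpos
    · subst h0
      exact ⟨Fin.elim0, Subsingleton.elim _ _, fun _ _ => Subsingleton.elim _ _⟩
    have : Nonempty (Fin N) := ⟨⟨0, hpos.trans_le htN⟩⟩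
    refine existsUnique_fixed_of_forall_lt (fun s => f (explore hht (M q.1) s q.2)) ?_
    intro s s' w hs
    refine hlt _ _ w fun u hu => ?_
    have := exploredRow_congr (hht := hht) (M := M q.1) (s := s) (s' := s')
      (R := fun u => (q.2 u).1) (u := u) fun u' hu' => hs u' (by
        rw [Fin.lt_def]
        rw [Fin.le_def, Fin.val_castLE] at hu'
        omega)
    simp only [explore, this]
  choose g hg hguniq using hex
  have key := measurePreserving_of_unique (Q := P.prod (Measure.pi fun u => (Measure.pi fun _ => μ).prod (ζ u)))
    (p := fun (s : Fin t → Fin N) (q : Ω × (Fin h → (Fin N → ℝ) × β)) => explore hht (M q.1) s q.2)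
    (f := f) (g := g) hf (fun s => measurable_explore hM.measurable_entry hht s)
    (fun s hs => by
      obtain ⟨x, rfl⟩ := hs
      exact measurePreserving_explore hM hht (hinj x) ζ)
    (fun q s => ⟨fun e => e ▸ hg q, fun e => (hguniq q s e).symm⟩)
  exact ⟨g, key.1, hg, key.2⟩

end

/-! ### Cells -/

theorem countable_setOf_measure_singleton_ne_zero {m : Measure ℝ} (hm : HasTruncatedMoment m) :
    {x : ℝ | x ≠ 0 ∧ m {x} ≠ 0}.Countable := by
  have hfin : ∀ n : ℕ, IsFiniteMeasure (m.restrict {x | 1 / ((n : ℝ) + 1) ≤ |x|}) := fun n => by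
    refine ⟨?_⟩
    rw [Measure.restrict_apply_univ]
    exact measure_le_abs_lt_top hm (by positivity)
  have hc : ∀ n : ℕ, {x : ℝ | 0 < m.restrict {x | 1 / ((n : ℝ) + 1) ≤ |x|} {a | id a = x}}.Countable :=
    fun n => Measure.countable_meas_level_set_pos measurable_id
  refine (Set.countable_iUnion hc).mono fun x hx => ?_
  obtain ⟨n, hn⟩ := exists_nat_one_div_lt (abs_pos.2 hx.1)
  refine Set.mem_iUnion.2 ⟨n, ?_⟩
  have e : {a : ℝ | id a = x} = {x} := rfl
  rw [Set.mem_ofPred_eq, e, Measure.restrict_apply (measurableSet_singleton x),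
    Set.inter_eq_left.2 (by simpa using hn.le)]
  exact pos_iff_ne_zero.2 hx.2

/-- There are finitely many small cells, with boundaries not charged by `m`, which cover all
numbers of absolute value between `δ` and `R`; each cell has a representative. The label of a number
is the number of its cell, or `0` for a number outside the cells. -/
theorem exists_cells {m : Measure ℝ} (hm : HasTruncatedMoment m) {δ a : ℝ} (hδ : 0 < δ)
    (ha : 0 < a) (R : ℝ) :
    ∃ (r : ℕ) (lab : ℝ → Fin (r + 1)) (rep : Fin (r + 1) → ℝ) (R' : ℝ), Measurable lab ∧
      rep 0 = 0 ∧ δ / 2 ≤ R' ∧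
      (∀ x, lab x ≠ 0 → δ / 2 ≤ |x| ∧ |x| ≤ R' ∧ |x - rep (lab x)| ≤ a) ∧
      (∀ x, lab x = 0 → |x| ≤ δ ∨ R ≤ |x|) ∧
      ∀ i : Fin r, m (frontier (lab ⁻¹' {i.succ})) = 0 := by
  obtain ⟨b, ⟨hb0, hb⟩, hatom⟩ : ∃ b ∈ Set.Ioo 0 (min a (δ / 2)), ∀ l : ℤ, l ≠ 0 → m {b * l} = 0 := by
    have hc : (⋃ l : {l : ℤ // l ≠ 0}, (fun x : ℝ => x / l.1) ''
        {x : ℝ | x ≠ 0 ∧ m {x} ≠ 0}).Countable :=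
      Set.countable_iUnion fun l => (countable_setOf_measure_singleton_ne_zero hm).image _
    obtain ⟨b, hb, hb'⟩ := (hc.dense_compl ℝ).exists_mem_open (isOpen_Ioo (a := 0)
      (b := min a (δ / 2))) (Set.nonempty_Ioo.2 (by positivity))
    refine ⟨b, hb', fun l hl => ?_⟩
    by_contra h
    have hl' : (l : ℝ) ≠ 0 := by exact_mod_cast hl
    exact hb (Set.mem_iUnion.2 ⟨⟨l, hl⟩, b * l, ⟨mul_ne_zero hb'.1.ne' hl', h⟩,
      mul_div_cancel_right₀ _ hl'⟩)
  have hba : b < a := hb.trans_le (min_le_left _ _)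
  have hbδ : b < δ / 2 := hb.trans_le (min_le_right _ _)
  obtain ⟨k₀, hk₀, hk₀'⟩ : ∃ k₀ : ℤ, δ / 2 ≤ b * k₀ ∧ b * k₀ ≤ δ := by
    refine ⟨⌈δ / 2 / b⌉, ?_, ?_⟩
    · have := Int.le_ceil (δ / 2 / b)
      rw [div_le_iff₀ hb0] at this
      linarith
    · have := Int.ceil_lt_add_one (δ / 2 / b)
      have h2 : b * (⌈δ / 2 / b⌉ : ℝ) < b * (δ / 2 / b + 1) := by gcongr
      rw [mul_add, mul_div_cancel₀ _ hb0.ne'] at h2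
      linarith
  obtain ⟨k₁, hk₁⟩ : ∃ k₁ : ℤ, max R δ ≤ b * k₁ := by
    refine ⟨⌈max R δ / b⌉, ?_⟩
    have := Int.le_ceil (max R δ / b)
    rw [div_le_iff₀ hb0] at this
    linarith
  have hk₀pos : 0 < k₀ := by
    have : 0 < b * (k₀ : ℝ) := by linarith
    exact_mod_cast (pos_iff_pos_of_mul_pos this).1 hb0
  set T : Finset ℤ := Finset.Ico k₀ k₁ ∪ Finset.Ico (-k₁) (-k₀) with hT
  have hfloor : ∀ (x : ℝ) (l : ℤ), ⌊x / b⌋ = l ↔ b * l ≤ x ∧ x < b * (l + 1 : ℤ) := by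
    intro x l
    rw [Int.floor_eq_iff, le_div_iff₀ hb0, div_lt_iff₀ hb0]
    push_cast
    rw [mul_comm, mul_comm (_ + 1)]
  let idx : ℤ → Fin (T.card + 1) := fun l => if h : l ∈ T then (T.equivFin ⟨l, h⟩).succ else 0
  have hidx : ∀ l (i : Fin T.card), idx l = i.succ ↔ l = (T.equivFin.symm i).1 := by
    intro l i
    by_cases h : l ∈ T
    · simp only [idx, h, dite_true, Fin.succ_inj]
      rw [← Equiv.eq_symm_apply]
      exact Subtype.ext_iff
    · simp only [idx, h, dite_false]
      refine ⟨fun e => absurd e (Fin.succ_ne_zero i).symm, fun e => absurd (e ▸ Subtype.prop _) h⟩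
  refine ⟨T.card, fun x => idx ⌊x / b⌋,
    Fin.cases 0 fun i => b * ((T.equivFin.symm i).1 : ℝ), b * k₁, ?_, rfl, ?_, ?_, ?_, ?_⟩
  · exact (measurable_of_countable idx).comp (by fun_prop)
  · have := le_max_right R δ
    linarith
  · intro x hx
    obtain ⟨i, hi⟩ := Fin.exists_succ_eq.2 hx
    rw [← hi]
    change δ / 2 ≤ |x| ∧ |x| ≤ b * k₁ ∧ |x - b * ((T.equivFin.symm i).1 : ℝ)| ≤ a
    have hl := (hidx _ i).1 hi.symm
    have hmem := (T.equivFin.symm i).2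
    set l := (T.equivFin.symm i).1
    obtain ⟨h1, h2⟩ := (hfloor x l).1 hl
    have h2' : x < b * l + b := by push_cast at h2; linarith
    rw [hT, Finset.mem_union, Finset.mem_Ico, Finset.mem_Ico] at hmem
    have hle : ∀ p q : ℤ, p ≤ q → b * (p : ℝ) ≤ b * q := fun p q hpq => by
      have : (p : ℝ) ≤ q := by exact_mod_cast hpq
      gcongr
    refine ⟨?_, ?_, ?_⟩
    · rcases hmem with h | h
      · have := hle _ _ h.1
        exact le_trans (by linarith) (le_abs_self x)
      · have := hle (l + 1) (-k₀) (by omega)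
        push_cast at this
        exact le_trans (by linarith) (neg_le_abs x)
    · rcases hmem with h | h
      · have := hle (l + 1) k₁ (by omega)
        have h0 := hle _ _ h.1
        push_cast at this
        rw [abs_of_nonneg (by linarith)]
        linarith
      · have := hle (l + 1) (-k₀) (by omega)
        have h0 := hle _ _ h.1
        push_cast at this h0
        rw [abs_of_nonpos (by linarith)]
        linarith
    · rw [abs_of_nonneg (by linarith)]
      linarith
  · intro x hx
    by_contra! hcon
    have hnot : ⌊x / b⌋ ∉ T := fun h => by
      simp only [idx, h, dite_true] at hx
      exact Fin.succ_ne_zero _ hx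
    apply hnot
    rw [hT, Finset.mem_union, Finset.mem_Ico, Finset.mem_Ico]
    have hRk : |x| < b * k₁ := hcon.2.trans_le ((le_max_left R δ).trans hk₁)
    have hkx : b * k₀ < |x| := hk₀'.trans_lt hcon.1
    rcases le_total 0 x with h0 | h0
    · rw [abs_of_nonneg h0] at hRk hkx
      left
      rw [Int.le_floor, Int.floor_lt, le_div_iff₀ hb0, div_lt_iff₀ hb0]
      constructor <;> linarith
    · rw [abs_of_nonpos h0] at hRk hkx
      right
      rw [Int.le_floor, Int.floor_lt, le_div_iff₀ hb0, div_lt_iff₀ hb0]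
      push_cast
      constructor <;> linarith
  · intro i
    have hmem := (T.equivFin.symm i).2
    have e : (fun x => idx ⌊x / b⌋) ⁻¹' {i.succ} =
        Set.Ico (b * ((T.equivFin.symm i).1 : ℝ)) (b * ((T.equivFin.symm i).1 + 1 : ℤ)) := by
      ext x
      rw [Set.mem_preimage, Set.mem_singleton_iff, hidx, hfloor, Set.mem_Ico]
    rw [e]
    set l := (T.equivFin.symm i).1
    rw [hT, Finset.mem_union, Finset.mem_Ico, Finset.mem_Ico] at hmem
    rw [frontier_Ico (by push_cast; linarith)]
    refine measure_mono_null (Set.insert_eq _ _).subset (measure_union_null ?_ ?_)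
    · exact hatom _ (by omega)
    · exact hatom _ (by omega)

/-! ### Drawing the labels of the children given their multiplicities -/

section

variable {K r : ℕ}

open Classical in
/-- The conditional law of a random label vector of law `ν`, given the multiplicities `c` of its
labels; multiplicities of probability zero are treated arbitrarily. -/
def condLabelLaw (ν : Measure (Fin K → Fin (r + 1))) (c : Fin r → ℕ) :
    Measure (Fin K → Fin (r + 1)) :=
  if ν {d | labelCount d = c} = 0 then Measure.dirac 0 else ν[|{d | labelCount d = c}]

theorem isProbabilityMeasure_condLabelLaw (ν : Measure (Fin K → Fin (r + 1))) [IsFiniteMeasure ν]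
    (c : Fin r → ℕ) : IsProbabilityMeasure (condLabelLaw ν c) := by
  unfold condLabelLaw
  split_ifs with h
  · infer_instance
  · exact cond_isProbabilityMeasure h

theorem measureReal_singleton_eq_mul_condLabelLaw (ν : Measure (Fin K → Fin (r + 1)))
    [IsFiniteMeasure ν] (d : Fin K → Fin (r + 1)) :
    ν.real {d} = ν.real {d' | labelCount d' = labelCount d} *
      (condLabelLaw ν (labelCount d)).real {d} := by
  have hsub : {d} ⊆ {d' | labelCount d' = labelCount d} := by simp
  unfold condLabelLaw
  split_ifs with h
  · rw [measureReal_def ν, measureReal_def ν, h, measure_mono_null hsub h]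
    simp
  · rw [measureReal_def (ν[|{d' | labelCount d' = labelCount d}]), cond_apply (Set.toFinite _).measurableSet, Set.inter_eq_right.2 hsub,
      ENNReal.toReal_mul, ENNReal.toReal_inv, ← measureReal_def, ← measureReal_def,
      mul_inv_cancel_left₀]
    exact (ENNReal.toReal_pos h (measure_ne_top _ _)).ne'

/-- The law of a random map which assigns, independently to each label vector of length `N`, a label
vector of length `K` drawn from the conditional law of `ν` given the multiplicities of the labels. -/
def drawLaw (N : ℕ) (ν : Measure (Fin K → Fin (r + 1))) :
    Measure ((Fin N → Fin (r + 1)) → Fin K → Fin (r + 1)) :=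
  Measure.pi fun l => condLabelLaw ν (labelCount l)

instance isProbabilityMeasure_drawLaw (N : ℕ) (ν : Measure (Fin K → Fin (r + 1)))
    [IsFiniteMeasure ν] : IsProbabilityMeasure (drawLaw N ν) := by
  have := isProbabilityMeasure_condLabelLaw ν
  unfold drawLaw
  infer_instance

/-- The label vector drawn for a row. -/
def drawnLabels {N : ℕ} (lab : ℝ → Fin (r + 1))
    (x : (Fin N → ℝ) × ((Fin N → Fin (r + 1)) → Fin K → Fin (r + 1))) : Fin K → Fin (r + 1) :=
  x.2 fun j => lab (x.1 j)

theorem measurable_drawnLabels {N : ℕ} {lab : ℝ → Fin (r + 1)} (hlab : Measurable lab) :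
    Measurable (drawnLabels (N := N) (K := K) lab) := by
  have h : Measurable fun q : (Fin N → Fin (r + 1)) ×
      ((Fin N → Fin (r + 1)) → Fin K → Fin (r + 1)) => q.2 q.1 :=
    measurable_from_prod_countable_right fun l => measurable_pi_apply l
  refine h.comp (Measurable.prodMk (measurable_pi_lambda _ fun j => ?_) measurable_snd)
  exact hlab.comp ((measurable_pi_apply j).comp measurable_fst)

/-- A discrepancy between the laws of the multiplicities of the labels in a row and in `ν`. -/
def countDiscrepancy (N : ℕ) (μ : Measure ℝ) (lab : ℝ → Fin (r + 1))
    (ν : Measure (Fin K → Fin (r + 1))) : ℝ :=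
  ∑ c ∈ Finset.univ.image (labelCount : (Fin K → Fin (r + 1)) → Fin r → ℕ),
    |(Measure.pi fun _ : Fin N => μ).real {x | (labelCount fun j => lab (x j)) = c} -
      ν.real {d | labelCount d = c}|

variable {N : ℕ} {μ : Measure ℝ} [IsProbabilityMeasure μ] {lab : ℝ → Fin (r + 1)}
  {ν : Measure (Fin K → Fin (r + 1))} [IsProbabilityMeasure ν]

/-- If the multiplicities of the labels of a row are among those that labels of `K` children can have,
the drawn labels follow the law of the labels in the tree given these multiplicities. -/
theorem measureReal_labelCount_eq_and_drawnLabels_eq (hlab : Measurable lab)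
    (d : Fin K → Fin (r + 1)) :
    ((Measure.pi fun _ : Fin N => μ).prod (drawLaw N ν)).real
      {x | (labelCount fun j => lab (x.1 j)) = labelCount d ∧ drawnLabels lab x = d} =
    (Measure.pi fun _ : Fin N => μ).real {x | (labelCount fun j => lab (x j)) = labelCount d} *
      (condLabelLaw ν (labelCount d)).real {d} := by
  have hprob := isProbabilityMeasure_condLabelLaw ν
  have hlm : Measurable fun (x : Fin N → ℝ) j => lab (x j) :=
    measurable_pi_lambda _ fun j => hlab.comp (measurable_pi_apply j)
  let F : Finset (Fin N → Fin (r + 1)) := Finset.univ.filter fun l => labelCount l = labelCount d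
  have e1 : {x : (Fin N → ℝ) × ((Fin N → Fin (r + 1)) → Fin K → Fin (r + 1)) |
      (labelCount fun j => lab (x.1 j)) = labelCount d ∧ drawnLabels lab x = d} =
      ⋃ l ∈ F, ((fun (x : Fin N → ℝ) j => lab (x j)) ⁻¹' {l}) ×ˢ {z | z l = d} := by
    ext x
    simp only [Set.mem_ofPred_eq, Set.mem_iUnion, Set.mem_prod, Set.mem_preimage,
      Set.mem_singleton_iff, F, Finset.mem_filter, Finset.mem_univ, true_and, exists_prop,
      drawnLabels]
    constructor
    · rintro ⟨h1, h2⟩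
      exact ⟨_, h1, rfl, h2⟩
    · rintro ⟨l, h1, h2, h3⟩
      subst h2
      exact ⟨h1, h3⟩
  have e2 : {x : Fin N → ℝ | (labelCount fun j => lab (x j)) = labelCount d} =
      ⋃ l ∈ F, (fun (x : Fin N → ℝ) j => lab (x j)) ⁻¹' {l} := by
    ext x
    simp [F]
  have hdisj : (F : Set (Fin N → Fin (r + 1))).PairwiseDisjoint
      fun l => (fun (x : Fin N → ℝ) j => lab (x j)) ⁻¹' {l} := by
    intro l _ l' _ hll
    refine Set.disjoint_left.2 fun x hx hx' => hll ?_
    exact hx.symm.trans hx'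
  have hms : ∀ l : Fin N → Fin (r + 1),
      MeasurableSet {z : (Fin N → Fin (r + 1)) → Fin K → Fin (r + 1) | z l = d} := fun l =>
    (measurable_pi_apply l : Measurable fun z : (Fin N → Fin (r + 1)) →
      Fin K → Fin (r + 1) => z l) (measurableSet_singleton d)
  rw [e1, measureReal_biUnion_finset, e2, measureReal_biUnion_finset hdisj, Finset.sum_mul]
  · refine Finset.sum_congr rfl fun l hl => ?_
    rw [measureReal_prod_prod]
    congr 1
    have h1 := (measurePreserving_eval (fun l : Fin N → Fin (r + 1) =>
      condLabelLaw ν (labelCount l)) l).measureReal_preimage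
      (measurableSet_singleton d).nullMeasurableSet
    rw [(Finset.mem_filter.1 hl).2] at h1
    exact h1
  · exact fun l _ => hlm (measurableSet_singleton l)
  · intro l hl l' hl' hll
    exact (Set.disjoint_prod.2 (Or.inl (hdisj hl hl' hll)))
  · exact fun l _ => (hlm (measurableSet_singleton l)).prod (hms l)

theorem sum_abs_labelCount_sub_le (hlab : Measurable lab) :
    ∑ d, |((Measure.pi fun _ : Fin N => μ).prod (drawLaw N ν)).real
      {x | (labelCount fun j => lab (x.1 j)) = labelCount d ∧ drawnLabels lab x = d} - ν.real {d}| ≤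
    countDiscrepancy N μ lab ν := by
  have hprob := isProbabilityMeasure_condLabelLaw ν
  simp only [measureReal_labelCount_eq_and_drawnLabels_eq hlab,
    measureReal_singleton_eq_mul_condLabelLaw ν, ← sub_mul, abs_mul, abs_of_nonneg measureReal_nonneg]
  rw [← Finset.sum_fiberwise_of_maps_to (t := Finset.univ.image labelCount)
    (fun d _ => Finset.mem_image_of_mem labelCount (Finset.mem_univ d))]
  refine Finset.sum_le_sum fun c _ => ?_
  have : ∀ d ∈ Finset.univ.filter (fun d : Fin K → Fin (r + 1) => labelCount d = c),
      |(Measure.pi fun _ : Fin N => μ).real {x | (labelCount fun j => lab (x j)) = labelCount d} -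
        ν.real {d' | labelCount d' = labelCount d}| * (condLabelLaw ν (labelCount d)).real {d} =
      |(Measure.pi fun _ : Fin N => μ).real {x | (labelCount fun j => lab (x j)) = c} -
        ν.real {d' | labelCount d' = c}| * (condLabelLaw ν c).real {d} := fun d hd => by
    rw [(Finset.mem_filter.1 hd).2]
  rw [Finset.sum_congr rfl this, ← Finset.mul_sum, sum_measureReal_singleton]
  exact mul_le_of_le_one_right (abs_nonneg _) measureReal_le_one

theorem measurableSet_labelCount_eq_and (hlab : Measurable lab) (d : Fin K → Fin (r + 1)) :
    MeasurableSet {x : (Fin N → ℝ) × ((Fin N → Fin (r + 1)) → Fin K → Fin (r + 1)) |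
      (labelCount fun j => lab (x.1 j)) = labelCount d ∧ drawnLabels lab x = d} := by
  have hlm : Measurable fun x : (Fin N → ℝ) × ((Fin N → Fin (r + 1)) → Fin K → Fin (r + 1)) =>
      labelCount fun j => lab (x.1 j) :=
    measurable_labelCount_comp (measurable_pi_lambda _ fun j =>
      hlab.comp ((measurable_pi_apply j).comp measurable_fst))
  exact (hlm (measurableSet_singleton _)).inter (measurable_drawnLabels hlab
    (measurableSet_singleton d))

theorem sum_measureReal_singleton_eq_one : ∑ d, ν.real {d} = 1 := by
  rw [sum_measureReal_singleton, Finset.coe_univ, probReal_univ]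

/-- With large probability the drawn labels have the same multiplicities as the labels of the row. -/
theorem measureReal_labelCount_ne_le (hlab : Measurable lab) :
    ((Measure.pi fun _ : Fin N => μ).prod (drawLaw N ν)).real
      {x | (labelCount fun j => lab (x.1 j)) ≠ labelCount (drawnLabels lab x)} ≤
    countDiscrepancy N μ lab ν := by
  set ρ := (Measure.pi fun _ : Fin N => μ).prod (drawLaw N ν)
  have e : {x : (Fin N → ℝ) × ((Fin N → Fin (r + 1)) → Fin K → Fin (r + 1)) |
      (labelCount fun j => lab (x.1 j)) ≠ labelCount (drawnLabels lab x)} =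
      (⋃ d ∈ (Finset.univ : Finset (Fin K → Fin (r + 1))), {x |
        (labelCount fun j => lab (x.1 j)) = labelCount d ∧ drawnLabels lab x = d})ᶜ := by
    ext x
    simp only [Set.mem_ofPred_eq, Set.mem_compl_iff, Set.mem_iUnion, Finset.mem_univ, exists_true_left,
      not_exists, not_and]
    exact ⟨fun h d h1 h2 => h (h2 ▸ h1), fun h h1 => h _ h1 rfl⟩
  have hms : MeasurableSet (⋃ d ∈ (Finset.univ : Finset (Fin K → Fin (r + 1))),
      {x : (Fin N → ℝ) × ((Fin N → Fin (r + 1)) → Fin K → Fin (r + 1)) |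
        (labelCount fun j => lab (x.1 j)) = labelCount d ∧ drawnLabels lab x = d}) :=
    Finset.measurableSet_biUnion _ fun d _ => measurableSet_labelCount_eq_and hlab d
  rw [e, probReal_compl_eq_one_sub hms, measureReal_biUnion_finset]
  · have h1 := (Finset.abs_sum_le_sum_abs _ _).trans (sum_abs_labelCount_sub_le (N := N) (μ := μ)
      (ν := ν) hlab)
    rw [Finset.sum_sub_distrib, sum_measureReal_singleton_eq_one] at h1
    linarith [(abs_le.1 h1).1]
  · intro d _ d' _ hdd
    refine Set.disjoint_left.2 fun x hx hx' => hdd ?_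
    exact hx.2.symm.trans hx'.2
  · exact fun d _ => measurableSet_labelCount_eq_and hlab d

/-- The law of the drawn labels is close to `ν` in total variation. -/
theorem sum_abs_drawnLabels_sub_le (hlab : Measurable lab) :
    ∑ d, |((Measure.pi fun _ : Fin N => μ).prod (drawLaw N ν)).real {x | drawnLabels lab x = d} -
      ν.real {d}| ≤ 2 * countDiscrepancy N μ lab ν := by
  set ρ := (Measure.pi fun _ : Fin N => μ).prod (drawLaw N ν)
  have h1 := sum_abs_labelCount_sub_le (N := N) (μ := μ) (ν := ν) hlab
  have h2 : ∑ d, (ρ.real {x | drawnLabels lab x = d} - ρ.real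
      {x | (labelCount fun j => lab (x.1 j)) = labelCount d ∧ drawnLabels lab x = d}) ≤
      countDiscrepancy N μ lab ν := by
    refine le_trans (le_of_eq ?_) (measureReal_labelCount_ne_le (N := N) (μ := μ) (ν := ν) hlab)
    have e : {x : (Fin N → ℝ) × ((Fin N → Fin (r + 1)) → Fin K → Fin (r + 1)) |
        (labelCount fun j => lab (x.1 j)) ≠ labelCount (drawnLabels lab x)} =
        ⋃ d ∈ (Finset.univ : Finset (Fin K → Fin (r + 1))), {x | drawnLabels lab x = d} \
          {x | (labelCount fun j => lab (x.1 j)) = labelCount d ∧ drawnLabels lab x = d} := by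
      ext x
      simp
    rw [e, measureReal_biUnion_finset]
    · refine Finset.sum_congr rfl fun d _ => ?_
      rw [measureReal_sdiff (s₁ := {x | drawnLabels lab x = d}) (fun x hx => hx.2) (measurableSet_labelCount_eq_and hlab d)]
    · intro d _ d' _ hdd
      refine Set.disjoint_left.2 fun x hx hx' => hdd ?_
      exact hx.1.symm.trans hx'.1
    · exact fun d _ => (measurable_drawnLabels hlab (measurableSet_singleton d)).diff
        (measurableSet_labelCount_eq_and hlab d)
  calc _ ≤ ∑ d, ((ρ.real {x | drawnLabels lab x = d} - ρ.real
        {x | (labelCount fun j => lab (x.1 j)) = labelCount d ∧ drawnLabels lab x = d}) +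
        |ρ.real {x | (labelCount fun j => lab (x.1 j)) = labelCount d ∧ drawnLabels lab x = d} -
          ν.real {d}|) := by
        refine Finset.sum_le_sum fun d _ => ?_
        have hle : ρ.real {x | (labelCount fun j => lab (x.1 j)) = labelCount d ∧
            drawnLabels lab x = d} ≤ ρ.real {x | drawnLabels lab x = d} :=
          measureReal_mono fun x hx => hx.2
        refine (abs_sub_le _ (ρ.real {x | (labelCount fun j => lab (x.1 j)) = labelCount d ∧
          drawnLabels lab x = d}) _).trans ?_
        rw [abs_of_nonneg (sub_nonneg.2 hle)]
    _ ≤ _ := by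
        rw [Finset.sum_add_distrib]
        linarith

end

/-- The total variation distance of product laws is at most the sum of the distances of the
factors. -/
theorem sum_abs_prod_sub_prod_le {α : Type*} [Fintype α] {h : ℕ} (a b : Fin h → α → ℝ)
    (ha : ∀ u x, 0 ≤ a u x) (hb : ∀ u x, 0 ≤ b u x) (ha1 : ∀ u, ∑ x, a u x = 1)
    (hb1 : ∀ u, ∑ x, b u x = 1) :
    ∑ d : Fin h → α, |∏ u, a u (d u) - ∏ u, b u (d u)| ≤ ∑ u, ∑ x, |a u x - b u x| := by
  induction h with
  | zero => simp
  | succ h ih =>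
    have ih' := ih (fun u => a u.succ) (fun u => b u.succ) (fun u => ha _) (fun u => hb _)
      (fun u => ha1 _) fun u => hb1 _
    have hA : ∑ d : Fin h → α, ∏ u, a u.succ (d u) = 1 := by
      have := Finset.prod_univ_sum (fun _ : Fin h => (Finset.univ : Finset α))
        (fun u x => a u.succ x)
      rw [Fintype.piFinset_univ] at this
      rw [← this]
      simp [ha1]
    rw [← (Fin.consEquiv fun _ : Fin (h + 1) => α).sum_comp, Fintype.sum_prod_type,
      Fin.sum_univ_succ]
    calc _ ≤ ∑ x, ∑ d : Fin h → α, (|a 0 x - b 0 x| * ∏ u, a u.succ (d u) +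
          b 0 x * |∏ u, a u.succ (d u) - ∏ u, b u.succ (d u)|) := by
          refine Finset.sum_le_sum fun x _ => Finset.sum_le_sum fun d _ => ?_
          simp only [Fin.consEquiv_apply, Fin.prod_univ_succ, Fin.cons_zero, Fin.cons_succ]
          have hp : 0 ≤ ∏ u, a u.succ (d u) := Finset.prod_nonneg fun u _ => ha _ _
          have e : a 0 x * ∏ u, a u.succ (d u) - b 0 x * ∏ u, b u.succ (d u) =
              (a 0 x - b 0 x) * ∏ u, a u.succ (d u) +
              b 0 x * (∏ u, a u.succ (d u) - ∏ u, b u.succ (d u)) := by ring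
          rw [e]
          refine (abs_add_le _ _).trans ?_
          rw [abs_mul, abs_mul, abs_of_nonneg hp, abs_of_nonneg (hb 0 x)]
      _ = ∑ x, |a 0 x - b 0 x| + ∑ d : Fin h → α, |∏ u, a u.succ (d u) - ∏ u, b u.succ (d u)| := by
          simp only [Finset.sum_add_distrib, ← Finset.mul_sum, hA, mul_one]
          rw [← Finset.sum_mul, hb1, one_mul]
      _ ≤ _ := by linarith

/-! ### Comparison of the multiplicities with those in the tree -/

section

variable {Ω' : Type*} [MeasurableSpace Ω'] {P' : Measure Ω'}
  {m : Measure ℝ} {y : List ℕ → ℕ → Ω' → ℝ} {K r : ℕ} {lab : ℝ → Fin (r + 1)} {η R' : ℝ}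

/-- The labels of the first `K` weights of a sequence. -/
def treeLabels (K : ℕ) (lab : ℝ → Fin (r + 1)) (x : ℕ → ℝ) : Fin K → Fin (r + 1) :=
  fun k => lab (x k)

theorem measurable_treeLabels (hy : IsPWIT P' m y) (hlab : Measurable lab) (v : List ℕ) :
    Measurable fun ω => treeLabels K lab fun k => y v k ω :=
  measurable_pi_lambda _ fun k => hlab.comp (hy.measurable v k)

theorem measurable_treeLabels_pi (hlab : Measurable lab) :
    Measurable fun x : ℕ → ℝ => treeLabels K lab x :=
  measurable_pi_lambda _ fun _ => hlab.comp (measurable_pi_apply _)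

/-- When no weight beyond the first `K` is large, the number of points of the process in a cell is the
number of occurrences of its label among the first `K` children. -/
theorem measure_eq_labelCount_treeLabels {x : ℕ → ℝ} (hlab : Measurable lab) (hη : 0 < η)
    (hle : ∀ x, lab x ≠ 0 → η ≤ |x|) (hx : ¬∃ k ≥ K, η ≤ |x k|) (i : Fin r) :
    ((Measure.sum fun k => Measure.dirac (x k)).restrict {0}ᶜ) (lab ⁻¹' {i.succ}) =
      labelCount (treeLabels K lab x) i := by
  classical
  rw [measure_sum_dirac_restrict_apply x (hlab (measurableSet_singleton _))]
  have h0 : lab ⁻¹' {i.succ} ∩ {0}ᶜ = lab ⁻¹' {i.succ} := by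
    refine Set.inter_eq_left.2 fun z hz => ?_
    have := hle z (by rw [Set.mem_preimage, Set.mem_singleton_iff] at hz; rw [hz]; exact Fin.succ_ne_zero i)
    intro h
    rw [Set.mem_singleton_iff.1 h, abs_zero] at this
    linarith
  rw [h0, tsum_eq_sum (s := Finset.range K)]
  · rw [Finset.sum_range]
    simp only [Set.indicator_apply, labelCount, treeLabels, Set.mem_preimage, Set.mem_singleton_iff,
      Pi.one_apply, Finset.sum_boole]
    congr!
  · intro k hk
    refine Set.indicator_of_notMem (fun h => hx ⟨k, by simpa using hk, hle _ ?_⟩) _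
    rw [Set.mem_preimage, Set.mem_singleton_iff] at h
    rw [h]
    exact Fin.succ_ne_zero i

variable [IsProbabilityMeasure P']

theorem sum_abs_measureReal_sub_le {C : Type*} (S : Finset C) {E F : C → Set Ω'} {B : Set Ω'}
    (hE : ∀ c, MeasurableSet (E c)) (hF : ∀ c, MeasurableSet (F c)) (hB : MeasurableSet B)
    (hEd : Pairwise (Function.onFun Disjoint E)) (hFd : Pairwise (Function.onFun Disjoint F))
    (h : ∀ c, E c \ B = F c \ B) :
    ∑ c ∈ S, |P'.real (E c) - P'.real (F c)| ≤ 2 * P'.real B := by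
  have key : ∀ G : C → Set Ω', (∀ c, MeasurableSet (G c)) → Pairwise (Function.onFun Disjoint G) →
      ∑ c ∈ S, P'.real (G c ∩ B) ≤ P'.real B := by
    intro G hG hGd
    rw [← measureReal_biUnion_finset]
    · exact measureReal_mono (Set.iUnion₂_subset fun c _ => Set.inter_subset_right)
    · intro c _ c' _ hcc
      exact (hGd hcc).mono Set.inter_subset_left Set.inter_subset_left
    · exact fun c _ => (hG c).inter hB
  calc _ ≤ ∑ c ∈ S, (P'.real (E c ∩ B) + P'.real (F c ∩ B)) := by
        refine Finset.sum_le_sum fun c _ => ?_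
        have h1 := measureReal_inter_add_sdiff (μ := P') (s := E c) hB
        have h2 := measureReal_inter_add_sdiff (μ := P') (s := F c) hB
        rw [h c] at h1
        have h3 : 0 ≤ P'.real (E c ∩ B) := measureReal_nonneg
        have h4 : 0 ≤ P'.real (F c ∩ B) := measureReal_nonneg
        rw [abs_le]
        constructor <;> linarith
    _ ≤ _ := by
        rw [Finset.sum_add_distrib]
        linarith [key E hE hEd, key F hF hFd]

/-- The multiplicities of the labels of the first `K` weights below a vertex are almost independent
Poisson variables. -/
theorem sum_abs_treeLabels_sub_poisson_le (hy : IsPWIT P' m y) (hm : HasTruncatedMoment m)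
    (hlab : Measurable lab) (hη : 0 < η) (hle : ∀ x, lab x ≠ 0 → η ≤ |x|) (v : List ℕ)
    (S : Finset (Fin r → ℕ)) :
    ∑ c ∈ S, |(P'.map fun ω => treeLabels K lab fun k => y v k ω).real {d | labelCount d = c} -
      ∏ i, (poissonMeasure (m (lab ⁻¹' {i.succ})).toNNReal).real {c i}| ≤
    2 * P'.real {ω | ∃ k ≥ K, η ≤ |y v k ω|} := by
  have hsub : ∀ i : Fin r, lab ⁻¹' {i.succ} ⊆ {x | η ≤ |x|} := fun i x hx => hle x (by
    rw [Set.mem_preimage, Set.mem_singleton_iff] at hx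
    rw [hx]
    exact Fin.succ_ne_zero i)
  have hms : ∀ i : Fin r, MeasurableSet (lab ⁻¹' {i.succ}) := fun i =>
    hlab (measurableSet_singleton _)
  have hdisj : Pairwise (Function.onFun Disjoint fun i : Fin r => lab ⁻¹' {i.succ}) := by
    intro i j hij
    refine Set.disjoint_left.2 fun x hx hx' => hij ?_
    exact Fin.succ_injective _ (hx.symm.trans hx')
  have hmt := measurable_treeLabels (K := K) hy hlab v
  let E : (Fin r → ℕ) → Set Ω' := fun c =>
    {ω | labelCount (treeLabels K lab fun k => y v k ω) = c}
  let F : (Fin r → ℕ) → Set Ω' := fun c =>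
    {ω | ∀ i, ((Measure.sum fun k => Measure.dirac (y v k ω)).restrict {0}ᶜ) (lab ⁻¹' {i.succ}) = c i}
  have key := sum_abs_measureReal_sub_le (P' := P') S (E := E) (F := F)
    (B := {ω | ∃ k ≥ K, η ≤ |y v k ω|}) ?_ ?_ ?_ ?_ ?_ ?_
  · refine le_trans (le_of_eq (Finset.sum_congr rfl fun c _ => ?_)) key
    rw [measureReal_def (P'.map _), Measure.map_apply hmt (Set.toFinite _).measurableSet,
      ← measureReal_forall_eq_poisson hy v hms hdisj
        (fun i => ((measure_mono (hsub i)).trans_lt (measure_le_abs_lt_top hm hη)).ne) c]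
    rfl
  · exact fun c => measurable_labelCount_comp hmt (measurableSet_singleton c)
  · intro c
    have e : F c = ⋂ i, (fun ω => ((Measure.sum fun k => Measure.dirac (y v k ω)).restrict {0}ᶜ)
        (lab ⁻¹' {i.succ})) ⁻¹' {(c i : ℝ≥0∞)} := by
      ext ω
      simp [F]
    rw [e]
    exact MeasurableSet.iInter fun i => (hy.poisson v).measurable_apply _ (hms i)
      (measurableSet_singleton _)
  · have e : {ω | ∃ k ≥ K, η ≤ |y v k ω|} = ⋃ k, ⋃ (_ : k ≥ K), {ω | η ≤ |y v k ω|} := by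
      ext ω
      simp
    rw [e]
    exact MeasurableSet.iUnion fun k => MeasurableSet.iUnion fun _ =>
      measurableSet_le_abs_apply hy v k η
  · intro c c' hcc
    exact Set.disjoint_left.2 fun ω h1 h2 => hcc (h1.symm.trans h2)
  · intro c c' hcc
    refine Set.disjoint_left.2 fun ω h1 h2 => hcc (funext fun i => ?_)
    exact_mod_cast (h1 i).symm.trans (h2 i)
  · intro c
    ext ω
    simp only [Set.mem_sdiff, Set.mem_ofPred_eq, E, F]
    refine and_congr_left fun hB => ?_
    simp only [measure_eq_labelCount_treeLabels hlab hη hle hB, Nat.cast_inj]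
    exact funext_iff

variable {Ω : Type*} [MeasurableSpace Ω] {P : Measure Ω} [IsProbabilityMeasure P]
  {A : (n : ℕ) → Ω → Matrix (Fin n) (Fin n) ℝ} {b : ℝ}

/-- The multiplicities of the labels in a row of a large matrix have almost the same law as in the tree,
because both have almost the Poisson law of the numbers of points in the cells. -/
theorem eventually_countDiscrepancy_le (hA : IsLevyKhintchineEnsemble P A 0 b m)
    (hC1 : ConditionC1 P A m) (hy : IsPWIT P' m y) (hlab : Measurable lab) (hη : 0 < η)
    (hηR : η ≤ R') (hle : ∀ x, lab x ≠ 0 → η ≤ |x| ∧ |x| ≤ R')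
    (hnull : ∀ i : Fin r, m (frontier (lab ⁻¹' {i.succ})) = 0) (v : List ℕ) {e : ℝ} (he : 0 < e)
    (hK : P'.real {ω | ∃ k ≥ K, η ≤ |y v k ω|} ≤ e) :
    ∀ᶠ n in atTop, countDiscrepancy (n + 2) (entryLaw P A n) lab
      (P'.map fun ω => treeLabels K lab fun k => y v k ω) ≤ 3 * e := by
  have hm := hasTruncatedMoment_of_conditionC1 hC1
  have hprob := isProbabilityMeasure_entryLaw hA
  have hlim : ∀ i : Fin r, Tendsto (fun n : ℕ => (n + 2) * (entryLaw P A n).real (lab ⁻¹' {i.succ}))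
      atTop (𝓝 ((m (lab ⁻¹' {i.succ})).toNNReal : ℝ)) := fun i =>
    tendsto_entryLaw hA hC1 hη hηR (hlab (measurableSet_singleton _)) (fun x hx => hle x (by
      rw [Set.mem_preimage, Set.mem_singleton_iff] at hx
      rw [hx]
      exact Fin.succ_ne_zero i)) (hnull i)
  set S := Finset.univ.image (labelCount : (Fin K → Fin (r + 1)) → Fin r → ℕ) with hS
  have h1 : Tendsto (fun n : ℕ => ∑ c ∈ S, |(Measure.pi fun _ : Fin (n + 2) => entryLaw P A n).real
      {x | (labelCount fun j => lab (x j)) = c} -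
      ∏ i, (poissonMeasure (m (lab ⁻¹' {i.succ})).toNNReal).real {c i}|) atTop
      (𝓝 (∑ c ∈ S, |∏ i, (poissonMeasure (m (lab ⁻¹' {i.succ})).toNNReal).real {c i} -
      ∏ i, (poissonMeasure (m (lab ⁻¹' {i.succ})).toNNReal).real {c i}|)) :=
    tendsto_finsetSum _ fun c _ => ((tendsto_labelCount_poisson hlab hlim c).sub_const _).abs
  simp only [sub_self, abs_zero, Finset.sum_const_zero] at h1
  have h2 := sum_abs_treeLabels_sub_poisson_le (K := K) hy hm hlab hη (fun x hx => (hle x hx).1) v S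
  filter_upwards [h1.eventually (gt_mem_nhds he)] with n hn
  calc _ ≤ ∑ c ∈ S, (|(Measure.pi fun _ : Fin (n + 2) => entryLaw P A n).real
      {x | (labelCount fun j => lab (x j)) = c} -
      ∏ i, (poissonMeasure (m (lab ⁻¹' {i.succ})).toNNReal).real {c i}| +
      |(P'.map fun ω => treeLabels K lab fun k => y v k ω).real {d | labelCount d = c} -
      ∏ i, (poissonMeasure (m (lab ⁻¹' {i.succ})).toNNReal).real {c i}|) := by
        refine Finset.sum_le_sum fun c _ => ?_
        exact (abs_sub_le _ _ _).trans (le_of_eq (congrArg₂ _ rfl (abs_sub_comm _ _)))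
    _ ≤ _ := by
        rw [Finset.sum_add_distrib]
        linarith

end

/-! ### Operators given by weights -/

section

variable {V : Type*}

theorem memℓp_two_of_summable {f : V → ℂ} (h : Summable fun u => ‖f u‖) : Memℓp f 2 := by
  have h1 : Memℓp f 1 := by
    rw [memℓp_gen_iff (by norm_num)]
    simpa using h
  exact h1.of_exponent_ge (by norm_num)

/-- The norm of `ℓ²` is at most the norm of `ℓ¹`. -/
theorem norm_le_tsum_norm (x : EllTwo V) (h : Summable fun u => ‖(x : V → ℂ) u‖) :
    ‖x‖ ≤ ∑' u, ‖(x : V → ℂ) u‖ := by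
  have h0 : 0 ≤ ∑' u, ‖(x : V → ℂ) u‖ := tsum_nonneg fun u => norm_nonneg _
  refine lp.norm_le_of_forall_sum_le (by norm_num) h0 fun s => ?_
  simp only [ENNReal.toReal_ofNat, Real.rpow_ofNat]
  refine (Finset.sum_sq_le_sq_sum_of_nonneg fun u _ => norm_nonneg _).trans ?_
  gcongr
  exact h.sum_le_tsum s fun u _ => norm_nonneg _

open Classical in
/-- A column of the matrix of weights as a vector, as in `weightOperator`. -/
def weightColumn (w : V → V → ℝ) (v : V) : EllTwo V :=
  if h : Memℓp (fun u => (w u v : ℂ)) 2 then ⟨fun u => (w u v : ℂ), h⟩ else 0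

theorem weightColumn_apply {w : V → V → ℝ} {v : V} (h : Memℓp (fun u => (w u v : ℂ)) 2) (u : V) :
    (weightColumn w v : V → ℂ) u = w u v := by
  rw [weightColumn, dif_pos h]

theorem weightOperator_apply (w : V → V → ℝ) {φ : EllTwo V} (hφ : φ ∈ finSupported V)
    {s : Finset V} (hs : Function.support (φ : V → ℂ) ⊆ s) :
    weightOperator w ⟨φ, hφ⟩ = ∑ v ∈ s, (φ : V → ℂ) v • weightColumn w v := by
  change ∑ᶠ v, (φ : V → ℂ) v • weightColumn w v = _
  refine finsum_eq_sum_of_support_subset _ fun v hv => hs fun h => hv ?_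
  simp [h]

theorem exists_finset_support_subset {φ : EllTwo V} (hφ : φ ∈ finSupported V) :
    ∃ s : Finset V, Function.support (φ : V → ℂ) ⊆ s := by
  have h : (Function.support (φ : V → ℂ)).Finite := hφ
  exact ⟨h.toFinset, h.coe_toFinset.ge⟩

theorem memℓp_of_hasSum {w : V → V → ℝ} {v : V} {a : ℝ} (h : HasSum (fun u => w u v) a) :
    Memℓp (fun u => (w u v : ℂ)) 2 := by
  refine memℓp_two_of_summable ?_
  simpa using h.summable.abs

/-- A summable family with sum zero is controlled by its values outside of one index. -/
theorem tsum_abs_le_of_hasSum_zero [DecidableEq V] {f : V → ℝ} (hf : HasSum f 0) (v : V) :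
    ∑' u, |f u| ≤ 2 * ∑' u, if u = v then 0 else |f u| := by
  have hs := hf.summable
  have h1 := hs.tsum_eq_add_tsum_ite v
  rw [hf.tsum_eq] at h1
  have h2 := hs.abs.tsum_eq_add_tsum_ite v
  have hs' : Summable fun u => if u = v then 0 else |f u| := by
    refine hs.abs.of_nonneg_of_le (fun u => ?_) fun u => ?_
    · split_ifs <;> positivity
    · split_ifs
      · positivity
      · exact le_rfl
  have h3 : |∑' u, if u = v then 0 else f u| ≤ ∑' u, if u = v then 0 else |f u| := by
    have : Summable fun u => |if u = v then 0 else f u| := by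
      refine hs'.congr fun u => ?_
      split_ifs <;> simp
    rw [← Real.norm_eq_abs]
    refine (norm_tsum_le_tsum_norm (by simpa using this)).trans (le_of_eq (tsum_congr fun u => ?_))
    split_ifs <;> simp
  rw [h2]
  have h4 : f v = -∑' u, if u = v then 0 else f u := by linarith
  rw [h4, abs_neg]
  linarith

/-- If the columns of two weight matrices have sum zero, the operators differ by at most twice the
off-diagonal differences. -/
theorem norm_weightOperator_sub_le [DecidableEq V] {w w' : V → V → ℝ} {φ : EllTwo V} (hφ : φ ∈ finSupported V)
    {s : Finset V} (hs : Function.support (φ : V → ℂ) ⊆ s) {e : ℝ}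
    (hw : ∀ v ∈ s, HasSum (fun u => w u v) 0) (hw' : ∀ v ∈ s, HasSum (fun u => w' u v) 0)
    (he : ∀ v ∈ s, (∑' u, if u = v then 0 else |w u v - w' u v|) ≤ e) :
    ‖weightOperator w ⟨φ, hφ⟩ - weightOperator w' ⟨φ, hφ⟩‖ ≤
      2 * e * ∑ v ∈ s, ‖(φ : V → ℂ) v‖ := by
  rw [weightOperator_apply w hφ hs, weightOperator_apply w' hφ hs, ← Finset.sum_sub_distrib,
    Finset.mul_sum]
  refine (norm_sum_le _ _).trans (Finset.sum_le_sum fun v hv => ?_)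
  rw [← smul_sub, norm_smul, mul_comm]
  gcongr
  have h0 : HasSum (fun u => w u v - w' u v) 0 := by simpa using (hw v hv).sub (hw' v hv)
  have e1 : ∀ u, ‖((weightColumn w v - weightColumn w' v : EllTwo V) : V → ℂ) u‖ =
      |w u v - w' u v| := by
    intro u
    rw [lp.coeFn_sub, Pi.sub_apply, weightColumn_apply (memℓp_of_hasSum (hw v hv)),
      weightColumn_apply (memℓp_of_hasSum (hw' v hv)), ← Complex.ofReal_sub, Complex.norm_real,
      Real.norm_eq_abs]
  refine (norm_le_tsum_norm _ (h0.summable.abs.congr fun u => (e1 u).symm)).trans ?_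
  rw [tsum_congr e1]
  have := tsum_abs_le_of_hasSum_zero h0 v
  linarith [he v hv]

/-- Measurability of the entries is enough, since a square summable column is the limit in `ℓ²` of its
restrictions to finite sets. -/
theorem aestronglyMeasurable_weightOperator [Countable V] {Ω : Type*} [MeasurableSpace Ω]
    {P : Measure Ω} {w : Ω → V → V → ℝ} (hw : ∀ u v, AEMeasurable (fun ω => w ω u v) P)
    (hmem : ∀ v, ∀ᵐ ω ∂P, Memℓp (fun u => (w ω u v : ℂ)) 2) {φ : EllTwo V}
    (hφ : φ ∈ finSupported V) :
    AEStronglyMeasurable (fun ω => weightOperator (w ω) ⟨φ, hφ⟩) P := by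
  classical
  obtain ⟨s, hs⟩ := exists_finset_support_subset hφ
  simp only [weightOperator_apply _ hφ hs]
  refine Finset.aestronglyMeasurable_fun_sum _ fun v _ => ?_
  suffices h : AEStronglyMeasurable (fun ω => weightColumn (w ω) v) P from
    h.const_smul ((φ : V → ℂ) v)
  refine aestronglyMeasurable_of_tendsto_ae (atTop : Filter (Finset V))
    (f := fun t ω => ∑ u ∈ t, lp.single 2 u ((w ω u v : ℂ))) (fun t => ?_) ?_
  · refine Finset.aestronglyMeasurable_fun_sum _ fun u _ => ?_
    have e : ∀ ω, (lp.single 2 u ((w ω u v : ℂ)) : EllTwo V) =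
        ((w ω u v : ℝ) : ℂ) • (lp.single 2 u (1 : ℂ) : EllTwo V) := fun ω => by
      rw [← lp.single_smul, smul_eq_mul, mul_one]
    simp only [e]
    exact (Complex.measurable_ofReal.comp_aemeasurable (hw u v)).aestronglyMeasurable.smul_const _
  · filter_upwards [hmem v] with ω hω
    have := lp.hasSum_single (p := 2) (by norm_num) (weightColumn (w ω) v)
    simp only [weightColumn_apply hω] at this
    exact this

end

/-! ### Matrices as operators -/

/-- The entries of the operator `matrixOperator M`. -/
def extendedEntry {n : ℕ} (M : Matrix (Fin n) (Fin n) ℝ) (x z : List ℕ) : ℝ :=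
  ∑ i : Fin n, ∑ j : Fin n, if x = [(i : ℕ)] ∧ z = [(j : ℕ)] then M i j else 0

theorem extendedEntry_singleton {n : ℕ} (M : Matrix (Fin n) (Fin n) ℝ) (i j : Fin n) :
    extendedEntry M [(i : ℕ)] [(j : ℕ)] = M i j := by
  rw [extendedEntry, Finset.sum_eq_single i, Finset.sum_eq_single j]
  · simp
  · intro j' _ hj
    rw [if_neg]
    simpa [Fin.ext_iff, eq_comm] using hj
  · simp
  · intro i' _ hi
    refine Finset.sum_eq_zero fun j' _ => ?_
    rw [if_neg]
    simp only [List.cons.injEq, and_true, not_and]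
    intro h
    exact absurd (Fin.ext h.symm) hi
  · simp

theorem extendedEntry_eq_zero {n : ℕ} (M : Matrix (Fin n) (Fin n) ℝ) {x z : List ℕ}
    (hx : ∀ i : Fin n, x ≠ [(i : ℕ)]) : extendedEntry M x z = 0 :=
  Finset.sum_eq_zero fun i _ => Finset.sum_eq_zero fun _ _ => if_neg fun h => hx i h.1

theorem hasSum_extendedEntry {n : ℕ} (M : Matrix (Fin n) (Fin n) ℝ) (z : List ℕ) :
    HasSum (fun x => extendedEntry M x z) (∑ j : Fin n, if z = [(j : ℕ)] then ∑ i, M i j else 0) := by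
  have e : (∑ j : Fin n, if z = [(j : ℕ)] then ∑ i, M i j else 0) =
      ∑ i : Fin n, ∑ j : Fin n, if z = [(j : ℕ)] then M i j else 0 := by
    rw [Finset.sum_comm]
    refine Finset.sum_congr rfl fun j _ => ?_
    split_ifs <;> simp
  rw [e]
  refine hasSum_sum fun i _ => hasSum_sum fun j _ => ?_
  have := hasSum_ite_eq [(i : ℕ)] (if z = [(j : ℕ)] then M i j else 0)
  refine this.congr_fun fun x => ?_
  split_ifs <;> simp_all

theorem sum_laplacianMatrix_eq_zero {n : ℕ} {M : Matrix (Fin n) (Fin n) ℝ} (hM : M.IsSymm)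
    (j : Fin n) : ∑ i, laplacianMatrix M i j = 0 := by
  simp only [laplacianMatrix, Matrix.sub_apply, Finset.sum_sub_distrib, Matrix.diagonal_apply]
  simp [fun i => hM.apply i j]

theorem hasSum_extendedEntry_laplacianMatrix {n : ℕ} {M : Matrix (Fin n) (Fin n) ℝ} (hM : M.IsSymm)
    (σ : Equiv.Perm (List ℕ)) (v : List ℕ) :
    HasSum (fun u => extendedEntry (laplacianMatrix M) (σ u) (σ v)) 0 := by
  have h := hasSum_extendedEntry (laplacianMatrix M) (σ v)
  simp only [sum_laplacianMatrix_eq_zero hM, ite_self, Finset.sum_const_zero] at h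
  exact (Equiv.hasSum_iff σ (f := fun x => extendedEntry (laplacianMatrix M) x (σ v))).2 h

theorem delta_apply {V : Type*} [DecidableEq V] (v u : V) :
    (delta v : V → ℂ) u = if u = v then 1 else 0 := by
  unfold delta
  by_cases h : u = v
  · subst h
    simp
  · simp [h]

theorem inner_delta {V : Type*} (v : V) (ψ : EllTwo V) : inner ℂ (delta v) ψ = (ψ : V → ℂ) v := by
  unfold delta
  simp [lp.inner_single_left]

theorem matrixOperator_apply {n : ℕ} (M : Matrix (Fin n) (Fin n) ℝ) (ψ : EllTwo (List ℕ))
    (x : List ℕ) : (matrixOperator M ψ : List ℕ → ℂ) x =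
      ∑ i : Fin n, ∑ j : Fin n, if x = [(i : ℕ)] then (M i j : ℂ) * (ψ : List ℕ → ℂ) [(j : ℕ)] else 0 := by
  simp only [matrixOperator, sum_apply, smul_apply,
    ContinuousLinearMap.smulRight_apply, innerSL_apply_apply, inner_delta, lp.coeFn_sum,
    Finset.sum_apply, lp.coeFn_smul, Pi.smul_apply, delta_apply, smul_eq_mul]
  refine Finset.sum_congr rfl fun i _ => Finset.sum_congr rfl fun j _ => ?_
  split_ifs <;> simp

/-- Conjugation by a permutation relabels the entries. -/
theorem permUnitary_symm_matrixOperator {n : ℕ} (M : Matrix (Fin n) (Fin n) ℝ)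
    (σ : Equiv.Perm (List ℕ)) {φ : EllTwo (List ℕ)} (hφ : φ ∈ finSupported (List ℕ)) :
    (permUnitary σ).symm (matrixOperator M (permUnitary σ φ)) =
      weightOperator (fun u v => extendedEntry M (σ u) (σ v)) ⟨φ, hφ⟩ := by
  obtain ⟨s, hs⟩ := exists_finset_support_subset hφ
  have hmem : ∀ v, Memℓp (fun u => (extendedEntry M (σ u) (σ v) : ℂ)) 2 := fun v =>
    memℓp_of_hasSum (w := fun u v => extendedEntry M (σ u) (σ v))
      ((Equiv.hasSum_iff σ (f := fun x => extendedEntry M x (σ v))).2 (hasSum_extendedEntry M (σ v)))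
  rw [weightOperator_apply _ hφ hs]
  ext u
  change (matrixOperator M (permUnitary σ φ) : List ℕ → ℂ) (σ u) = _
  rw [matrixOperator_apply, lp.coeFn_sum, Finset.sum_apply]
  have hcol : ∀ v, (weightColumn (fun u v => extendedEntry M (σ u) (σ v)) v : List ℕ → ℂ) u =
      extendedEntry M (σ u) (σ v) := fun v => weightColumn_apply
    (w := fun u v => extendedEntry M (σ u) (σ v)) (hmem v) u
  simp only [lp.coeFn_smul, Pi.smul_apply, hcol, smul_eq_mul]
  simp only [extendedEntry, Complex.ofReal_sum, Finset.mul_sum]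
  rw [Finset.sum_comm (s := s)]
  refine Finset.sum_congr rfl fun i _ => ?_
  rw [Finset.sum_comm (s := s)]
  refine Finset.sum_congr rfl fun j _ => ?_
  change (if σ u = [(i : ℕ)] then (M i j : ℂ) * (φ : List ℕ → ℂ) (σ.symm [(j : ℕ)]) else 0) = _
  by_cases hu : σ u = [(i : ℕ)]
  · simp only [hu, if_true, true_and, apply_ite Complex.ofReal, Complex.ofReal_zero, mul_ite,
      mul_zero, ← Equiv.eq_symm_apply]
    rw [Finset.sum_ite_eq' s (σ.symm [(j : ℕ)])]
    split_ifs with h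
    · ring
    · have : (φ : List ℕ → ℂ) (σ.symm [(j : ℕ)]) = 0 := by
        by_contra h'
        exact h (hs h')
      rw [this, mul_zero]
  · simp [hu]

/-! ### The operator of the tree and its quantization -/

open Classical in
/-- The off-diagonal part of a column of `pwitlWeight`: `c k` at the `k`-th child of `v` and `p` at
the parent. -/
def treeColumn (v : List ℕ) (p : ℝ) (c : ℕ → ℝ) (u : List ℕ) : ℝ :=
  if ∃ k, u = k :: v then c u.headI else if ∃ k, v = k :: u then p else 0

theorem hasSum_treeColumn {v : List ℕ} {p S : ℝ} {c : ℕ → ℝ} (hc : HasSum c S)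
    (hp : v = [] → p = 0) : HasSum (treeColumn v p c) (p + S) := by
  classical
  have h1 : HasSum (fun u : List ℕ => if ∃ k, u = k :: v then c u.headI else 0) S := by
    have hinj : Function.Injective fun k : ℕ => k :: v := fun k k' h => (List.cons.inj h).1
    rw [← hinj.hasSum_iff]
    · convert hc using 1
      funext k
      simp
    · intro u hu
      rw [if_neg]
      rintro ⟨k, rfl⟩
      exact hu ⟨k, rfl⟩
  have h2 : HasSum (fun u : List ℕ => if ∃ k, v = k :: u then p else 0) p := by
    cases v with
    | nil => simp [hp rfl]
    | cons k u₀ =>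
      convert hasSum_ite_eq u₀ p using 1
      funext u
      simp [eq_comm]
  convert h2.add h1 using 1
  funext u
  unfold treeColumn
  by_cases hu : ∃ k, u = k :: v
  · have : ¬∃ k', v = k' :: u := by
      rintro ⟨k', hk'⟩
      obtain ⟨k, rfl⟩ := hu
      have := congrArg List.length hk'
      simp only [List.length_cons] at this
      omega
    rw [if_pos hu, if_neg this, if_pos hu, zero_add]
  · rw [if_neg hu, if_neg hu, add_zero]

theorem parentWeight_cons (y : List ℕ → ℕ → ℝ) (k : ℕ) (v : List ℕ) :
    parentWeight y (k :: v) = y v k := rfl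

theorem pwitlWeight_of_ne (y : List ℕ → ℕ → ℝ) {u v : List ℕ} (h : u ≠ v) :
    pwitlWeight y u v = treeColumn v (parentWeight y v) (y v) u := by
  unfold pwitlWeight treeColumn
  rw [if_neg h]
  split_ifs with h1
  · obtain ⟨k, rfl⟩ := h1
    rfl
  · rfl
  · rfl

theorem treeColumn_self (v : List ℕ) (p : ℝ) (c : ℕ → ℝ) : treeColumn v p c v = 0 := by
  unfold treeColumn
  rw [if_neg, if_neg] <;>
  · rintro ⟨k, hk⟩
    have := congrArg List.length hk
    simp at this

/-- The columns of the tree with loops sum to zero, as do those of the Laplacian of a symmetric matrix. -/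
theorem hasSum_pwitlWeight {y : List ℕ → ℕ → ℝ} {v : List ℕ} (hy : Summable (y v)) :
    HasSum (fun u => pwitlWeight y u v) 0 := by
  classical
  have h1 := hasSum_treeColumn (v := v) (p := parentWeight y v) hy.hasSum (by rintro rfl; rfl)
  have h2 := (hasSum_ite_eq v (loopWeight y v)).add h1
  have e : loopWeight y v + (parentWeight y v + ∑' k, y v k) = 0 := by
    rw [loopWeight]
    ring
  rw [e] at h2
  refine h2.congr_fun fun u => ?_
  by_cases h : u = v
  · subst h
    simp [treeColumn_self, pwitlWeight]
  · simp [h, pwitlWeight_of_ne]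

theorem tsum_abs_pwitlWeight_sub {y y' : List ℕ → ℕ → ℝ} {v : List ℕ}
    (hs : Summable fun k => |y v k - y' v k|) :
    (∑' u, if u = v then 0 else |pwitlWeight y u v - pwitlWeight y' u v|) =
      |parentWeight y v - parentWeight y' v| + ∑' k, |y v k - y' v k| := by
  rw [← (hasSum_treeColumn (v := v) (p := |parentWeight y v - parentWeight y' v|) hs.hasSum
    (by rintro rfl; simp [parentWeight])).tsum_eq]
  refine tsum_congr fun u => ?_
  by_cases h : u = v
  · subst h
    simp [treeColumn_self]
  · rw [if_neg h, pwitlWeight_of_ne _ h, pwitlWeight_of_ne _ h]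
    unfold treeColumn
    split_ifs <;> simp

/-- The labels `1, …, r` stand for cells of numbers of absolute value at least `η`; each number in a
cell is close to the representative of the cell. The label `0` is given to all other numbers; the
numbers of absolute value between `δ` and `R` are in a cell. -/
structure IsCellLabelling {r : ℕ} (lab : ℝ → Fin (r + 1)) (rep : Fin (r + 1) → ℝ)
    (η δ R a : ℝ) : Prop where
  rep_zero : rep 0 = 0
  le_abs : ∀ x, lab x ≠ 0 → η ≤ |x|
  abs_sub_le : ∀ x, lab x ≠ 0 → |x - rep (lab x)| ≤ a
  of_eq_zero : ∀ x, lab x = 0 → |x| ≤ δ ∨ R ≤ |x|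

/-- The edge weights of the tree with the weights below the first `h` words replaced by the
representatives of given labels, and all other weights replaced by zero. -/
def quantizedWeight {r h K : ℕ} (rep : Fin (r + 1) → ℝ) (d : Fin h → Fin K → Fin (r + 1))
    (v : List ℕ) (k : ℕ) : ℝ :=
  if H : wordEquiv v < h ∧ k < K then rep (d ⟨wordEquiv v, H.1⟩ ⟨k, H.2⟩) else 0

theorem summable_quantizedWeight {r h K : ℕ} (rep : Fin (r + 1) → ℝ)
    (d : Fin h → Fin K → Fin (r + 1)) (v : List ℕ) :
    Summable (quantizedWeight rep d v) := by
  refine summable_of_ne_finset_zero (s := Finset.range K) fun k hk => ?_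
  rw [quantizedWeight, dif_neg]
  rintro ⟨_, h⟩
  exact hk (Finset.mem_range.2 h)

section

variable {r h K : ℕ} {lab : ℝ → Fin (r + 1)} {rep : Fin (r + 1) → ℝ} {η δ R a e : ℝ}

theorem abs_sub_quantizedWeight_le (hL : IsCellLabelling lab rep η δ R a) (ha : 0 ≤ a) (hδ : 0 ≤ δ)
    {x : List ℕ → ℕ → ℝ} {v : List ℕ} (hv : wordEquiv v < h) (hK : ¬∃ k ≥ K, η ≤ |x v k|)
    (hR : ¬∃ k, R ≤ |x v k|) (k : ℕ) :
    |x v k - quantizedWeight (h := h) rep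
      (fun u => treeLabels K lab (x (wordEquiv.symm u))) v k| ≤
      (if k ∈ Finset.range K then a else 0) + min |x v k| δ := by
  push Not at hK hR
  by_cases hk : k < K
  · rw [quantizedWeight, dif_pos ⟨hv, hk⟩, if_pos (Finset.mem_range.2 hk)]
    simp only [treeLabels, Equiv.symm_apply_apply]
    by_cases h0 : lab (x v k) = 0
    · rcases hL.of_eq_zero _ h0 with h1 | h1
      · rw [h0, hL.rep_zero, sub_zero, min_eq_left h1]
        linarith
      · exact absurd h1 (not_le.2 (hR k))
    · exact (hL.abs_sub_le _ h0).trans (le_add_of_nonneg_right (le_min (abs_nonneg _) hδ))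
  · rw [quantizedWeight, dif_neg fun H => hk H.2, if_neg (by simpa using hk), sub_zero, zero_add]
    have h0 : lab (x v k) = 0 := by
      by_contra h0
      exact absurd (hL.le_abs _ h0) (not_le.2 (hK k (not_lt.1 hk)))
    rcases hL.of_eq_zero _ h0 with h1 | h1
    · rw [min_eq_left h1]
    · exact absurd h1 (not_le.2 (hR k))

theorem tsum_abs_sub_quantizedWeight_le (hL : IsCellLabelling lab rep η δ R a) (ha : 0 ≤ a)
    (hδ : 0 ≤ δ) (he : 0 ≤ e)
    {x : List ℕ → ℕ → ℝ} {v : List ℕ} (hv : wordEquiv v < h) (hK : ¬∃ k ≥ K, η ≤ |x v k|)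
    (hR : ¬∃ k, R ≤ |x v k|)
    (hsum : ∑' k, ENNReal.ofReal (min |x v k| δ) ≤ ENNReal.ofReal e) :
    (Summable fun k => |x v k - quantizedWeight (h := h) rep
      (fun u => treeLabels K lab (x (wordEquiv.symm u))) v k|) ∧
    ∑' k, |x v k - quantizedWeight (h := h) rep
      (fun u => treeLabels K lab (x (wordEquiv.symm u))) v k| ≤ K * a + e := by
  have hb := abs_sub_quantizedWeight_le hL ha hδ hv hK hR
  have h0 : ∀ k, 0 ≤ min |x v k| δ := fun k => le_min (abs_nonneg _) hδ
  have hne : ∑' k, ENNReal.ofReal (min |x v k| δ) ≠ ∞ := ne_top_of_le_ne_top ENNReal.ofReal_ne_top hsum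
  have hs1 : Summable fun k => min |x v k| δ := by
    refine (ENNReal.summable_toReal hne).congr fun k => ?_
    rw [ENNReal.toReal_ofReal (h0 k)]
  have hle : ∑' k, min |x v k| δ ≤ e := by
    have := ENNReal.toReal_mono ENNReal.ofReal_ne_top hsum
    rw [ENNReal.toReal_ofReal he, ENNReal.tsum_toReal_eq fun k => ENNReal.ofReal_ne_top] at this
    simpa only [ENNReal.toReal_ofReal (h0 _)] using this
  have hs2 : Summable fun k => if k ∈ Finset.range K then a else 0 :=
    summable_of_ne_finset_zero (s := Finset.range K) fun k hk => if_neg hk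
  have hs3 : ∑' k, (if k ∈ Finset.range K then a else 0) = K * a := by
    rw [tsum_eq_sum (s := Finset.range K) fun k hk => if_neg hk,
      Finset.sum_congr rfl fun k hk => if_pos hk]
    simp
  have hs := Summable.of_nonneg_of_le (fun k => abs_nonneg _) hb (hs2.add hs1)
  refine ⟨hs, (hs.tsum_le_tsum hb (hs2.add hs1)).trans ?_⟩
  rw [hs2.tsum_add hs1, hs3]
  linarith

/-- If there are no exceptional weights below the first `h` words, the operator of the tree is close
to the operator with quantized weights. -/
theorem norm_pwitlOperator_sub_quantizedWeight_le (hL : IsCellLabelling lab rep η δ R a)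
    (ha : 0 ≤ a) (hδ : 0 ≤ δ) (he : 0 ≤ e) {x : List ℕ → ℕ → ℝ}
    (hK : ∀ v, wordEquiv v < h → ¬∃ k ≥ K, η ≤ |x v k|)
    (hR : ∀ v, wordEquiv v < h → ¬∃ k, R ≤ |x v k|)
    (hsum : ∀ v, wordEquiv v < h → ∑' k, ENNReal.ofReal (min |x v k| δ) ≤ ENNReal.ofReal e)
    {φ : EllTwo (List ℕ)} (hφ : φ ∈ finSupported (List ℕ)) {s : Finset (List ℕ)}
    (hs : Function.support (φ : List ℕ → ℂ) ⊆ s) (hsh : ∀ v ∈ s, wordEquiv v < h) :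
    ‖pwitlOperator x ⟨φ, hφ⟩ - pwitlOperator (quantizedWeight (h := h) rep
      fun u => treeLabels K lab (x (wordEquiv.symm u))) ⟨φ, hφ⟩‖ ≤
      2 * (2 * (K * a + e)) * ∑ v ∈ s, ‖(φ : List ℕ → ℂ) v‖ := by
  have key := fun v hv => tsum_abs_sub_quantizedWeight_le hL ha hδ he (hv : wordEquiv v < h) (hK v hv)
    (hR v hv) (hsum v hv)
  refine norm_weightOperator_sub_le hφ hs (fun v hv => ?_) (fun v hv => ?_) fun v hv => ?_
  · refine hasSum_pwitlWeight ?_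
    have := ((key v (hsh v hv)).1.of_abs).add (summable_quantizedWeight (h := h) rep
      (fun u => treeLabels K lab (x (wordEquiv.symm u))) v)
    exact this.congr fun k => by ring
  · exact hasSum_pwitlWeight (summable_quantizedWeight _ _ _)
  · have h1 := key v (hsh v hv)
    rw [tsum_abs_pwitlWeight_sub h1.1]
    have h2 : |parentWeight x v - parentWeight (quantizedWeight (h := h) rep
        fun u => treeLabels K lab (x (wordEquiv.symm u))) v| ≤ K * a + e := by
      cases v with
      | nil =>
        simp only [parentWeight, sub_self, abs_zero]
        positivity
      | cons k u =>
        have h3 := key u ((wordEquiv_lt_cons k u).trans (hsh _ hv))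
        exact (h3.1.le_tsum k fun _ _ => abs_nonneg _).trans h3.2
    linarith [h1.2]

end

/-! ### The matrix in the explored neighbourhood -/

/-- Explored rows `R` and drawn labels `d` without exceptional behaviour: no two rows have large
entries in the same column, the entries in the `t` reserved columns are small, the drawn labels have
the multiplicities of the labels of the rows, and the unlabelled entries have a small sum. -/
structure IsGoodExploration {h N K r : ℕ} (t : ℕ) (lab : ℝ → Fin (r + 1)) (η η' e : ℝ)
    (R : Fin h → Fin N → ℝ) (d : Fin h → Fin K → Fin (r + 1)) : Prop where
  separated : ∀ u u' j, u ≠ u' → η ≤ |R u j| → |R u' j| < η'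
  reserved : ∀ u (j : Fin N), (j : ℕ) < t → |R u j| < η'
  labelCount_eq : ∀ u, (labelCount fun j => lab (R u j)) = labelCount (d u)
  sum_le : ∀ u, ∑ j, (if lab (R u j) = 0 then |R u j| else 0) ≤ e

section

variable {h t N K r : ℕ} {lab : ℝ → Fin (r + 1)} {rep : Fin (r + 1) → ℝ} {η η' δ ρ a e : ℝ}
  {R : Fin h → Fin N → ℝ} {d : Fin h → Fin K → Fin (r + 1)} {htN : t ≤ N}

/-- On a good exploration no collision occurs: each child with a nonzero label is placed at the vertex
that it is matched with. -/
theorem exists_matching_eq_placement (hG : IsGoodExploration t lab η η' e R d)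
    (hL : IsCellLabelling lab rep η δ ρ a) (hη : η' ≤ η) {u : Fin h} {k : Fin K} (hk : d u k ≠ 0)
    {w : Fin t} (hw : (w : ℕ) = childIndex u k) :
    matching (fun j => lab (R u j)) (d u) k =
      some (placement htN (candidate (fun u j => lab (R u j)) d) w) := by
  obtain ⟨j, hj⟩ := Option.ne_none_iff_exists'.1 (matching_ne_none (hG.labelCount_eq u) hk)
  have hlarge : ∀ (u' : Fin h) (k' : Fin K), matching (fun j => lab (R u' j)) (d u') k' = some j →
      η ≤ |R u' j| := fun u' k' h' => by
    have := matching_spec h'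
    exact hL.le_abs _ (this.1 ▸ this.2)
  rw [hj, placement_of_some (j := j)]
  · rw [candidate_child (l := fun u j => lab (R u j)) (d := d) hw, hj]
  · by_contra ht
    have h1 := hG.reserved u j (not_le.1 ht)
    linarith [hlarge u k hj]
  · intro w' hw' hcand
    obtain ⟨u', k', hw'', hm⟩ := exists_of_candidate_eq_some hcand
    by_cases huu : u' = u
    · subst huu
      rw [matching_inj hm hj] at hw''
      rw [Fin.lt_def, hw, hw''] at hw'
      exact lt_irrefl _ hw'
    · have h1 := hG.separated u' u j huu (hlarge u' k' hm)
      linarith [hlarge u k hj]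

theorem placement_of_eq_zero (hG : IsGoodExploration t lab η η' e R d) {u : Fin h} {k : Fin K}
    (hk : d u k = 0) {w : Fin t} (hw : (w : ℕ) = childIndex u k) :
    |R u (placement htN (candidate (fun u j => lab (R u j)) d) w)| < η' := by
  rw [placement_of_none]
  · exact hG.reserved _ _ w.isLt
  · rw [candidate_child (l := fun u j => lab (R u j)) (d := d) hw]
    by_contra hne
    obtain ⟨j, hj⟩ := Option.ne_none_iff_exists'.1 hne
    exact (matching_spec hj).2 hk

/-- The entry between the places of a word and of its child is close to the quantized weight, whether
the child is matched with a large entry or is put at a reserved vertex. -/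
theorem abs_placement_child_le (hG : IsGoodExploration t lab η η' e R d)
    (hL : IsCellLabelling lab rep η δ ρ a) (hη : η' ≤ η) {u : Fin h} {k : Fin K} {w : Fin t}
    (hw : (w : ℕ) = childIndex u k) :
    |R u (placement htN (candidate (fun u j => lab (R u j)) d) w) - rep (d u k)| ≤ max a η' := by
  by_cases hk : d u k = 0
  · rw [hk, hL.rep_zero, sub_zero]
    exact (placement_of_eq_zero hG hk hw).le.trans (le_max_right _ _)
  · have hm := matching_spec (exists_matching_eq_placement (htN := htN) hG hL hη hk hw)
    rw [← hm.1]
    exact (hL.abs_sub_le _ (hm.1 ▸ hm.2)).trans (le_max_left _ _)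

/-- The entry between the places of a word and of a word that is not one of its first `K` children is
small: that word was placed at a reserved vertex, or at a large entry of another row. -/
theorem abs_placement_lt_of_not_child (hG : IsGoodExploration t lab η η' e R d)
    (hL : IsCellLabelling lab rep η δ ρ a) {u : Fin h} {w : Fin t}
    (hw : ∀ k : Fin K, (w : ℕ) ≠ childIndex u k) :
    |R u (placement htN (candidate (fun u j => lab (R u j)) d) w)| < η' := by
  rcases placement_eq_or (htN := htN) (candidate (fun u j => lab (R u j)) d) w with h1 | h1
  · rw [h1]
    exact hG.reserved _ _ w.isLt
  · obtain ⟨u', k', hw', hm⟩ := exists_of_candidate_eq_some h1.1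
    have huu : u' ≠ u := by
      rintro rfl
      exact hw k' hw'
    have h2 := matching_spec hm
    exact hG.separated u' u _ huu (hL.le_abs _ (h2.1 ▸ h2.2))

variable {M : Matrix (Fin N) (Fin N) ℝ} {hht : h ≤ t} {R₀ : Fin h → Fin N → ℝ} {s : Fin t → Fin N}
  {σ : Equiv.Perm (List ℕ)}

theorem wordEquiv_lt_of_child (hK : ∀ (u : Fin h) (k : Fin K), childIndex u k < t) (v : Fin h)
    {k : ℕ} (hk : k < K) : wordEquiv (k :: wordEquiv.symm v) < t := hK v ⟨k, hk⟩

theorem quantizedWeight_word (v : Fin h) (k : Fin K) :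
    quantizedWeight rep d (wordEquiv.symm v) k = rep (d v k) := by
  simp [quantizedWeight]

theorem quantizedWeight_of_le (v : List ℕ) {k : ℕ} (hk : K ≤ k) : quantizedWeight rep d v k = 0 := by
  rw [quantizedWeight, dif_neg]
  rintro ⟨_, h⟩
  omega

/-- Entrywise comparison of a column of the matrix with the column of the quantized tree. -/
theorem abs_sub_pwitlWeight_le (hG : IsGoodExploration t lab η η' e R d)
    (hL : IsCellLabelling lab rep η δ ρ a) (hη : η' ≤ η)
    (hM : M.IsSymm) (hK : ∀ (u : Fin h) (k : Fin K), childIndex u k < t)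
    (hR : R = exploredRow hht M s R₀)
    (hs : s = placement htN (candidate (fun u j => lab (R u j)) d))
    (hσ : ∀ w : Fin t, σ (wordEquiv.symm w) = [((s w : Fin N) : ℕ)]) (v : Fin h) {j : Fin N}
    (hj : j ≠ s (Fin.castLE hht v)) :
    |M j (s (Fin.castLE hht v)) -
      pwitlWeight (quantizedWeight rep d) (σ.symm [(j : ℕ)]) (wordEquiv.symm v)| ≤
    (if j ∈ (Finset.univ.filter fun u : Fin h => u < v).image fun u => s (Fin.castLE hht u)
      then max a η' else 0) +
      (if lab (R v j) = 0 then |R v j| else a) := by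
  have hinj : Function.Injective s := by
    rw [hs]
    exact placement_injective _ _
  have ha : ∀ x, lab x ≠ 0 → 0 ≤ a := fun x hx => (abs_nonneg _).trans (hL.abs_sub_le x hx)
  have hlast : 0 ≤ if lab (R v j) = 0 then |R v j| else a := by
    split_ifs with h0
    · exact abs_nonneg _
    · exact ha _ h0
  have hσ' : ∀ w : Fin t, σ.symm [((s w : Fin N) : ℕ)] = wordEquiv.symm w := fun w => by
    rw [Equiv.symm_apply_eq, hσ]
  have hidx : ∀ (u : List ℕ) (hu : wordEquiv u < t), σ.symm [(j : ℕ)] = u →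
      j = s ⟨wordEquiv u, hu⟩ := by
    rintro u hu hju
    rw [Equiv.symm_apply_eq] at hju
    have h1 := hσ ⟨wordEquiv u, hu⟩
    rw [Equiv.symm_apply_apply, ← hju, List.cons.injEq] at h1
    exact Fin.ext h1.1
  have hne : σ.symm [(j : ℕ)] ≠ wordEquiv.symm v := by
    intro heq
    apply hj
    have h1 := hidx (wordEquiv.symm v) (by rw [Equiv.apply_symm_apply]; exact v.isLt.trans_le hht) heq
    rw [h1]
    congr 1
    exact Fin.ext (by simp)
  rw [pwitlWeight_of_ne _ hne]
  by_cases hearly : j ∈ (Finset.univ.filter fun u : Fin h => u < v).image fun u =>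
      s (Fin.castLE hht u)
  · -- The vertex was explored before: its row contains the entry.
    rw [if_pos hearly]
    refine le_add_of_le_of_nonneg ?_ hlast
    obtain ⟨u, hu, rfl⟩ := Finset.mem_image.1 hearly
    replace hu : u < v := (Finset.mem_filter.1 hu).2
    have hrow : M (s (Fin.castLE hht u)) (s (Fin.castLE hht v)) = R u (s (Fin.castLE hht v)) := by
      rw [hR, exploredRow, if_neg]
      rintro ⟨u'', hu'', heq⟩
      rw [hinj heq, Fin.le_def] at hu''
      rw [Fin.lt_def] at hu
      simp only [Fin.val_castLE] at hu''
      omega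
    have hword : σ.symm [((s (Fin.castLE hht u) : Fin N) : ℕ)] = wordEquiv.symm u := hσ' _
    rw [hrow, hword]
    unfold treeColumn
    rw [if_neg]
    · by_cases hch : ∃ k, wordEquiv.symm (v : ℕ) = k :: wordEquiv.symm u
      · rw [if_pos hch]
        obtain ⟨k, hk⟩ := hch
        have hv : (v : ℕ) = childIndex u k := by
          rw [childIndex, ← hk, Equiv.apply_symm_apply]
        rw [hk, parentWeight_cons]
        by_cases hkK : k < K
        · rw [quantizedWeight_word u ⟨k, hkK⟩, hs]
          exact abs_placement_child_le hG hL hη (k := ⟨k, hkK⟩) hv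
        · rw [quantizedWeight_of_le _ (not_lt.1 hkK), sub_zero, hs]
          refine (abs_placement_lt_of_not_child hG hL fun k' hk' => ?_).le.trans (le_max_right _ _)
          have := (childIndex_inj (hv.symm.trans hk')).2
          omega
      · rw [if_neg hch, sub_zero, hs]
        refine (abs_placement_lt_of_not_child hG hL fun k' hk' => hch ⟨k', ?_⟩).le.trans
          (le_max_right _ _)
        rw [Equiv.symm_apply_eq]
        exact hk'
    · rintro ⟨k, hk⟩
      have h1 := wordEquiv_lt_cons k (wordEquiv.symm (v : ℕ))
      rw [← hk, Equiv.apply_symm_apply, Equiv.apply_symm_apply] at h1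
      rw [Fin.lt_def] at hu
      omega
  · -- The entry is read off when the row of `v` is explored.
    rw [if_neg hearly, zero_add]
    have hrow : M j (s (Fin.castLE hht v)) = R v j := by
      rw [hM.apply, hR, exploredRow, if_neg]
      rintro ⟨u'', hu'', heq⟩
      rcases hu''.lt_or_eq with hlt | heq'
      · refine hearly (Finset.mem_image.2 ⟨⟨u'', ?_⟩, Finset.mem_filter.2 ⟨Finset.mem_univ _, ?_⟩, heq⟩)
        · rw [Fin.lt_def, Fin.val_castLE] at hlt
          omega
        · rw [Fin.lt_def] at hlt ⊢
          exact hlt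
      · rw [heq'] at heq
        exact hj heq.symm
    rw [hrow]
    by_cases h0 : lab (R v j) = 0
    · rw [if_pos h0]
      have hz : treeColumn (wordEquiv.symm (v : ℕ))
          (parentWeight (quantizedWeight rep d) (wordEquiv.symm (v : ℕ)))
          (quantizedWeight rep d (wordEquiv.symm (v : ℕ))) (σ.symm [(j : ℕ)]) = 0 := by
        unfold treeColumn
        split_ifs with h1 h2
        · obtain ⟨k, hk⟩ := h1
          rw [hk, List.headI_cons]
          by_cases hkK : k < K
          · rw [quantizedWeight_word v ⟨k, hkK⟩]
            by_cases hd : d v ⟨k, hkK⟩ = 0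
            · rw [hd, hL.rep_zero]
            · have h3 := hidx _ (wordEquiv_lt_of_child hK v hkK) hk
              have h4 := matching_spec (exists_matching_eq_placement (htN := htN) hG hL hη hd
                (w := ⟨_, wordEquiv_lt_of_child hK v hkK⟩) rfl)
              rw [← hs, ← h3] at h4
              exact absurd (h4.1.symm.trans h0) h4.2
          · exact quantizedWeight_of_le _ (not_lt.1 hkK)
        · obtain ⟨k, hk⟩ := h2
          have h3 := wordEquiv_lt_cons k (σ.symm [(j : ℕ)])
          rw [← hk, Equiv.apply_symm_apply] at h3
          have h4 := hidx _ ((h3.trans v.isLt).trans_le hht) rfl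
          exact absurd (Finset.mem_image.2 ⟨⟨_, h3.trans v.isLt⟩,
            Finset.mem_filter.2 ⟨Finset.mem_univ _, h3⟩, h4.symm⟩) hearly
        · rfl
      rw [hz, sub_zero]
    · rw [if_neg h0]
      obtain ⟨k, hk⟩ := exists_matching_eq_some (hG.labelCount_eq v) h0
      have hm := matching_spec hk
      have h1 := exists_matching_eq_placement (htN := htN) hG hL hη hm.2 (w := ⟨_, hK v k⟩) rfl
      rw [hk, Option.some.injEq, ← hs] at h1
      have hword : σ.symm [(j : ℕ)] = (k : ℕ) :: wordEquiv.symm v := by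
        rw [h1, hσ']
        simp [childIndex]
      unfold treeColumn
      rw [if_pos ⟨k, hword⟩, hword, List.headI_cons, quantizedWeight_word, ← hm.1]
      exact hL.abs_sub_le _ h0

/-- Entries with nonzero labels are matched with distinct children, so there are at most `K` of them. -/
theorem card_label_ne_zero_le {l : Fin N → Fin (r + 1)} {c : Fin K → Fin (r + 1)}
    (hl : labelCount l = labelCount c) : (Finset.univ.filter fun j => l j ≠ 0).card ≤ K := by
  classical
  have hsub : (Finset.univ.filter fun j => l j ≠ 0).map Function.Embedding.some ⊆
      Finset.univ.image (matching l c) := by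
    intro o ho
    obtain ⟨j, hj, rfl⟩ := Finset.mem_map.1 ho
    obtain ⟨k, hk⟩ := exists_matching_eq_some hl (Finset.mem_filter.1 hj).2
    exact Finset.mem_image.2 ⟨k, Finset.mem_univ _, hk⟩
  have := (Finset.card_le_card hsub).trans Finset.card_image_le
  simpa using this

/-- On a good exploration the column of the matrix at a word is close to the column of the quantized
tree, in `ℓ¹` and off the diagonal. -/
theorem tsum_abs_extendedEntry_sub_le (hG : IsGoodExploration t lab η η' e R d)
    (hL : IsCellLabelling lab rep η δ ρ a) (hη : η' ≤ η) (ha : 0 ≤ a)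
    (hM : M.IsSymm) (hK : ∀ (u : Fin h) (k : Fin K), childIndex u k < t)
    (hR : R = exploredRow hht M s R₀)
    (hs : s = placement htN (candidate (fun u j => lab (R u j)) d))
    (hσ : ∀ w : Fin t, σ (wordEquiv.symm w) = [((s w : Fin N) : ℕ)]) (v : Fin h) :
    (∑' u, if u = wordEquiv.symm (v : ℕ) then 0 else
      |extendedEntry (laplacianMatrix M) (σ u) (σ (wordEquiv.symm (v : ℕ))) -
        pwitlWeight (quantizedWeight rep d) u (wordEquiv.symm (v : ℕ))|) ≤
      h * max a η' + (K * a + e) := by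
  have hσv : σ (wordEquiv.symm (v : ℕ)) = [((s (Fin.castLE hht v) : Fin N) : ℕ)] :=
    hσ (Fin.castLE hht v)
  have hσsymm : ∀ j : Fin N, σ.symm [(j : ℕ)] = wordEquiv.symm (v : ℕ) ↔ j = s (Fin.castLE hht v) := by
    intro j
    rw [Equiv.symm_apply_eq, hσv]
    simp [Fin.ext_iff]
  have hginj : Function.Injective fun j : Fin N => σ.symm [(j : ℕ)] := fun j j' hjj => by
    simpa [Fin.ext_iff] using σ.symm.injective hjj
  have hrange : ∀ u, wordEquiv u < t → u ∈ Set.range fun j : Fin N => σ.symm [(j : ℕ)] := by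
    intro u hu
    refine ⟨s ⟨wordEquiv u, hu⟩, ?_⟩
    change σ.symm [((s ⟨wordEquiv u, hu⟩ : Fin N) : ℕ)] = u
    rw [Equiv.symm_apply_eq, ← hσ, Equiv.symm_apply_apply]
  rw [← hginj.tsum_eq, tsum_fintype]
  · have hbound : ∀ j : Fin N, (if σ.symm [(j : ℕ)] = wordEquiv.symm (v : ℕ) then 0 else
        |extendedEntry (laplacianMatrix M) (σ (σ.symm [(j : ℕ)])) (σ (wordEquiv.symm (v : ℕ))) -
        pwitlWeight (quantizedWeight rep d) (σ.symm [(j : ℕ)]) (wordEquiv.symm (v : ℕ))|) ≤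
        (if j ∈ (Finset.univ.filter fun u : Fin h => u < v).image fun u => s (Fin.castLE hht u)
          then max a η' else 0) +
          ((if lab (R v j) = 0 then |R v j| else 0) + if lab (R v j) ≠ 0 then a else 0) := by
      intro j
      by_cases hj : j = s (Fin.castLE hht v)
      · rw [if_pos ((hσsymm j).2 hj)]
        have := abs_nonneg (R v j)
        have : 0 ≤ max a η' := le_max_of_le_left ha
        split_ifs <;> linarith
      · rw [if_neg fun h => hj ((hσsymm j).1 h), Equiv.apply_symm_apply, hσv, extendedEntry_singleton,
          laplacianMatrix, Matrix.sub_apply, Matrix.diagonal_apply_ne _ hj, sub_zero]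
        refine (abs_sub_pwitlWeight_le hG hL hη hM hK hR hs hσ v hj).trans (le_of_eq ?_)
        congr 1
        by_cases h0 : lab (R v j) = 0 <;> simp [h0]
    refine (Finset.sum_le_sum fun j _ => hbound j).trans ?_
    rw [Finset.sum_add_distrib, Finset.sum_add_distrib]
    have h1 : ∑ j : Fin N, (if j ∈ (Finset.univ.filter fun u : Fin h => u < v).image
        fun u => s (Fin.castLE hht u) then max a η' else 0) ≤ h * max a η' := by
      rw [← Finset.sum_filter, Finset.sum_const, nsmul_eq_mul]
      have : 0 ≤ max a η' := le_max_of_le_left ha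
      gcongr
      rw [Finset.filter_univ_mem]
      exact Finset.card_image_le.trans ((Finset.card_filter_le _ _).trans (by simp))
    have h2 : ∑ j : Fin N, (if lab (R v j) ≠ 0 then a else 0) ≤ K * a := by
      rw [← Finset.sum_filter, Finset.sum_const, nsmul_eq_mul]
      gcongr
      exact card_label_ne_zero_le (hG.labelCount_eq v)
    linarith [hG.sum_le v]
  · intro u hu
    by_contra hnot
    refine hu ?_
    change (if u = wordEquiv.symm (v : ℕ) then 0 else _) = 0
    split_ifs with h1
    · rfl
    rw [extendedEntry_eq_zero, pwitlWeight_of_ne _ h1, zero_sub, abs_neg, abs_eq_zero]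
    · unfold treeColumn
      split_ifs with h2 h3
      · obtain ⟨k, rfl⟩ := h2
        refine quantizedWeight_of_le _ (not_lt.1 fun hk => hnot (hrange _ ?_))
        exact wordEquiv_lt_of_child hK v hk
      · obtain ⟨k, hk⟩ := h3
        have h4 := wordEquiv_lt_cons k u
        rw [← hk, Equiv.apply_symm_apply] at h4
        exact absurd (hrange u ((h4.trans v.isLt).trans_le hht)) hnot
      · rfl
    · intro i hi
      exact hnot ⟨i, by rw [← σ.symm_apply_apply u, hi]⟩

/-- On a good exploration the relabelled matrix is close to the operator of the quantized tree. -/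
theorem norm_conj_matrixOperator_sub_le (hG : IsGoodExploration t lab η η' e R d)
    (hL : IsCellLabelling lab rep η δ ρ a) (hη : η' ≤ η) (ha : 0 ≤ a)
    (hM : M.IsSymm) (hK : ∀ (u : Fin h) (k : Fin K), childIndex u k < t)
    (hR : R = exploredRow hht M s R₀)
    (hs : s = placement htN (candidate (fun u j => lab (R u j)) d))
    (hσ : ∀ w : Fin t, σ (wordEquiv.symm w) = [((s w : Fin N) : ℕ)])
    {φ : EllTwo (List ℕ)} (hφ : φ ∈ finSupported (List ℕ)) {S : Finset (List ℕ)}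
    (hS : Function.support (φ : List ℕ → ℂ) ⊆ S) (hSh : ∀ v ∈ S, wordEquiv v < h) :
    ‖(permUnitary σ).symm (matrixOperator (laplacianMatrix M) (permUnitary σ φ)) -
      pwitlOperator (quantizedWeight rep d) ⟨φ, hφ⟩‖ ≤
      2 * (h * max a η' + (K * a + e)) * ∑ v ∈ S, ‖(φ : List ℕ → ℂ) v‖ := by
  rw [permUnitary_symm_matrixOperator _ _ hφ]
  refine norm_weightOperator_sub_le hφ hS (fun v _ => hasSum_extendedEntry_laplacianMatrix hM σ v)
    (fun v _ => hasSum_pwitlWeight (summable_quantizedWeight _ _ _)) fun v hv => ?_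
  have := tsum_abs_extendedEntry_sub_le hG hL hη ha hM hK hR hs hσ ⟨wordEquiv v, hSh v hv⟩
  simpa only [Equiv.symm_apply_apply] using this

end

/-! ### Probabilities of the exceptional events -/

theorem isIIDSymmetric_of_ensemble {Ω : Type*} [MeasurableSpace Ω] {P : Measure Ω}
    [IsProbabilityMeasure P] {A : (n : ℕ) → Ω → Matrix (Fin n) (Fin n) ℝ} {sigmaSq : ℝ≥0} {b : ℝ}
    {m : Measure ℝ} (hA : IsLevyKhintchineEnsemble P A sigmaSq b m) (n : ℕ) :
    IsIIDSymmetric P (A (n + 2)) (entryLaw P A n) where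
  measurable_entry := hA.measurable_entry (n + 2)
  symm ω i j := (hA.symm (n + 2) ω).apply j i
  map_eq := by
    rw [(hA.indep (n + 2)).map_fun_eq_pi_map fun p => (hA.measurable_entry _ _ _).aemeasurable]
    congr 1
    funext p
    exact map_entry_eq_entryLaw hA n p

/-- A placement of the first `t` words extends to a permutation of all words. -/
theorem exists_perm_of_placement {t N : ℕ} {s : Fin t → Fin N} (hs : Function.Injective s) :
    ∃ σ : Equiv.Perm (List ℕ), ∀ w : Fin t, σ (wordEquiv.symm w) = [((s w : Fin N) : ℕ)] := by
  let T : Set (List ℕ) := Set.range fun w : Fin t => wordEquiv.symm (w : ℕ)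
  have hT : ∀ x : T, wordEquiv x < t := by
    rintro ⟨_, w, rfl⟩
    simp
  let f : T ↪ List ℕ := ⟨fun x => [((s ⟨wordEquiv x, hT x⟩ : Fin N) : ℕ)], by
    intro x x' hxx
    simp only [List.cons.injEq, and_true] at hxx
    have h1 := hs (Fin.ext hxx)
    rw [Fin.mk.injEq] at h1
    exact Subtype.ext (wordEquiv.injective h1)⟩
  have hfin : T.Finite := Set.finite_range _
  have hlt : Cardinal.mk T < Cardinal.mk (List ℕ) :=
    (Cardinal.lt_aleph0_iff_set_finite.2 hfin).trans_le (Cardinal.aleph0_le_mk _)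
  obtain ⟨g, hg⟩ := Cardinal.extend_function_of_lt f hlt ⟨Equiv.refl _⟩
  refine ⟨g, fun w => ?_⟩
  have h1 := hg ⟨wordEquiv.symm (w : ℕ), w, rfl⟩
  rw [h1]
  change [((s ⟨wordEquiv (wordEquiv.symm (w : ℕ)), _⟩ : Fin N) : ℕ)] = _
  simp

section

variable {h N : ℕ} {μ : Measure ℝ} [IsProbabilityMeasure μ] {β : Type*} [MeasurableSpace β]
  {ζ : Fin h → Measure β} [∀ u, IsProbabilityMeasure (ζ u)]

theorem measurePreserving_entry (u : Fin h) (j : Fin N) :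
    MeasurePreserving (fun x : Fin h → (Fin N → ℝ) × β => (x u).1 j)
      (Measure.pi fun u => (Measure.pi fun _ => μ).prod (ζ u)) μ :=
  ((measurePreserving_eval (fun _ : Fin N => μ) j).comp measurePreserving_fst).comp
    (measurePreserving_eval (fun u => (Measure.pi fun _ : Fin N => μ).prod (ζ u)) u)

theorem measureReal_le_abs_entry (u : Fin h) (j : Fin N) (η : ℝ) :
    (Measure.pi fun u => (Measure.pi fun _ : Fin N => μ).prod (ζ u)).real
      {x | η ≤ |(x u).1 j|} = μ.real {x | η ≤ |x|} :=
  (measurePreserving_entry u j).measureReal_preimage (measurableSet_le_abs η).nullMeasurableSet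

theorem measureReal_le_abs_entry_and {u u' : Fin h} (huu : u ≠ u') (j : Fin N) (η η' : ℝ) :
    (Measure.pi fun u => (Measure.pi fun _ : Fin N => μ).prod (ζ u)).real
      {x | η ≤ |(x u).1 j| ∧ η' ≤ |(x u').1 j|} = μ.real {x | η ≤ |x|} * μ.real {x | η' ≤ |x|} := by
  have h1 := iIndepFun_pi (μ := fun u => (Measure.pi fun _ : Fin N => μ).prod (ζ u))
    (X := fun _ x => x.1 j) fun u => ((measurable_pi_apply j).comp measurable_fst).aemeasurable
  have h2 := (h1.indepFun huu).measure_inter_preimage_eq_mul {x | η ≤ |x|} {x | η' ≤ |x|}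
    (measurableSet_le_abs η) (measurableSet_le_abs η')
  rw [← measureReal_le_abs_entry (μ := μ) (ζ := ζ) u j η,
    ← measureReal_le_abs_entry (μ := μ) (ζ := ζ) u' j η', measureReal_def, measureReal_def,
    measureReal_def, ← ENNReal.toReal_mul]
  exact congrArg ENNReal.toReal h2

theorem measureReal_le_sum_min_le (u : Fin h) {δ e : ℝ} (hδ : 0 ≤ δ) (he : 0 < e) :
    (Measure.pi fun u => (Measure.pi fun _ : Fin N => μ).prod (ζ u)).real
      {x | e ≤ ∑ j, min |(x u).1 j| δ} ≤ N * (∫ x, min |x| δ ∂μ) / e := by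
  have hint : Integrable (fun x : ℝ => min |x| δ) μ := by
    refine Integrable.of_bound (C := δ) (by fun_prop) (ae_of_all _ fun x => ?_)
    rw [Real.norm_of_nonneg (le_min (abs_nonneg _) hδ)]
    exact min_le_right _ _
  have hint' : ∀ j : Fin N, Integrable (fun x : Fin h → (Fin N → ℝ) × β => min |(x u).1 j| δ)
      (Measure.pi fun u => (Measure.pi fun _ : Fin N => μ).prod (ζ u)) := fun j =>
    (measurePreserving_entry u j).integrable_comp_of_integrable hint
  have h1 := mul_meas_ge_le_integral_of_nonneg
    (μ := Measure.pi fun u => (Measure.pi fun _ : Fin N => μ).prod (ζ u))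
    (f := fun x => ∑ j, min |(x u).1 j| δ)
    (ae_of_all _ fun x => Finset.sum_nonneg fun j _ => le_min (abs_nonneg _) hδ)
    (integrable_finsetSum _ fun j _ => hint' j) e
  rw [integral_finsetSum _ fun j _ => hint' j] at h1
  have h2 : ∀ j : Fin N, ∫ x, min |(x u).1 j| δ
      ∂(Measure.pi fun u => (Measure.pi fun _ : Fin N => μ).prod (ζ u)) = ∫ x, min |x| δ ∂μ := by
    intro j
    have h3 := integral_map (f := fun x : ℝ => min |x| δ)
      (measurePreserving_entry (ζ := ζ) (μ := μ) u j).aemeasurable (by fun_prop)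
    rw [(measurePreserving_entry (ζ := ζ) (μ := μ) u j).map_eq] at h3
    exact h3.symm
  simp only [h2, Finset.sum_const, Finset.card_univ, Fintype.card_fin, nsmul_eq_mul] at h1
  rw [le_div_iff₀ he, mul_comm]
  exact h1

end

/-- Union bound for the exceptional explorations. The four terms account for two large entries in one
column, large entries at the reserved vertices, multiplicities that cannot be reproduced, and unlabelled
entries that are either huge or have a large sum. -/
theorem measureReal_setOf_not_isGoodExploration_le {h N K r : ℕ} {μ : Measure ℝ}
    [IsProbabilityMeasure μ] {lab : ℝ → Fin (r + 1)} (hlab : Measurable lab)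
    {rep : Fin (r + 1) → ℝ} {η η' δ ρ a e c : ℝ}
    (hL : IsCellLabelling lab rep η δ ρ a) (hδ : 0 ≤ δ) (he : 0 < e)
    {ν : Fin h → Measure (Fin K → Fin (r + 1))} [∀ u, IsProbabilityMeasure (ν u)]
    (hc : ∀ u, countDiscrepancy N μ lab (ν u) ≤ c) {t : ℕ} (htN : t ≤ N) :
    (Measure.pi fun u => (Measure.pi fun _ : Fin N => μ).prod (drawLaw N (ν u))).real
      {x | ¬IsGoodExploration t lab η η' e (fun u => (x u).1) fun u => drawnLabels lab (x u)} ≤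
    h * (h * (N * (μ.real {x | η ≤ |x|} * μ.real {x | η' ≤ |x|}))) +
      h * (t * μ.real {x | η' ≤ |x|}) + h * c +
      h * (N * μ.real {x | ρ ≤ |x|} + N * (∫ x, min |x| δ ∂μ) / e) := by
  set Q := Measure.pi fun u => (Measure.pi fun _ : Fin N => μ).prod (drawLaw N (ν u)) with hQ
  let B₁ : Set (Fin h → (Fin N → ℝ) × ((Fin N → Fin (r + 1)) → Fin K → Fin (r + 1))) :=
    ⋃ u ∈ (Finset.univ : Finset (Fin h)), ⋃ u' ∈ (Finset.univ : Finset (Fin h)),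
      ⋃ j ∈ (Finset.univ : Finset (Fin N)), {x | u ≠ u' ∧ η ≤ |(x u).1 j| ∧ η' ≤ |(x u').1 j|}
  let B₂ : Set (Fin h → (Fin N → ℝ) × ((Fin N → Fin (r + 1)) → Fin K → Fin (r + 1))) :=
    ⋃ u ∈ (Finset.univ : Finset (Fin h)), ⋃ j ∈ (Finset.univ : Finset (Fin t)),
      {x | η' ≤ |(x u).1 (Fin.castLE htN j)|}
  let B₃ : Set (Fin h → (Fin N → ℝ) × ((Fin N → Fin (r + 1)) → Fin K → Fin (r + 1))) :=
    ⋃ u ∈ (Finset.univ : Finset (Fin h)),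
      {x | (labelCount fun j => lab ((x u).1 j)) ≠ labelCount (drawnLabels lab (x u))}
  let B₄ : Set (Fin h → (Fin N → ℝ) × ((Fin N → Fin (r + 1)) → Fin K → Fin (r + 1))) :=
    ⋃ u ∈ (Finset.univ : Finset (Fin h)),
      ((⋃ j ∈ (Finset.univ : Finset (Fin N)), {x | ρ ≤ |(x u).1 j|}) ∪
        {x | e ≤ ∑ j, min |(x u).1 j| δ})
  have hsub : {x | ¬IsGoodExploration t lab η η' e (fun u => (x u).1)
      fun u => drawnLabels lab (x u)} ⊆ B₁ ∪ B₂ ∪ B₃ ∪ B₄ := by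
    intro x hx
    by_contra hnot
    simp only [B₁, B₂, B₃, B₄, Set.mem_union, Set.mem_iUnion, Set.mem_ofPred_eq, Finset.mem_univ,
      exists_true_left, not_or, not_exists, not_and, not_le, ne_eq, not_not] at hnot
    obtain ⟨⟨⟨h1, h2⟩, h3⟩, h4⟩ := hnot
    refine hx ⟨fun u u' j huu hj => h1 u u' j huu hj, fun u j hj => h2 u ⟨j, hj⟩, h3, fun u => ?_⟩
    obtain ⟨h5, h6⟩ := h4 u
    refine (Finset.sum_le_sum fun j _ => ?_).trans h6.le
    split_ifs with h0
    · rcases hL.of_eq_zero _ h0 with h7 | h7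
      · rw [min_eq_left h7]
      · exact absurd h7 (not_le.2 (h5 j))
    · exact le_min (abs_nonneg _) hδ
  have hsum : ∀ (k : ℕ) (F : Fin k → Set (Fin h → (Fin N → ℝ) ×
      ((Fin N → Fin (r + 1)) → Fin K → Fin (r + 1)))) (z : ℝ), (∀ i, Q.real (F i) ≤ z) →
      Q.real (⋃ i ∈ (Finset.univ : Finset (Fin k)), F i) ≤ k * z := by
    intro k F z hz
    refine (measureReal_biUnion_finset_le _ _).trans ((Finset.sum_le_sum fun i _ => hz i).trans ?_)
    simp
  have hb1 : Q.real B₁ ≤ h * (h * (N * (μ.real {x | η ≤ |x|} * μ.real {x | η' ≤ |x|}))) := by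
    refine hsum _ _ _ fun u => hsum _ _ _ fun u' => hsum _ _ _ fun j => ?_
    by_cases huu : u = u'
    · simp only [huu, ne_eq, not_true_eq_false, false_and, Set.ofPred_false, measureReal_empty]
      positivity
    · simp only [ne_eq, huu, not_false_eq_true, true_and]
      exact (measureReal_le_abs_entry_and huu j η η').le
  have hb2 : Q.real B₂ ≤ h * (t * μ.real {x | η' ≤ |x|}) :=
    hsum _ _ _ fun u => hsum _ _ _ fun j => (measureReal_le_abs_entry u _ η').le
  have hb3 : Q.real B₃ ≤ h * c := by
    refine hsum _ _ _ fun u => ?_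
    have hmeas : MeasurableSet {x : (Fin N → ℝ) × ((Fin N → Fin (r + 1)) → Fin K → Fin (r + 1)) |
        (labelCount fun j => lab (x.1 j)) ≠ labelCount (drawnLabels lab x)} := by
      have h1 : Measurable fun x : (Fin N → ℝ) × ((Fin N → Fin (r + 1)) → Fin K → Fin (r + 1)) =>
          labelCount fun j => lab (x.1 j) := measurable_labelCount_comp
        (measurable_pi_lambda _ fun j => hlab.comp ((measurable_pi_apply j).comp measurable_fst))
      exact (measurableSet_eq_fun h1
        (measurable_labelCount_comp (measurable_drawnLabels hlab))).compl
    have h1 := (measurePreserving_eval (fun u => (Measure.pi fun _ : Fin N => μ).prod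
      (drawLaw N (ν u))) u).measureReal_preimage hmeas.nullMeasurableSet
    exact (h1.le.trans (measureReal_labelCount_ne_le hlab)).trans (hc u)
  have hb4 : Q.real B₄ ≤ h * (N * μ.real {x | ρ ≤ |x|} + N * (∫ x, min |x| δ ∂μ) / e) := by
    refine hsum _ _ _ fun u => (measureReal_union_le _ _).trans (add_le_add ?_ ?_)
    · exact hsum _ _ _ fun j => (measureReal_le_abs_entry u _ ρ).le
    · exact measureReal_le_sum_min_le u hδ he
  refine (measureReal_mono hsub).trans ?_
  have h1 := measureReal_union_le (μ := Q) (B₁ ∪ B₂ ∪ B₃) B₄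
  have h2 := measureReal_union_le (μ := Q) (B₁ ∪ B₂) B₃
  have h3 := measureReal_union_le (μ := Q) B₁ B₂
  linarith

/-! ### Comparison of expectations -/

section

variable {E : Type*} [NormedAddCommGroup E]
  {X : Type*} [MeasurableSpace X]
  {Q : Measure X} [IsProbabilityMeasure Q] {D : Type*} [Fintype D] [MeasurableSpace D]
  [MeasurableSingletonClass D]

/-- A random vector that is close to a function of a discrete random variable outside an exceptional
set has almost the same Lipschitz averages. The set `B` is not assumed to be measurable. -/
theorem abs_integral_sub_sum_le {U : X → E} (hU : AEStronglyMeasurable U Q) {d : X → D}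
    (hd : Measurable d) {G : D → E} {B : Set X} {κ : ℝ} (hκ : 0 ≤ κ)
    (hB : ∀ x ∉ B, ‖U x - G (d x)‖ ≤ κ) {f : E → ℝ} {C : ℝ≥0} (hf : LipschitzWith C f) {M : ℝ}
    (hM : ∀ x, |f x| ≤ M) :
    |∫ x, f (U x) ∂Q - ∑ z, Q.real {x | d x = z} * f (G z)| ≤ C * κ + 2 * M * Q.real B := by
  have hM0 : 0 ≤ M := (abs_nonneg _).trans (hM 0)
  have h1 : ∫ x, f (G (d x)) ∂Q = ∑ z, Q.real {x | d x = z} * f (G z) := by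
    have hp : IsProbabilityMeasure (Q.map d) := Measure.isProbabilityMeasure_map hd.aemeasurable
    rw [← integral_map (f := fun z => f (G z)) hd.aemeasurable
      (measurable_of_finite _).aestronglyMeasurable, integral_fintype]
    · refine Finset.sum_congr rfl fun z _ => ?_
      rw [measureReal_def, Measure.map_apply hd (measurableSet_singleton z), smul_eq_mul]
      rfl
    · exact Integrable.of_finite
  have hint1 : Integrable (fun x => f (U x)) Q :=
    Integrable.of_bound (C := M) (hf.continuous.comp_aestronglyMeasurable hU)
      (ae_of_all _ fun x => hM _)
  have hint2 : Integrable (fun x => f (G (d x))) Q :=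
    Integrable.of_bound (C := M) (((measurable_of_finite fun z => f (G z)).comp hd).aestronglyMeasurable)
      (ae_of_all _ fun x => hM _)
  have hBm : MeasurableSet (toMeasurable Q B) := measurableSet_toMeasurable Q B
  rw [← h1, ← integral_sub hint1 hint2, ← Real.norm_eq_abs]
  have hint3 : Integrable (fun x => C * κ + (toMeasurable Q B).indicator (fun _ => 2 * M) x) Q :=
    (integrable_const _).add ((integrable_const _).indicator hBm)
  refine (norm_integral_le_of_norm_le hint3 (ae_of_all _ fun x => ?_)).trans (le_of_eq ?_)
  · rw [Real.norm_eq_abs]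
    by_cases hx : x ∈ toMeasurable Q B
    · rw [Set.indicator_of_mem hx]
      have h2 := (abs_sub (f (U x)) (f (G (d x)))).trans (add_le_add (hM _) (hM _))
      have : 0 ≤ C * κ := by positivity
      linarith
    · rw [Set.indicator_of_notMem hx, add_zero, ← Real.dist_eq]
      refine (hf.dist_le_mul _ _).trans ?_
      rw [dist_eq_norm]
      have := hB x fun h => hx (subset_toMeasurable Q B h)
      gcongr
  · rw [integral_add (integrable_const _) ((integrable_const _).indicator hBm), integral_const,
      probReal_univ, one_smul, integral_indicator_const _ hBm, smul_eq_mul, measureReal_def,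
      measure_toMeasurable, ← measureReal_def]
    ring

/-- Two random vectors have almost the same law if they are close to the same function of discrete
random variables, the laws of which are close in total variation. -/
theorem abs_integral_sub_integral_le {X' : Type*} [MeasurableSpace X'] {Q' : Measure X'}
    [IsProbabilityMeasure Q'] {U : X → E} (hU : AEStronglyMeasurable U Q) {U' : X' → E}
    (hU' : AEStronglyMeasurable U' Q') {d : X → D} (hd : Measurable d) {d' : X' → D}
    (hd' : Measurable d') {G : D → E} {B : Set X} {B' : Set X'} {κ τ : ℝ} (hκ : 0 ≤ κ)
    (hB : ∀ x ∉ B, ‖U x - G (d x)‖ ≤ κ) (hB' : ∀ x ∉ B', ‖U' x - G (d' x)‖ ≤ κ)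
    (hτ : ∑ z, |Q.real {x | d x = z} - Q'.real {x | d' x = z}| ≤ τ)
    {f : E → ℝ} {C : ℝ≥0} (hf : LipschitzWith C f) {M : ℝ} (hM : ∀ x, |f x| ≤ M) :
    |∫ x, f (U x) ∂Q - ∫ x, f (U' x) ∂Q'| ≤
      2 * (C * κ) + M * (2 * Q.real B + 2 * Q'.real B' + τ) := by
  have hM0 : 0 ≤ M := (abs_nonneg _).trans (hM 0)
  have h1 := abs_integral_sub_sum_le hU hd hκ hB hf hM
  have h2 := abs_integral_sub_sum_le hU' hd' hκ hB' hf hM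
  have h3 : |∑ z, Q.real {x | d x = z} * f (G z) - ∑ z, Q'.real {x | d' x = z} * f (G z)| ≤ τ * M := by
    rw [← Finset.sum_sub_distrib]
    refine (Finset.abs_sum_le_sum_abs _ _).trans ?_
    have h4 := mul_le_mul_of_nonneg_right hτ hM0
    rw [Finset.sum_mul] at h4
    refine le_trans (Finset.sum_le_sum fun z _ => ?_) h4
    rw [← sub_mul, abs_mul]
    gcongr
    exact hM _
  rw [abs_le] at h1 h2 h3 ⊢
  constructor <;> linarith

end

/-! ### Measurability of the operators -/

section

variable {Ω' : Type*} [MeasurableSpace Ω'] {P' : Measure Ω'} {m : Measure ℝ}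
  {y : List ℕ → ℕ → Ω' → ℝ}

theorem aestronglyMeasurable_conj_matrixOperator {X : Type*} [MeasurableSpace X] {Q : Measure X}
    {N : ℕ} {M : X → Matrix (Fin N) (Fin N) ℝ} (hM : ∀ i j, Measurable fun x => M x i j)
    {σ : X → Equiv.Perm (List ℕ)} (hσ : ∀ u z, MeasurableSet {x | σ x u = z})
    {φ : EllTwo (List ℕ)} (hφ : φ ∈ finSupported (List ℕ)) :
    AEStronglyMeasurable (fun x => (permUnitary (σ x)).symm (matrixOperator (laplacianMatrix (M x))
      (permUnitary (σ x) φ))) Q := by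
  simp only [permUnitary_symm_matrixOperator _ _ hφ]
  refine aestronglyMeasurable_weightOperator (fun u v => ?_) (fun v => ae_of_all _ fun x => ?_) hφ
  · refine Measurable.aemeasurable ?_
    refine Finset.measurable_fun_sum _ fun i _ => Finset.measurable_fun_sum _ fun j _ => ?_
    refine Measurable.ite ((hσ u _).inter (hσ v _)) ?_ measurable_const
    simp only [laplacianMatrix, Matrix.sub_apply, Matrix.diagonal_apply]
    refine (hM i j).sub ?_
    split_ifs
    · exact Finset.measurable_fun_sum _ fun k _ => hM i k
    · exact measurable_const
  · exact memℓp_of_hasSum (w := fun u v => extendedEntry (laplacianMatrix (M x)) (σ x u) (σ x v))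
      ((Equiv.hasSum_iff (σ x) (f := fun z => extendedEntry _ z (σ x v))).2 (hasSum_extendedEntry _ _))

theorem aestronglyMeasurable_pwitlOperator (hy : IsPWIT P' m y) (hm : HasTruncatedMoment m)
    {φ : EllTwo (List ℕ)} (hφ : φ ∈ finSupported (List ℕ)) :
    AEStronglyMeasurable (fun ω => pwitlOperator (fun v k => y v k ω) ⟨φ, hφ⟩) P' := by
  have hparent : ∀ v, Measurable fun ω => parentWeight (fun v k => y v k ω) v := by
    intro v
    cases v with
    | nil => exact measurable_const
    | cons k u => exact hy.measurable u k
  refine aestronglyMeasurable_weightOperator (fun u v => ?_) (fun v => ?_) hφ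
  · unfold pwitlWeight
    split_ifs with h1 h2 h3
    · unfold loopWeight
      refine (hparent v).neg.aemeasurable.sub ?_
      refine aemeasurable_of_tendsto_metrizable_ae atTop
        (f := fun (n : ℕ) ω => ∑ k ∈ Finset.range n, y v k ω)
        (fun n => (Finset.measurable_fun_sum _ fun k _ => hy.measurable v k).aemeasurable) ?_
      filter_upwards [ae_summable_abs hy hm v] with ω hω
      exact hω.of_abs.hasSum.tendsto_sum_nat
    · exact (hparent u).aemeasurable
    · exact (hparent v).aemeasurable
    · exact aemeasurable_const
  · filter_upwards [ae_summable_abs hy hm v] with ω hω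
    exact memℓp_of_hasSum (hasSum_pwitlWeight hω.of_abs)

/-! ### The joint laws of the labels -/

theorem measureReal_treeLabels_eq [IsProbabilityMeasure P'] (hy : IsPWIT P' m y) {h K r : ℕ}
    {lab : ℝ → Fin (r + 1)} (hlab : Measurable lab) (d : Fin h → Fin K → Fin (r + 1)) :
    P'.real {ω | (fun u : Fin h => treeLabels K lab fun k => y (wordEquiv.symm u) k ω) = d} =
      ∏ u : Fin h, (P'.map fun ω => treeLabels K lab fun k => y (wordEquiv.symm (u : ℕ)) k ω).real {d u} := by
  have hinj : Function.Injective fun u : Fin h => wordEquiv.symm (u : ℕ) := fun u u' huu =>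
    Fin.ext (wordEquiv.symm.injective huu)
  have h1 := (hy.indep.precomp hinj).comp (fun _ x => treeLabels K lab x)
    fun _ => measurable_treeLabels_pi hlab
  have h2 := h1.measure_inter_preimage_eq_mul Finset.univ (sets := fun u => {d u})
    fun u _ => measurableSet_singleton _
  have e : {ω | (fun u : Fin h => treeLabels K lab fun k => y (wordEquiv.symm u) k ω) = d} =
      ⋂ u ∈ (Finset.univ : Finset (Fin h)), ((fun x => treeLabels K lab x) ∘
        (fun ω k => y (wordEquiv.symm (u : ℕ)) k ω)) ⁻¹' {d u} := by
    ext ω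
    simp only [Set.mem_ofPred_eq, Set.mem_iInter, Finset.mem_univ, true_imp_iff, Set.mem_preimage,
      Set.mem_singleton_iff, Function.comp_apply]
    exact funext_iff
  rw [measureReal_def, e]
  refine (congrArg ENNReal.toReal h2).trans ?_
  rw [ENNReal.toReal_prod]
  refine Finset.prod_congr rfl fun u _ => ?_
  rw [measureReal_def, Measure.map_apply (measurable_treeLabels hy hlab _) (measurableSet_singleton _)]
  rfl

theorem measureReal_drawnLabels_eq {h N K r : ℕ} {μ : Measure ℝ} [IsProbabilityMeasure μ]
    {lab : ℝ → Fin (r + 1)} {ν : Fin h → Measure (Fin K → Fin (r + 1))}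
    [∀ u, IsProbabilityMeasure (ν u)] (d : Fin h → Fin K → Fin (r + 1)) :
    (Measure.pi fun u => (Measure.pi fun _ : Fin N => μ).prod (drawLaw N (ν u))).real
      {x | (fun u => drawnLabels lab (x u)) = d} =
    ∏ u, ((Measure.pi fun _ : Fin N => μ).prod (drawLaw N (ν u))).real
      {x | drawnLabels lab x = d u} := by
  have e : {x : Fin h → (Fin N → ℝ) × ((Fin N → Fin (r + 1)) → Fin K → Fin (r + 1)) |
      (fun u => drawnLabels lab (x u)) = d} = Set.univ.pi fun u => {x | drawnLabels lab x = d u} := by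
    ext x
    simp only [Set.mem_ofPred_eq, Set.mem_univ_pi]
    exact funext_iff
  rw [measureReal_def, e, Measure.pi_pi, ENNReal.toReal_prod]
  rfl

/-- The labels drawn along the matrix and the labels of the tree, for the first `h` words jointly, are
close in total variation: both families are independent over the words. -/
theorem sum_abs_jointLabels_sub_le [IsProbabilityMeasure P'] (hy : IsPWIT P' m y) {h N K r : ℕ}
    {μ : Measure ℝ} [IsProbabilityMeasure μ] {lab : ℝ → Fin (r + 1)} (hlab : Measurable lab)
    {ν : Fin h → Measure (Fin K → Fin (r + 1))} [∀ u, IsProbabilityMeasure (ν u)]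
    (hν : ∀ u : Fin h, ν u = P'.map fun ω => treeLabels K lab fun k => y (wordEquiv.symm u) k ω)
    {c : ℝ} (hc : ∀ u, countDiscrepancy N μ lab (ν u) ≤ c) :
    ∑ d : Fin h → Fin K → Fin (r + 1), |(Measure.pi fun u => (Measure.pi fun _ : Fin N => μ).prod
      (drawLaw N (ν u))).real {x | (fun u => drawnLabels lab (x u)) = d} -
      P'.real {ω | (fun u : Fin h => treeLabels K lab fun k => y (wordEquiv.symm u) k ω) = d}| ≤
    h * (2 * c) := by
  simp only [measureReal_treeLabels_eq hy hlab, measureReal_drawnLabels_eq, ← hν]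
  refine (sum_abs_prod_sub_prod_le
    (fun (u : Fin h) (z : Fin K → Fin (r + 1)) =>
      ((Measure.pi fun _ : Fin N => μ).prod (drawLaw N (ν u))).real {x | drawnLabels lab x = z})
    (fun u z => (ν u).real {z}) (fun _ _ => measureReal_nonneg) (fun _ _ => measureReal_nonneg)
    (fun u => ?_) fun u => sum_measureReal_singleton_eq_one).trans ?_
  · have hm := measurable_drawnLabels (N := N) (K := K) hlab
    have hp : IsProbabilityMeasure
        (((Measure.pi fun _ : Fin N => μ).prod (drawLaw N (ν u))).map (drawnLabels lab)) :=
      Measure.isProbabilityMeasure_map hm.aemeasurable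
    rw [← sum_measureReal_singleton_eq_one
      (ν := ((Measure.pi fun _ : Fin N => μ).prod (drawLaw N (ν u))).map (drawnLabels lab))]
    refine Finset.sum_congr rfl fun z _ => ?_
    rw [measureReal_def (Measure.map _ _), Measure.map_apply hm (measurableSet_singleton z)]
    rfl
  · refine (Finset.sum_le_sum fun u _ => (sum_abs_drawnLabels_sub_le hlab).trans
      (mul_le_mul_of_nonneg_left (hc u) zero_le_two)).trans ?_
    simp

/-! ### Coupling at a fixed size -/

/-- Operators `U` and `U'` have almost the same law on the vectors supported on the first `h` words,
as tested by bounded Lipschitz functions. -/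
def AlmostSameLaw {X : Type*} [MeasurableSpace X] (Q : Measure X)
    (U : EllTwo (List ℕ) → X → EllTwo (List ℕ)) (P' : Measure Ω') (y : List ℕ → ℕ → Ω' → ℝ)
    (h : ℕ) (ε : ℝ) : Prop :=
  ∀ (φ : EllTwo (List ℕ)) (hφ : φ ∈ finSupported (List ℕ)) (S : Finset (List ℕ)),
    Function.support (φ : List ℕ → ℂ) ⊆ S → (∀ v ∈ S, wordEquiv v < h) →
    ∀ (f : EllTwo (List ℕ) → ℝ) (C : ℝ≥0) (B : ℝ), LipschitzWith C f → (∀ x, |f x| ≤ B) →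
    |∫ x, f (U φ x) ∂Q - ∫ ω, f (pwitlOperator (fun v k => y v k ω) ⟨φ, hφ⟩) ∂P'| ≤
      ε * (C * ∑ v ∈ S, ‖(φ : List ℕ → ℂ) v‖ + B)

theorem measurable_placement_comp {h t N K r : ℕ} {lab : ℝ → Fin (r + 1)} (hlab : Measurable lab)
    (htN : t ≤ N) :
    Measurable fun x : Fin h → (Fin N → ℝ) × ((Fin N → Fin (r + 1)) → Fin K → Fin (r + 1)) =>
      placement htN (candidate (t := t) (fun u j => lab ((x u).1 j))
        fun u => drawnLabels lab (x u)) := by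
  have h1 : Measurable fun x : Fin h → (Fin N → ℝ) ×
      ((Fin N → Fin (r + 1)) → Fin K → Fin (r + 1)) => ((fun u j => lab ((x u).1 j) :
      Fin h → Fin N → Fin (r + 1)), (fun u => drawnLabels lab (x u) : Fin h → Fin K → Fin (r + 1))) := by
    refine Measurable.prodMk (measurable_pi_lambda _ fun u => measurable_pi_lambda _ fun j => ?_)
      (measurable_pi_lambda _ fun u => ?_)
    · exact hlab.comp ((measurable_pi_apply j).comp (measurable_fst.comp (measurable_pi_apply u)))
    · exact (measurable_drawnLabels hlab).comp (measurable_pi_apply u)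
  exact (measurable_of_finite fun p : (Fin h → Fin N → Fin (r + 1)) ×
    (Fin h → Fin K → Fin (r + 1)) => placement htN (candidate (t := t) p.1 p.2)).comp h1

/-- Relabelling of a matrix of fixed size. The bijection places the first `t` words along an exploration
driven by auxiliary rows and label draws. The precision `ε` has to dominate the deterministic error on
good explorations, and the sum of the probabilities `θ` and `θ'` of the exceptional events in the matrix
and in the tree, counted twice, and of the distance between the laws of the labels. -/
theorem exists_coupling [IsProbabilityMeasure P'] (hy : IsPWIT P' m y) (hm : HasTruncatedMoment m)
    {Ω : Type*} [MeasurableSpace Ω] {P : Measure Ω} [IsProbabilityMeasure P] {N : ℕ}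
    {M : Ω → Matrix (Fin N) (Fin N) ℝ} {μ : Measure ℝ} [IsProbabilityMeasure μ]
    (hM : IsIIDSymmetric P M μ) {h t K r : ℕ} {lab : ℝ → Fin (r + 1)} (hlab : Measurable lab)
    {rep : Fin (r + 1) → ℝ} {η η' δ ρ a e c θ θ' : ℝ} (hL : IsCellLabelling lab rep η δ ρ a)
    (hη : η' ≤ η) (hδ : 0 ≤ δ) (ha : 0 ≤ a) (he : 0 < e) (hht : h ≤ t) (htN : t ≤ N) (ht : 0 < t)
    (hK : ∀ (u : Fin h) (k : Fin K), childIndex u k < t)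
    (hc : ∀ u : Fin h, countDiscrepancy N μ lab
      (P'.map fun ω => treeLabels K lab fun k => y (wordEquiv.symm u) k ω) ≤ c)
    (hθ : h * (h * (N * (μ.real {x | η ≤ |x|} * μ.real {x | η' ≤ |x|}))) +
      h * (t * μ.real {x | η' ≤ |x|}) + h * c +
      h * (N * μ.real {x | ρ ≤ |x|} + N * (∫ x, min |x| δ ∂μ) / e) ≤ θ)
    (hθ' : P'.real {ω | ∃ v, wordEquiv v < h ∧ ((∃ k ≥ K, η ≤ |y v k ω|) ∨ (∃ k, ρ ≤ |y v k ω|) ∨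
      ENNReal.ofReal e ≤ ∑' k, ENNReal.ofReal (min |y v k ω| δ))} ≤ θ')
    {ε : ℝ} (hε₁ : 4 * (h * max a η' + 2 * (K * a + e)) ≤ ε)
    (hε₂ : 2 * θ + 2 * θ' + h * (2 * c) ≤ ε) :
    ∃ (W : Type) (_ : MeasurableSpace W) (ν : Measure W) (_ : IsProbabilityMeasure ν)
      (σ : Ω × W → Equiv.Perm (List ℕ)), (∀ u z, MeasurableSet {q | σ q u = z}) ∧
      (∀ q, σ q [] = [0]) ∧
      AlmostSameLaw (P.prod ν) (fun φ q => (permUnitary (σ q)).symm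
        (matrixOperator (laplacianMatrix (M q.1)) (permUnitary (σ q) φ))) P' y h ε := by
  have hprob : ∀ u : Fin h, IsProbabilityMeasure
      (P'.map fun ω => treeLabels K lab fun k => y (wordEquiv.symm (u : ℕ)) k ω) := fun u =>
    Measure.isProbabilityMeasure_map (measurable_treeLabels hy hlab _).aemeasurable
  set νt : Fin h → Measure (Fin K → Fin (r + 1)) := fun u =>
    P'.map fun ω => treeLabels K lab fun k => y (wordEquiv.symm (u : ℕ)) k ω with hνt
  let f : (Fin h → (Fin N → ℝ) × ((Fin N → Fin (r + 1)) → Fin K → Fin (r + 1))) → Fin t → Fin N :=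
    fun x => placement htN (candidate (fun u j => lab ((x u).1 j)) fun u => drawnLabels lab (x u))
  obtain ⟨g, hg, hfix, hpres⟩ := exists_exploration hM hht htN (fun u => drawLaw N (νt u)) (f := f)
    (measurable_placement_comp hlab htN) (fun x => placement_injective _ _) (by
      intro x x' w hx
      refine placement_congr fun w' hw' => candidate_congr fun u hu => ?_
      rw [hx u (hu.trans_le hw')]
      exact ⟨rfl, rfl⟩)
  have hgs : ∀ q, Function.Injective (g q) := fun q => by
    rw [← hfix q]
    exact placement_injective _ _
  have hext : ∀ s : Fin t → Fin N, ∃ σ : Equiv.Perm (List ℕ), Function.Injective s →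
      ∀ w : Fin t, σ (wordEquiv.symm w) = [((s w : Fin N) : ℕ)] := fun s => by
    by_cases hs : Function.Injective s
    · obtain ⟨σ, hσ⟩ := exists_perm_of_placement hs
      exact ⟨σ, fun _ => hσ⟩
    · exact ⟨1, fun h => absurd h hs⟩
  choose τ hτ using hext
  have hσ : ∀ q (w : Fin t), τ (g q) (wordEquiv.symm w) = [((g q w : Fin N) : ℕ)] := fun q =>
    hτ _ (hgs q)
  have hσm : ∀ u z, MeasurableSet {q | τ (g q) u = z} := fun u z =>
    hg (Set.toFinite {s | τ s u = z}).measurableSet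
  refine ⟨_, inferInstance, Measure.pi fun u => (Measure.pi fun _ : Fin N => μ).prod
    (drawLaw N (νt u)), inferInstance, fun q => τ (g q), hσm, fun q => ?_, ?_⟩
  · have h0 := hσ q ⟨0, ht⟩
    rw [wordEquiv_symm_zero] at h0
    rw [h0, ← hfix q]
    have hnone : candidate (t := t) (fun u j => lab ((explore hht (M q.1) (g q) q.2 u).1 j))
        (fun u => drawnLabels lab (explore hht (M q.1) (g q) q.2 u)) ⟨0, ht⟩ = none := by
      by_contra hne
      obtain ⟨j, hj⟩ := Option.ne_none_iff_exists'.1 hne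
      obtain ⟨u, k, huk, -⟩ := exists_of_candidate_eq_some hj
      have := lt_childIndex u k
      simp only at huk
      omega
    simp only [f, placement_of_none hnone]
    rfl
  · intro φ hφ S hS hSh F C B hF hB
    have hsum0 : 0 ≤ ∑ v ∈ S, ‖(φ : List ℕ → ℂ) v‖ := Finset.sum_nonneg fun _ _ => norm_nonneg _
    have hB0 : 0 ≤ B := (abs_nonneg _).trans (hB 0)
    have hmax : 0 ≤ h * max a η' := mul_nonneg (Nat.cast_nonneg _) (le_max_of_le_left ha)
    have hKa : 0 ≤ K * a + e := by positivity
    let D : Ω × (Fin h → (Fin N → ℝ) × ((Fin N → Fin (r + 1)) → Fin K → Fin (r + 1))) →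
        Fin h → Fin K → Fin (r + 1) := fun q u => drawnLabels lab (explore hht (M q.1) (g q) q.2 u)
    let D' : Ω' → Fin h → Fin K → Fin (r + 1) := fun ω u =>
      treeLabels K lab fun k => y (wordEquiv.symm u) k ω
    have hDm0 : Measurable fun (x : Fin h → (Fin N → ℝ) ×
        ((Fin N → Fin (r + 1)) → Fin K → Fin (r + 1))) u => drawnLabels lab (x u) :=
      measurable_pi_lambda _ fun u => (measurable_drawnLabels hlab).comp (measurable_pi_apply u)
    have hD : Measurable D := hDm0.comp hpres.measurable
    have hD' : Measurable D' := measurable_pi_lambda _ fun u => measurable_treeLabels hy hlab _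
    let Bad : Set (Ω × (Fin h → (Fin N → ℝ) × ((Fin N → Fin (r + 1)) → Fin K → Fin (r + 1)))) :=
      {q | ¬IsGoodExploration t lab η η' e (fun u => (explore hht (M q.1) (g q) q.2 u).1) (D q)}
    let Bad' : Set Ω' := {ω | ∃ v, wordEquiv v < h ∧ ((∃ k ≥ K, η ≤ |y v k ω|) ∨
      (∃ k, ρ ≤ |y v k ω|) ∨ ENNReal.ofReal e ≤ ∑' k, ENNReal.ofReal (min |y v k ω| δ))}
    have hBad : (P.prod (Measure.pi fun u => (Measure.pi fun _ : Fin N => μ).prod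
        (drawLaw N (νt u)))).real Bad ≤ θ := by
      refine le_trans ?_ ((measureReal_setOf_not_isGoodExploration_le hlab hL hδ he hc htN).trans hθ)
      exact ENNReal.toReal_mono (measure_ne_top _ _) (hpres.measure_preimage_le _)
    have key := abs_integral_sub_integral_le
      (Q := P.prod (Measure.pi fun u => (Measure.pi fun _ : Fin N => μ).prod (drawLaw N (νt u))))
      (Q' := P') (U := fun q => (permUnitary (τ (g q))).symm
        (matrixOperator (laplacianMatrix (M q.1)) (permUnitary (τ (g q)) φ)))
      (U' := fun ω => pwitlOperator (fun v k => y v k ω) ⟨φ, hφ⟩) (d := D) (d' := D')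
      (G := fun d => pwitlOperator (quantizedWeight rep d) ⟨φ, hφ⟩) (B := Bad) (B' := Bad')
      (κ := 2 * (h * max a η' + 2 * (K * a + e)) * ∑ v ∈ S, ‖(φ : List ℕ → ℂ) v‖)
      (τ := h * (2 * c))
      (aestronglyMeasurable_conj_matrixOperator (fun i j => (hM.measurable_entry i j).comp measurable_fst)
        hσm hφ) (aestronglyMeasurable_pwitlOperator hy hm hφ) hD hD' (by positivity) ?_ ?_ ?_ hF hB
    · refine key.trans ?_
      have hθ'' : P'.real Bad' ≤ θ' := hθ'
      have h2 : 2 * (C * (2 * (h * max a η' + 2 * (K * a + e)) * ∑ v ∈ S, ‖(φ : List ℕ → ℂ) v‖)) ≤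
          ε * (C * ∑ v ∈ S, ‖(φ : List ℕ → ℂ) v‖) := by
        have h3 : 0 ≤ (C : ℝ) * ∑ v ∈ S, ‖(φ : List ℕ → ℂ) v‖ := by positivity
        have h4 := mul_le_mul_of_nonneg_right hε₁ h3
        linarith
      have h5 : 2 * (P.prod (Measure.pi fun u => (Measure.pi fun _ : Fin N => μ).prod
        (drawLaw N (νt u)))).real Bad + 2 * P'.real Bad' + h * (2 * c) ≤ ε := by linarith
      have h6 := mul_le_mul_of_nonneg_left h5 hB0
      linarith
    · intro q hq
      have hgood := not_not.1 hq
      refine (norm_conj_matrixOperator_sub_le (htN := htN) hgood hL hη ha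
        (Matrix.IsSymm.ext fun i j => hM.symm q.1 j i) hK (hht := hht) (R₀ := fun u => (q.2 u).1)
        (s := g q) rfl (hfix q).symm (hσ q) hφ hS hSh).trans ?_
      gcongr
      linarith
    · intro ω hω
      have hω' : ∀ v, wordEquiv v < h → (¬∃ k ≥ K, η ≤ |y v k ω|) ∧ (¬∃ k, ρ ≤ |y v k ω|) ∧
          ¬ENNReal.ofReal e ≤ ∑' k, ENNReal.ofReal (min |y v k ω| δ) := fun v hv => by
        have : ¬((∃ k ≥ K, η ≤ |y v k ω|) ∨ (∃ k, ρ ≤ |y v k ω|) ∨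
          ENNReal.ofReal e ≤ ∑' k, ENNReal.ofReal (min |y v k ω| δ)) := fun h' => hω ⟨v, hv, h'⟩
        rwa [not_or, not_or] at this
      refine (norm_pwitlOperator_sub_quantizedWeight_le (x := fun v k => y v k ω) hL ha hδ he.le
        (fun v hv => (hω' v hv).1) (fun v hv => (hω' v hv).2.1)
        (fun v hv => (not_le.1 (hω' v hv).2.2).le) hφ hS hSh).trans ?_
      gcongr
      linarith
    · refine le_trans (le_of_eq (Finset.sum_congr rfl fun d _ => ?_))
        (sum_abs_jointLabels_sub_le (μ := μ) (ν := νt) hy hlab (fun u => rfl) hc)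
      congr 2
      exact hpres.measureReal_preimage (hDm0 (measurableSet_singleton d)).nullMeasurableSet

end

/-! ### Choice of the parameters -/

theorem exists_lintegral_min_le {m : Measure ℝ} (hm : HasTruncatedMoment m) {ε : ℝ} (hε : 0 < ε) :
    ∃ δ₀ > 0, ∀ δ ≤ δ₀, ∫⁻ x, ENNReal.ofReal (min |x| δ) ∂m ≤ ENNReal.ofReal ε := by
  have hfin : ∫⁻ x, ENNReal.ofReal (min |x| 1) ∂m ≠ ∞ := by
    have := hm.2
    rw [hasFiniteIntegral_iff_ofReal
      (ae_of_all _ fun x => le_min (abs_nonneg x) zero_le_one)] at this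
    exact this.ne
  have hlim := tendsto_lintegral_of_dominated_convergence (μ := m)
    (F := fun (n : ℕ) x => ENNReal.ofReal (min |x| (1 / ((n : ℝ) + 1)))) (f := fun _ => 0)
    (fun x => ENNReal.ofReal (min |x| 1)) (fun n => by fun_prop) (fun n => ae_of_all _ fun x => ?_)
    hfin (ae_of_all _ fun x => ?_)
  · rw [lintegral_zero] at hlim
    obtain ⟨n, hn⟩ := (hlim.eventually (ge_mem_nhds (ENNReal.ofReal_pos.2 hε))).exists
    exact ⟨1 / ((n : ℝ) + 1), by positivity, fun δ hδ => (lintegral_mono fun x =>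
      ENNReal.ofReal_le_ofReal (min_le_min_left _ hδ)).trans hn⟩
  · have : 1 / ((n : ℝ) + 1) ≤ 1 := by
      rw [div_le_one (by positivity)]
      have : (0 : ℝ) ≤ n := n.cast_nonneg
      linarith
    exact ENNReal.ofReal_le_ofReal (min_le_min_left _ this)
  · have h1 : Tendsto (fun n : ℕ => min |x| (1 / ((n : ℝ) + 1))) atTop (𝓝 (min |x| 0)) :=
      tendsto_const_nhds.min tendsto_one_div_add_atTop_nhds_zero_nat
    rw [min_eq_right (abs_nonneg x)] at h1
    simpa using ENNReal.tendsto_ofReal h1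

section

variable {Ω : Type*} [MeasurableSpace Ω] {P : Measure Ω} [IsProbabilityMeasure P]
  {A : (n : ℕ) → Ω → Matrix (Fin n) (Fin n) ℝ} {b : ℝ} {m : Measure ℝ}

/-- The expected number of entries of absolute value at least `η` in a row stays bounded. -/
theorem exists_mul_measureReal_le_abs_le {sigmaSq : ℝ≥0}
    (hA : IsLevyKhintchineEnsemble P A sigmaSq b m)
    (hC1 : ConditionC1 P A m) {η : ℝ} (hη : 0 < η) :
    ∃ C, ∀ n : ℕ, (n + 2) * (entryLaw P A n).real {x | η ≤ |x|} ≤ C := by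
  have hprob := isProbabilityMeasure_entryLaw hA
  obtain ⟨δ, hδ, -, h⟩ := exists_integral_min_le hA hC1 one_pos
  refine ⟨1 / min η δ, fun n => ?_⟩
  have hpos : 0 < min η δ := lt_min hη hδ
  have hint : Integrable (fun x : ℝ => min |x| δ) (entryLaw P A n) := by
    refine Integrable.of_bound (C := δ) (by fun_prop) (ae_of_all _ fun x => ?_)
    rw [Real.norm_of_nonneg (le_min (abs_nonneg _) hδ.le)]
    exact min_le_right _ _
  have h1 := mul_meas_ge_le_integral_of_nonneg
    (ae_of_all _ fun x : ℝ => le_min (abs_nonneg x) hδ.le) hint (min η δ)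
  have h2 : (entryLaw P A n).real {x | η ≤ |x|} ≤
      (entryLaw P A n).real {x | min η δ ≤ min |x| δ} :=
    measureReal_mono fun x hx => min_le_min_right δ hx
  rw [le_div_iff₀ hpos]
  calc (n + 2) * (entryLaw P A n).real {x | η ≤ |x|} * min η δ
      ≤ (n + 2) * (min η δ * (entryLaw P A n).real {x | min η δ ≤ min |x| δ}) := by
        rw [mul_assoc, mul_comm (Measure.real _ _)]
        gcongr
    _ ≤ (n + 2) * ∫ x, min |x| δ ∂entryLaw P A n := by gcongr
    _ ≤ 1 := h n

theorem tendsto_measureReal_le_abs {sigmaSq : ℝ≥0} (hA : IsLevyKhintchineEnsemble P A sigmaSq b m)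
    (hC1 : ConditionC1 P A m) {η : ℝ} (hη : 0 < η) :
    Tendsto (fun n => (entryLaw P A n).real {x | η ≤ |x|}) atTop (𝓝 0) := by
  obtain ⟨C, hC⟩ := exists_mul_measureReal_le_abs_le hA hC1 hη
  have h1 : Tendsto (fun n : ℕ => C / ((n : ℝ) + 2)) atTop (𝓝 0) :=
    tendsto_const_nhds.div_atTop (tendsto_atTop_add_const_right _ _ tendsto_natCast_atTop_atTop)
  refine squeeze_zero (fun n => measureReal_nonneg) (fun n => ?_) h1
  rw [le_div_iff₀ (by positivity), mul_comm]
  exact hC n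

variable {Ω' : Type*} [MeasurableSpace Ω'] {P' : Measure Ω'} [IsProbabilityMeasure P']
  {y : List ℕ → ℕ → Ω' → ℝ}

/-- Probability that one of the first `h` words has a large weight beyond the first `K` children, a huge
weight, or small weights with a large sum. -/
theorem measureReal_exceptional_le (hy : IsPWIT P' m y) (hm : HasTruncatedMoment m) {h K : ℕ}
    {η ρ δ e θ : ℝ} (hδ : 0 ≤ δ) (he : 0 < e) (hθ : 0 ≤ θ) (hρ : 0 < ρ)
    (hK : ∀ u : Fin h, P'.real {ω | ∃ k ≥ K, η ≤ |y (wordEquiv.symm u) k ω|} ≤ θ)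
    (hm₁ : m.real {x | ρ ≤ |x|} ≤ θ)
    (hm₂ : ∫⁻ x, ENNReal.ofReal (min |x| δ) ∂m ≤ ENNReal.ofReal (e * θ)) :
    P'.real {ω | ∃ v, wordEquiv v < h ∧ ((∃ k ≥ K, η ≤ |y v k ω|) ∨ (∃ k, ρ ≤ |y v k ω|) ∨
      ENNReal.ofReal e ≤ ∑' k, ENNReal.ofReal (min |y v k ω| δ))} ≤ h * (3 * θ) := by
  have hsub : {ω | ∃ v, wordEquiv v < h ∧ ((∃ k ≥ K, η ≤ |y v k ω|) ∨ (∃ k, ρ ≤ |y v k ω|) ∨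
      ENNReal.ofReal e ≤ ∑' k, ENNReal.ofReal (min |y v k ω| δ))} ⊆
      ⋃ u ∈ (Finset.univ : Finset (Fin h)), ({ω | ∃ k ≥ K, η ≤ |y (wordEquiv.symm u) k ω|} ∪
        ({ω | ∃ k, ρ ≤ |y (wordEquiv.symm u) k ω|} ∪
        {ω | ENNReal.ofReal e ≤ ∑' k, ENNReal.ofReal (min |y (wordEquiv.symm u) k ω| δ)})) := by
    rintro ω ⟨v, hv, hω⟩
    refine Set.mem_biUnion (Finset.mem_univ (⟨wordEquiv v, hv⟩ : Fin h)) ?_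
    simpa only [Set.mem_union, Set.mem_ofPred_eq, Equiv.symm_apply_apply] using hω
  refine (measureReal_mono hsub (measure_ne_top _ _)).trans ((measureReal_biUnion_finset_le _ _).trans
    ((Finset.sum_le_sum fun u _ => ?_).trans (by simp :
      ∑ _u : Fin h, 3 * θ ≤ h * (3 * θ))))
  have h1 : P'.real {ω | ∃ k, ρ ≤ |y (wordEquiv.symm u) k ω|} ≤ θ :=
    (ENNReal.toReal_mono (measure_le_abs_lt_top hm hρ).ne (measure_exists_le_abs_le hy _ hρ)).trans hm₁
  have h2 : P'.real {ω | ENNReal.ofReal e ≤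
      ∑' k, ENNReal.ofReal (min |y (wordEquiv.symm u) k ω| δ)} ≤ θ := by
    refine ENNReal.toReal_le_of_le_ofReal hθ ?_
    refine (measure_le_tsum_min_le hy _ hδ he).trans ?_
    rw [ENNReal.div_le_iff (ENNReal.ofReal_pos.2 he).ne' ENNReal.ofReal_ne_top,
      ← ENNReal.ofReal_mul hθ, mul_comm θ]
    exact hm₂
  refine (measureReal_union_le _ _).trans ?_
  have h3 := measureReal_union_le (μ := P') {ω | ∃ k, ρ ≤ |y (wordEquiv.symm u) k ω|}
    {ω | ENNReal.ofReal e ≤ ∑' k, ENNReal.ofReal (min |y (wordEquiv.symm u) k ω| δ)}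
  linarith [hK u]

/-- For each number `h` of words and each precision, the matrices of large size can be relabelled so
that their laws are close to the operator of the tree. -/
theorem eventually_exists_coupling (hA : IsLevyKhintchineEnsemble P A 0 b m)
    (hC1 : ConditionC1 P A m) (hy : IsPWIT P' m y) (h : ℕ) {ε : ℝ} (hε : 0 < ε) :
    ∀ᶠ n in atTop, ∃ (W : Type) (_ : MeasurableSpace W) (ν : Measure W) (_ : IsProbabilityMeasure ν)
      (σ : Ω × W → Equiv.Perm (List ℕ)), (∀ u z, MeasurableSet {q | σ q u = z}) ∧
      (∀ q, σ q [] = [0]) ∧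
      AlmostSameLaw (P.prod ν) (fun φ q => (permUnitary (σ q)).symm
        (matrixOperator (laplacianMatrix (A n q.1)) (permUnitary (σ q) φ))) P' y h ε := by
  suffices H : ∀ᶠ n in atTop, ∃ (W : Type) (_ : MeasurableSpace W) (ν : Measure W)
      (_ : IsProbabilityMeasure ν)
      (σ : Ω × W → Equiv.Perm (List ℕ)), (∀ u z, MeasurableSet {q | σ q u = z}) ∧
      (∀ q, σ q [] = [0]) ∧
      AlmostSameLaw (P.prod ν) (fun φ q => (permUnitary (σ q)).symm
        (matrixOperator (laplacianMatrix (A (n + 2) q.1)) (permUnitary (σ q) φ))) P' y h ε by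
    filter_upwards [(tendsto_sub_atTop_nat 2).eventually H, eventually_ge_atTop 2] with n hn h2
    rwa [Nat.sub_add_cancel h2] at hn
  have hm := hasTruncatedMoment_of_conditionC1 hC1
  have hprob := isProbabilityMeasure_entryLaw hA
  -- The deterministic error `4 * (h * max a η' + 2 * (K * a + e))` is at most
  -- `4 * (ε / 16 + 2 * (ε / 32 + ε / 32)) = 3 / 4 * ε`.
  set e : ℝ := ε / 32 with he_def
  have he : 0 < e := by positivity
  -- The exceptional events have probabilities at most `(2 + 5 * h) * θ` and `3 * h * θ`, and the labels
  -- differ by `6 * h * θ`, so that the error is `(2 * (2 + 5 * h) + 6 * h + 6 * h) * θ`.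
  set θ : ℝ := ε / (4 + 22 * h) with hθ_def
  have hθ : 0 < θ := by positivity
  have hθε : (4 + 22 * h) * θ = ε := mul_div_cancel₀ _ (by positivity)
  -- The truncation levels, at the origin and at infinity.
  obtain ⟨δ₁, hδ₁, -, hδ₁'⟩ := exists_integral_min_le hA hC1 (mul_pos he hθ)
  obtain ⟨δ₂, hδ₂, hδ₂'⟩ := exists_lintegral_min_le hm (mul_pos he hθ)
  set δ : ℝ := min δ₁ δ₂ with hδ_def
  have hδ : 0 < δ := lt_min hδ₁ hδ₂
  obtain ⟨ρ, hρ1, hρm, hρn⟩ := exists_tail_le hA hC1 hθ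
  have hρ : 0 < ρ := one_pos.trans_le hρ1
  -- The number of children.
  obtain ⟨K, hK⟩ : ∃ K : ℕ, ∀ u : Fin h,
      P'.real {ω | ∃ k ≥ K, δ / 2 ≤ |y (wordEquiv.symm u) k ω|} ≤ θ := by
    have h1 : ∀ᶠ K : ℕ in atTop, ∀ u : Fin h,
        P' {ω | ∃ k ≥ K, δ / 2 ≤ |y (wordEquiv.symm u) k ω|} ≤ ENNReal.ofReal θ :=
      eventually_all.2 fun u => (tendsto_measure_exists_ge hy hm _ (half_pos hδ)).eventually
        (ge_mem_nhds (ENNReal.ofReal_pos.2 hθ))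
    obtain ⟨K, hK⟩ := h1.exists
    exact ⟨K, fun u => ENNReal.toReal_le_of_le_ofReal hθ.le (hK u)⟩
  -- The cells.
  set a : ℝ := min (ε / (16 * (h + 1))) (ε / (32 * (K + 1))) with ha_def
  have ha : 0 < a := lt_min (by positivity) (by positivity)
  obtain ⟨r, lab, rep, R', hlab, hrep, hR', hcell, hzero, hnull⟩ := exists_cells hm hδ ha ρ
  have hL : IsCellLabelling lab rep (δ / 2) δ ρ a :=
    ⟨hrep, fun x hx => (hcell x hx).1, fun x hx => (hcell x hx).2.2, hzero⟩
  set η' : ℝ := min (δ / 2) (ε / (16 * (h + 1))) with hη_def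
  have hη' : 0 < η' := lt_min (half_pos hδ) (by positivity)
  -- The number of reserved vertices.
  obtain ⟨t, hht, ht, hKt⟩ : ∃ t, h ≤ t ∧ 0 < t ∧ ∀ (u : Fin h) (k : Fin K), childIndex u k < t := by
    refine ⟨h + 1 + (Finset.univ : Finset (Fin h × Fin K)).sup fun p => childIndex p.1 p.2, by omega,
      by omega, fun u k => ?_⟩
    have := Finset.le_sup (f := fun p : Fin h × Fin K => childIndex p.1 p.2)
      (Finset.mem_univ (u, k))
    simp only at this
    omega
  have hdisc : ∀ᶠ n in atTop, ∀ u : Fin h, countDiscrepancy (n + 2) (entryLaw P A n) lab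
      (P'.map fun ω => treeLabels K lab fun k => y (wordEquiv.symm u) k ω) ≤ 3 * θ :=
    eventually_all.2 fun u => eventually_countDiscrepancy_le hA hC1 hy hlab (half_pos hδ) hR'
      (fun x hx => ⟨(hcell x hx).1, (hcell x hx).2.1⟩) hnull _ hθ (hK u)
  -- The number of large entries stays bounded, while a given entry is small with high probability.
  obtain ⟨C, hC⟩ := exists_mul_measureReal_le_abs_le hA hC1 (half_pos hδ)
  have hq := tendsto_measureReal_le_abs hA hC1 hη'
  have hq1 : ∀ᶠ n in atTop, h * (h * (C * (entryLaw P A n).real {x | η' ≤ |x|})) ≤ θ := by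
    have := ((hq.const_mul C).const_mul (h : ℝ)).const_mul (h : ℝ)
    simp only [mul_zero] at this
    exact this.eventually (ge_mem_nhds hθ)
  have hq2 : ∀ᶠ n in atTop, h * (t * (entryLaw P A n).real {x | η' ≤ |x|}) ≤ θ := by
    have := (hq.const_mul (t : ℝ)).const_mul (h : ℝ)
    simp only [mul_zero] at this
    exact this.eventually (ge_mem_nhds hθ)
  filter_upwards [hdisc, hq1, hq2, eventually_ge_atTop t] with n hn1 hn2 hn3 hn4
  refine exists_coupling hy hm (isIIDSymmetric_of_ensemble hA n) hlab hL (η' := η') (min_le_left _ _)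
    hδ.le ha.le he hht (hn4.trans (Nat.le_add_right _ _)) ht hKt hn1
    (θ := (2 + 5 * h) * θ) (θ' := h * (3 * θ)) ?_
    (measureReal_exceptional_le hy hm hδ.le he hθ.le hρ hK hρm (hδ₂' δ (min_le_right _ _))) ?_ ?_
  · push_cast
    have h1 : h * (h * (((n : ℝ) + 2) * ((entryLaw P A n).real {x | δ / 2 ≤ |x|} *
        (entryLaw P A n).real {x | η' ≤ |x|}))) ≤ θ := by
      refine le_trans ?_ hn2
      rw [← mul_assoc ((n : ℝ) + 2)]
      gcongr
      exact hC n
    have h2 : ((n : ℝ) + 2) * (∫ x, min |x| δ ∂entryLaw P A n) / e ≤ θ := by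
      rw [div_le_iff₀ he, mul_comm θ]
      refine le_trans ?_ (hδ₁' n)
      have hint : ∀ z : ℝ, 0 < z → Integrable (fun x : ℝ => min |x| z) (entryLaw P A n) := by
        intro z hz
        refine Integrable.of_bound (C := z) (by fun_prop) (ae_of_all _ fun x => ?_)
        rw [Real.norm_of_nonneg (le_min (abs_nonneg _) hz.le)]
        exact min_le_right _ _
      exact mul_le_mul_of_nonneg_left (integral_mono (hint δ hδ) (hint δ₁ hδ₁)
        fun x => min_le_min_left _ (min_le_left _ _)) (by positivity)
    have h3 : (h : ℝ) * (((n : ℝ) + 2) * (entryLaw P A n).real {x | ρ ≤ |x|} +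
        ((n : ℝ) + 2) * (∫ x, min |x| δ ∂entryLaw P A n) / e) ≤ h * (θ + θ) := by
      gcongr
      exact hρn n
    linarith
  · have h1 : h * max a η' ≤ ε / 16 := by
      have h2 : max a η' ≤ ε / (16 * (h + 1)) := max_le (min_le_left _ _) (min_le_right _ _)
      calc h * max a η' ≤ (h + 1) * (ε / (16 * (h + 1))) := by
            gcongr
            linarith
        _ = ε / 16 := by field_simp
    have h2 : K * a ≤ ε / 32 := by
      calc K * a ≤ (K + 1) * (ε / (32 * (K + 1))) := by
            gcongr
            · linarith
            · exact min_le_right _ _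
        _ = ε / 32 := by field_simp
    rw [he_def]
    linarith
  · linarith

end

/-! ### Passage to the limit -/

theorem exists_tendsto_atTop_of_forall_eventually {p : ℕ → ℕ → Prop}
    (h : ∀ k, ∀ᶠ n in atTop, p k n) :
    ∃ κ : ℕ → ℕ, Tendsto κ atTop atTop ∧ ∀ᶠ n in atTop, p (κ n) n := by
  classical
  choose N hN using fun k => eventually_atTop.1 (h k)
  refine ⟨fun n => Nat.findGreatest (fun k => N k ≤ n) n, tendsto_atTop.2 fun k => ?_, ?_⟩
  · filter_upwards [eventually_ge_atTop (max k (N k))] with n hn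
    exact Nat.le_findGreatest ((le_max_left _ _).trans hn) ((le_max_right _ _).trans hn)
  · filter_upwards [eventually_ge_atTop (N 0)] with n hn
    exact hN _ n (Nat.findGreatest_spec (P := fun k => N k ≤ n) (Nat.zero_le n) hn)

theorem theorem5p1 {Ω : Type*} [MeasurableSpace Ω] (P : Measure Ω) [IsProbabilityMeasure P]
    {Ω' : Type*} [MeasurableSpace Ω'] (P' : Measure Ω') [IsProbabilityMeasure P']
    (A : (n : ℕ) → Ω → Matrix (Fin n) (Fin n) ℝ) (b : ℝ) (m : Measure ℝ)
    (hA : IsLevyKhintchineEnsemble P A 0 b m) (hC1 : ConditionC1 P A m)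
    (y : List ℕ → ℕ → Ω' → ℝ) (hy : IsPWIT P' m y) :
    LocallyConvergesInDistribution P P'
      (fun n ω => matrixOperator (laplacianMatrix (A n ω))) [0]
      (fun ω' => pwitlOperator fun v k => y v k ω') [] := by
  have hm := hasTruncatedMoment_of_conditionC1 hC1
  -- The level `κ n` is both the number of words and the inverse of the precision.
  obtain ⟨κ, hκ, hcoup⟩ := exists_tendsto_atTop_of_forall_eventually fun k =>
    eventually_exists_coupling hA hC1 hy k (ε := 1 / ((k : ℝ) + 1)) (by positivity)
  obtain ⟨n₀, hn₀⟩ := eventually_atTop.1 hcoup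
  -- For small sizes any bijection that maps the root to the first vertex will do.
  have hall : ∀ n, ∃ (W : Type) (_ : MeasurableSpace W) (ν : Measure W) (_ : IsProbabilityMeasure ν)
      (σ : Ω × W → Equiv.Perm (List ℕ)), (∀ u z, MeasurableSet {q | σ q u = z}) ∧
      (∀ q, σ q [] = [0]) ∧ (n₀ ≤ n →
      AlmostSameLaw (P.prod ν) (fun φ q => (permUnitary (σ q)).symm
        (matrixOperator (laplacianMatrix (A n q.1)) (permUnitary (σ q) φ))) P' y (κ n)
        (1 / ((κ n : ℝ) + 1))) := by
    intro n
    by_cases hn : n₀ ≤ n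
    · obtain ⟨W, mW, ν, hν, σ, h1, h2, h3⟩ := hn₀ n hn
      exact ⟨W, mW, ν, hν, σ, h1, h2, fun _ => h3⟩
    · exact ⟨Unit, inferInstance, Measure.dirac (), inferInstance, fun _ => Equiv.swap [] [0],
        fun u z => MeasurableSet.const _, fun _ => Equiv.swap_apply_left _ _,
        fun h => absurd h hn⟩
  choose W mW ν hν σ hσm hroot hlaw using hall
  refine ⟨fun ω => le_rfl, Ω × (∀ n, W n), inferInstance, P.prod (Measure.infinitePi ν), inferInstance,
    Prod.fst, fun n q => σ n (q.1, q.2 n), measurePreserving_fst, ?_, fun n q => hroot n _, ?_⟩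
  · intro n x z
    have : Measurable fun q : Ω × (∀ n, W n) => (q.1, q.2 n) := by fun_prop
    exact this (hσm n x z)
  intro φ hφ
  have hpres : ∀ n, MeasurePreserving (fun q : Ω × (∀ n, W n) => (q.1, q.2 n))
      (P.prod (Measure.infinitePi ν)) (P.prod (ν n)) := fun n =>
    (MeasurePreserving.id P).prod (measurePreserving_eval_infinitePi ν n)
  have hU : ∀ n, AEStronglyMeasurable (fun q : Ω × W n => (permUnitary (σ n q)).symm
      (matrixOperator (laplacianMatrix (A n q.1)) (permUnitary (σ n q) φ))) (P.prod (ν n)) := fun n =>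
    aestronglyMeasurable_conj_matrixOperator
      (fun i j => (hA.measurable_entry n i j).comp measurable_fst) (hσm n) hφ
  have hU' : ∀ n, AEStronglyMeasurable (fun q : Ω × (∀ n, W n) => (permUnitary (σ n (q.1, q.2 n))).symm
      (matrixOperator (laplacianMatrix (A n q.1)) (permUnitary (σ n (q.1, q.2 n)) φ)))
      (P.prod (Measure.infinitePi ν)) := fun n => (hU n).comp_measurePreserving (hpres n)
  have hL := aestronglyMeasurable_pwitlOperator hy hm hφ
  refine ⟨fun n => (hU' n).aemeasurable, hL.aemeasurable, ?_⟩
  refine tendsto_iff_forall_lipschitz_integral_tendsto.2 ?_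
  rintro f ⟨B, hB⟩ ⟨C, hf⟩
  have hB' : ∀ x, |f x| ≤ |f 0| + B := fun x => by
    have h1 := hB x 0
    rw [Real.dist_eq] at h1
    linarith [abs_sub_abs_le_abs_sub (f x) (f 0)]
  obtain ⟨S, hS⟩ := exists_finset_support_subset hφ
  obtain ⟨H, hH⟩ : ∃ H, ∀ v ∈ S, wordEquiv v < H :=
    ⟨S.sup wordEquiv + 1, fun v hv => Nat.lt_succ_of_le (Finset.le_sup (f := wordEquiv) hv)⟩
  have hlim : Tendsto (fun n => 1 / ((κ n : ℝ) + 1) *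
      (C * ∑ v ∈ S, ‖(φ : List ℕ → ℂ) v‖ + (|f 0| + B))) atTop (𝓝 0) := by
    have := (tendsto_one_div_add_atTop_nhds_zero_nat (𝕜 := ℝ)).comp hκ
    simpa using this.mul_const (C * ∑ v ∈ S, ‖(φ : List ℕ → ℂ) v‖ + (|f 0| + B))
  rw [tendsto_iff_dist_tendsto_zero]
  refine squeeze_zero' (Eventually.of_forall fun n => dist_nonneg) ?_ hlim
  filter_upwards [eventually_ge_atTop n₀, hκ.eventually_ge_atTop H] with n hn hn'
  have key := hlaw n hn φ hφ S hS (fun v hv => (hH v hv).trans_le hn') f C _ hf hB'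
  rw [Real.dist_eq]
  convert key using 2
  congr 1
  · refine (integral_map (hU' n).aemeasurable hf.continuous.aestronglyMeasurable).trans ?_
    rw [← (hpres n).map_eq, integral_map (hpres n).aemeasurable]
    rw [(hpres n).map_eq]
    exact hf.continuous.comp_aestronglyMeasurable (hU n)
  · exact integral_map hL.aemeasurable hf.continuous.aestronglyMeasurable

end
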